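/- Let $d\ge 3$, $0\le s<d-2$ and $\sigma>0$, and let $\mathcal M$ be a real $d\times d$ matrix. Let $\mathsf g$ be a real-valued function, smooth on $\mathbb R^d\setminus\{0\}$, such that for every integer $k\ge 0$ there is a constant $C_k$ with $$|\nabla^{\otimes k}\mathsf g(x)|\le C_k\left(\frac1{|x|^{s+k}}+|\log|x||\,\mathbf 1_{s=k=0}\right)\qquad\text{for all }x\ne 0,$$ and such that $\mathcal M:\nabla^{\otimes 2}\mathsf g(x)=\sum_{i,j}\mathcal M_{ij}\,\partial_i\partial_j\mathsf g(x)\ge 0$ for all $x\neq 0$. Let $\mu:[0,\infty)\to L^1(\mathbb R^d)\cap L^\infty(\mathbb R^d)$ be real-valued, continuous in time with values in $L^1$ and locally bounded in time with values in $L^\infty$ (in particular, $\mu$ may be any element of $C([0,\infty);L^1\cap L^\infty)$). Suppose that $\mu$ is a mild solution of $$\partial_t\mu=-\operatorname{div}(\mu\,\mathcal M\nabla\mathsf g*\mu)+\sigma\Delta\mu ,$$ that is, for every $t>0$, $$\mu^t=e^{t\sigma\Delta}\mu^0-\int_0^t e^{(t-\kappa)\sigma\Delta}\operatorname{div}\big(\mu^\kappa\,\mathcal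 M\nabla\mathsf g*\mu^\kappa\big)\,d\kappa\qquad\text{a.e. on }\mathbb R^d,$$ where $e^{\tau\Delta}$ is the heat flow. If $\mathcal M:\nabla^{\otimes2}\mathsf g$ is not identically $0$ on $\mathbb R^d\setminus\{0\}$, assume moreover that $\mu^t\ge 0$ a.e. for all $t\ge0$. Let $1\le p\le q\le\infty$. Then for all $t>0$, $$\|\mu^t\|_{L^q}\le\left(\frac{K(q)}{K(p)}\right)^{\frac d2}\left(\frac{4\pi\sigma t}{1/p-1/q}\right)^{-\frac d2\left(\frac1p-\frac1q\right)}\|\mu^0\|_{L^p},\qquad K(r):=\frac{{r'}^{1/r'}}{r^{1/r}},\quad \frac1r+\frac1{r'}=1,$$ with the conventions $1/\infty=0$ and $\infty^{1/\infty}=1$ (so $K(1)=K(\infty)=1$), and with the second factor read as $1$ when $p=q$. -/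

import Mathlib

open MeasureTheory Set Filter Topology
open scoped ENNReal NNReal ContDiff

noncomputable section

namespace MeanField

/-- Regularity and growth of the interaction potential: `g` is smooth away from the origin (the
value `g 0` plays no role) and, for every `k ≥ 0`, the `k`-th derivative of `g` at `x ≠ 0` is at
most a constant (depending on `k`) times `|x|^{-s-k}`, plus `|log |x||` when `s = k = 0`. -/
structure IsRieszType {d : ℕ} (s : ℝ) (g : EuclideanSpace ℝ (Fin d) → ℝ) : Prop where
  contDiffOn : ContDiffOn ℝ ∞ g {0}ᶜ
  bound : ∀ k : ℕ, ∃ C : ℝ, ∀ x : EuclideanSpace ℝ (Fin d), x ≠ 0 →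
    ‖iteratedFDeriv ℝ k g x‖ ≤
      C * (1 / ‖x‖ ^ (s + k) + (if s = 0 ∧ k = 0 then |Real.log ‖x‖| else 0))

/-- The Frobenius product `M : ∇²g (x) = ∑ i j, M i j * ∂ᵢ∂ⱼ g (x)`. -/
def frobeniusHessian {d : ℕ} (M : Matrix (Fin d) (Fin d) ℝ)
    (g : EuclideanSpace ℝ (Fin d) → ℝ) (x : EuclideanSpace ℝ (Fin d)) : ℝ :=
  ∑ i, ∑ j, M i j *
    iteratedFDeriv ℝ 2 g x ![EuclideanSpace.single i (1 : ℝ), EuclideanSpace.single j (1 : ℝ)]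

/-- The velocity field `(M ∇g) ∗ f (x) = ∫ M ∇g (x - y) f y dy`. -/
def velocity {d : ℕ} (M : Matrix (Fin d) (Fin d) ℝ) (g f : EuclideanSpace ℝ (Fin d) → ℝ)
    (x : EuclideanSpace ℝ (Fin d)) : EuclideanSpace ℝ (Fin d) :=
  ∫ y, f y • Matrix.toEuclideanLin M (gradient g (x - y))

/-- The heat kernel `(4πτ)^{-d/2} exp (-|z|² / (4τ))`, for `τ > 0`. -/
def heatKernel {d : ℕ} (τ : ℝ) (z : EuclideanSpace ℝ (Fin d)) : ℝ :=
  (4 * Real.pi * τ) ^ (-(d : ℝ) / 2) * Real.exp (-‖z‖ ^ 2 / (4 * τ))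

/-- The heat flow `e^{τΔ} f`, for `τ > 0`. -/
def heatFlow {d : ℕ} (τ : ℝ) (f : EuclideanSpace ℝ (Fin d) → ℝ)
    (x : EuclideanSpace ℝ (Fin d)) : ℝ :=
  ∫ y, heatKernel τ (x - y) * f y

/-- `e^{τΔ} div F` for a vector field `F` and `τ > 0`, the derivative falling on the kernel:
`∑ i, (∂ᵢ heatKernel τ) ∗ Fᵢ`. -/
def heatFlowDiv {d : ℕ} (τ : ℝ) (F : EuclideanSpace ℝ (Fin d) → EuclideanSpace ℝ (Fin d))
    (x : EuclideanSpace ℝ (Fin d)) : ℝ :=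
  ∫ y, inner ℝ (gradient (heatKernel τ) (x - y)) (F y)

/-- `μ` is a global mild solution, with initial datum `μ 0`, of
`∂ₜ μ = - div (μ (M ∇g ∗ μ)) + σ Δ μ` on `[0, ∞)`: each `μ t` lies in `L¹ ∩ L^∞`, the map
`t ↦ μ t` is continuous into `L¹` and locally bounded into `L^∞` (both hold if it is continuous
into `L¹ ∩ L^∞`), and the Duhamel formula holds for every `t > 0`. -/
structure IsMildSolution {d : ℕ} (M : Matrix (Fin d) (Fin d) ℝ)
    (g : EuclideanSpace ℝ (Fin d) → ℝ) (σ : ℝ) (μ : ℝ → EuclideanSpace ℝ (Fin d) → ℝ) :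
    Prop where
  memLp_one : ∀ t, 0 ≤ t → MemLp (μ t) 1 volume
  memLp_top : ∀ t, 0 ≤ t → MemLp (μ t) ∞ volume
  continuous_one : ∀ t, 0 ≤ t →
    Tendsto (fun r => eLpNorm (μ r - μ t) 1 volume) (𝓝[Ici 0] t) (𝓝 0)
  bounded_top : ∀ T : ℝ, ∃ C : ℝ≥0, ∀ t ∈ Icc 0 T, eLpNorm (μ t) ∞ volume ≤ C
  duhamel : ∀ t, 0 < t → ∀ᵐ x ∂volume,
    μ t x = heatFlow (t * σ) (μ 0) x
      - ∫ κ in (0 : ℝ)..t, heatFlowDiv ((t - κ) * σ) (fun y => μ κ y • velocity M g (μ κ) y) x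

/-- `K r = r'^{1/r'} / r^{1/r}` for `r ∈ [1, ∞]`, with `r'` the Hölder conjugate of `r`
(`1' = ∞` and `∞' = 1`), where `∞^{1/∞} = ∞^0 = 1`. -/
def K (r : ℝ≥0∞) : ℝ :=
  (r.conjExponent ^ r.conjExponent⁻¹.toReal / r ^ r⁻¹.toReal).toReal

end MeanField

end

/-!
# Sharp smoothing estimates for a mean-field equation with a singular kernel

For a solution `μ`, the velocity `u = (M ∇g) ∗ μ` is bounded and Lipschitz uniformly on bounded time
intervals, because `μ` is integrable and bounded and `s + 2 < d`; its divergence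
`(M : ∇²g) ∗ μ` is nonnegative. Hence `μ` solves a linear equation `∂ₜμ = - div (μ u) + σ Δμ` with
a regular field `u` of nonnegative divergence (`IsMildSolution.isAdvectionDiffusion`), and nothing
else about the kernel is needed.

The estimate is proved in dual form. The dual equation, backward in time, transports a test function
along the flow of `u` and lets it diffuse. Transport along a field of nonnegative divergence does
not increase `L^r` norms, as the Jacobian of the flow is at least `1`, while the heat flow is smoothing
from `L^a` to `L^b` with the sharp constant `smoothingConst`. The two effects are combined by
splitting: the time interval is cut into `n` equal steps, and in each step the test function evolves
by the heat flow and is then composed with `x ↦ x + h u(x)`. Three facts make this work.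

* The pairing with `μ` changes in one step by `o(h)` times the Lipschitz constant of the test
  function (`IsAdvectionDiffusion.exists_step_error_le`), by the Duhamel formula and the `L¹`
  continuity of the flux `μ u` in time and under translations. The Lipschitz constant stays bounded
  over all the steps.
* The Jacobian of one step is at least `1 - o(h)` (`exists_det_ge`), so that the losses in the `L^r`
  norms multiply to a factor tending to `1`.
* When the reciprocal exponent decreases at a constant rate, the sharp constants of the steps
  multiply exactly to the sharp constant of the whole interval (`rateConst_mul`).

In the limit this bounds `∫ φ μ(T)` by the sharp constant times the norms of `φ` and `μ(0)`
(`IsAdvectionDiffusion.ofReal_abs_integral_le`), hence, by the converse of Hölder's inequality, the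
norm of `μ(T)` when `1 < p < q < ∞`. The remaining cases follow by letting the exponents vary, since
the norms of an integrable bounded function and the constant depend continuously on the reciprocal
exponents (`tendsto_eLpNorm_inv_ofReal`, `smoothingConst_eq_exp`).

The sharp smoothing estimate for the heat flow (`eLpNorm_heatFlow_le`) rests on a Gaussian form of
Hölder's inequality (`integral_rpow_mul_rpow_le`): for a centered Gaussian pair `(X, Y)` with
`Var (θ₁⟨u, X⟩ + θ₂⟨v, Y⟩) ≤ θ₁ Var ⟨u, X⟩ + θ₂ Var ⟨v, Y⟩`, one has
`E[f(X)^θ₁ g(Y)^θ₂] ≤ E[f(X)]^θ₁ E[g(Y)]^θ₂`. For a small variance `s²` it holds up to a factor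
`exp (C s³)` by comparing cumulants of order two, and the inequality with that factor is stable under
sums of independent copies; `2ⁿ` copies of variance `2⁻ⁿ` give the factor `exp (C 2^{-n/2})`, which
tends to `1`. Weighting the heat kernel by powers of the marginals of a suitable Gaussian turns it
into the density of that Gaussian (`heatKernel_sub_mul_eq`), which gives the estimate with its
constant.
-/

noncomputable section

namespace MeanField

variable {d : ℕ}

local notation "E" => EuclideanSpace ℝ (Fin d)

/-! ### The heat kernel -/

lemma heatKernel_pos {τ : ℝ} (hτ : 0 < τ) (z : E) : 0 < heatKernel τ z := by
  unfold heatKernel; positivity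

lemma heatKernel_nonneg {τ : ℝ} (hτ : 0 < τ) (z : E) : 0 ≤ heatKernel τ z :=
  (heatKernel_pos hτ z).le

lemma heatKernel_neg (τ : ℝ) (z : E) : heatKernel τ (-z) = heatKernel τ z := by
  simp [heatKernel]

@[fun_prop]
lemma continuous_heatKernel (τ : ℝ) : Continuous (heatKernel τ : E → ℝ) := by
  unfold heatKernel; fun_prop

lemma integral_heatKernel {τ : ℝ} (hτ : 0 < τ) : ∫ z : E, heatKernel τ z = 1 := by
  have h := GaussianFourier.integral_rexp_neg_mul_sq_norm (V := E) (b := 1 / (4 * τ))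
    (by positivity)
  have h2 : ∀ z : E, heatKernel τ z
      = (4 * Real.pi * τ) ^ (-(d : ℝ) / 2) * Real.exp (-(1 / (4 * τ)) * ‖z‖ ^ 2) := by
    intro z; unfold heatKernel; congr 2; ring
  simp_rw [h2]
  rw [integral_const_mul, h, finrank_euclideanSpace_fin,
    show Real.pi / (1 / (4 * τ)) = 4 * Real.pi * τ by field_simp,
    ← Real.rpow_add (by positivity)]
  rw [show -(d : ℝ) / 2 + (d : ℝ) / 2 = 0 by ring, Real.rpow_zero]

lemma integrable_heatKernel {τ : ℝ} (hτ : 0 < τ) : Integrable (heatKernel τ : E → ℝ) :=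
  .of_integral_ne_zero (by rw [integral_heatKernel hτ]; exact one_ne_zero)

/-- Completing the square in a product of two heat kernels. -/
lemma heatKernel_mul_heatKernel {a b : ℝ} (ha : 0 < a) (hb : 0 < b) (x y : E) :
    heatKernel a (x - y) * heatKernel b y
      = heatKernel (a + b) x * heatKernel (a * b / (a + b)) (y - (b / (a + b)) • x) := by
  have hab : 0 < a + b := by positivity
  unfold heatKernel
  rw [mul_mul_mul_comm, mul_mul_mul_comm ((4 * Real.pi * (a + b)) ^ _),
    ← Real.mul_rpow (by positivity) (by positivity), ← Real.mul_rpow (by positivity)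
    (by positivity), ← Real.exp_add, ← Real.exp_add]
  congr 2
  · field_simp
  · have h1 : ‖x - y‖ ^ 2 = ‖x‖ ^ 2 - 2 * inner ℝ x y + ‖y‖ ^ 2 := norm_sub_sq_real x y
    have h2 : ‖y - (b / (a + b)) • x‖ ^ 2
        = ‖y‖ ^ 2 - 2 * (b / (a + b)) * inner ℝ x y + (b / (a + b)) ^ 2 * ‖x‖ ^ 2 := by
      rw [norm_sub_sq_real, real_inner_smul_right, norm_smul, mul_pow, Real.norm_eq_abs, sq_abs,
        real_inner_comm]
      ring
    rw [h1, h2]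
    field_simp
    ring

lemma integral_heatKernel_mul_heatKernel {a b : ℝ} (ha : 0 < a) (hb : 0 < b) (x w : E) :
    ∫ y, heatKernel a (x - y) * heatKernel b (y - w) = heatKernel (a + b) (x - w) := by
  rw [← integral_add_right_eq_self (fun y => heatKernel a (x - y) * heatKernel b (y - w)) w]
  have : ∀ y : E, heatKernel a (x - (y + w)) * heatKernel b (y + w - w)
      = heatKernel (a + b) (x - w)
        * heatKernel (a * b / (a + b)) (y - (b / (a + b)) • (x - w)) := by
    intro y
    rw [← heatKernel_mul_heatKernel ha hb]
    congr 2 <;> abel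
  simp_rw [this]
  rw [integral_const_mul, integral_sub_right_eq_self (fun y => heatKernel (a * b / (a + b)) y),
    integral_heatKernel (by positivity), mul_one]

lemma hasGradientAt_heatKernel {τ : ℝ} (hτ : 0 < τ) (z : E) :
    HasGradientAt (heatKernel τ) (-(heatKernel τ z / (2 * τ)) • z) z := by
  have h1 : HasFDerivAt (fun z : E => ‖z‖ ^ 2) (2 • innerSL ℝ z) z :=
    (hasStrictFDerivAt_norm_sq z).hasFDerivAt
  have h2 := (((h1.neg.mul_const (4 * τ)⁻¹).exp).const_mul ((4 * Real.pi * τ) ^ (-(d : ℝ) / 2)))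
  rw [hasGradientAt_iff_hasFDerivAt]
  have h3 : (heatKernel τ : E → ℝ) = fun z => (4 * Real.pi * τ) ^ (-(d : ℝ) / 2)
      * Real.exp (-‖z‖ ^ 2 * (4 * τ)⁻¹) := by
    ext z; simp [heatKernel, div_eq_mul_inv]
  rw [h3]
  convert! h2 using 1
  ext v
  simp [InnerProductSpace.toDual_apply_apply]
  field_simp
  ring

lemma gradient_heatKernel {τ : ℝ} (hτ : 0 < τ) (z : E) :
    gradient (heatKernel τ) z = -(heatKernel τ z / (2 * τ)) • z :=
  (hasGradientAt_heatKernel hτ z).gradient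

lemma gradient_heatKernel_neg {τ : ℝ} (hτ : 0 < τ) (z : E) :
    gradient (heatKernel τ) (-z) = -gradient (heatKernel τ) z := by
  simp [gradient_heatKernel hτ, heatKernel_neg]

lemma continuous_gradient_heatKernel {τ : ℝ} (hτ : 0 < τ) :
    Continuous (gradient (heatKernel τ) : E → E) := by
  rw [show (gradient (heatKernel τ) : E → E) = fun z => -(heatKernel τ z / (2 * τ)) • z from
    funext (gradient_heatKernel hτ)]
  fun_prop

lemma heatKernel_eq_two_mul {τ : ℝ} (hτ : 0 < τ) (z : E) :
    heatKernel τ z = 2 ^ ((d : ℝ) / 2) * Real.exp (-‖z‖ ^ 2 / (8 * τ)) * heatKernel (2 * τ) z := by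
  unfold heatKernel
  rw [show 4 * Real.pi * (2 * τ) = 2 * (4 * Real.pi * τ) by ring,
    Real.mul_rpow (x := 2) (y := 4 * Real.pi * τ) (by positivity) (by positivity)]
  have h1 : (2 : ℝ) ^ ((d : ℝ) / 2) * 2 ^ (-(d : ℝ) / 2) = 1 := by
    rw [← Real.rpow_add (by positivity), show (d : ℝ) / 2 + -(d : ℝ) / 2 = 0 by ring,
      Real.rpow_zero]
  have h2 : Real.exp (-‖z‖ ^ 2 / (4 * τ))
      = Real.exp (-‖z‖ ^ 2 / (8 * τ)) * Real.exp (-‖z‖ ^ 2 / (4 * (2 * τ))) := by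
    rw [← Real.exp_add]; congr 1; field_simp; ring
  rw [h2]
  linear_combination (-((4 * Real.pi * τ) ^ (-(d : ℝ) / 2) * (Real.exp (-‖z‖ ^ 2 / (8 * τ)) *
    Real.exp (-‖z‖ ^ 2 / (4 * (2 * τ)))))) * h1

lemma norm_gradient_heatKernel_le {τ : ℝ} (hτ : 0 < τ) (z : E) :
    ‖gradient (heatKernel τ) z‖ ≤ 2 ^ ((d : ℝ) / 2) / √τ * heatKernel (2 * τ) z := by
  rw [gradient_heatKernel hτ, norm_smul, norm_neg, Real.norm_eq_abs, abs_of_nonneg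
    (div_nonneg (heatKernel_nonneg hτ z) (by positivity)), heatKernel_eq_two_mul hτ]
  have hG := heatKernel_nonneg (τ := 2 * τ) (by positivity) z
  have hs : 0 < √τ := Real.sqrt_pos.2 hτ
  have hss : √τ * √τ = τ := Real.mul_self_sqrt hτ.le
  set w := ‖z‖ / √τ with hw
  have hz : ‖z‖ = w * √τ := by rw [hw]; field_simp
  have hw0 : 0 ≤ w := by positivity
  have key : w / 2 * Real.exp (-w ^ 2 / 8) ≤ 1 := by
    have h1 : w / 2 ≤ Real.exp (w ^ 2 / 8) := by
      nlinarith [Real.add_one_le_exp (w ^ 2 / 8), sq_nonneg (w - 2)]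
    calc w / 2 * Real.exp (-w ^ 2 / 8) ≤ Real.exp (w ^ 2 / 8) * Real.exp (-w ^ 2 / 8) := by gcongr
      _ = 1 := by rw [← Real.exp_add]; simp [neg_div]
  have he : Real.exp (-‖z‖ ^ 2 / (8 * τ)) = Real.exp (-w ^ 2 / 8) := by
    congr 1; rw [hz, mul_pow, Real.sq_sqrt hτ.le]; field_simp
  rw [he, hz]
  calc 2 ^ ((d : ℝ) / 2) * Real.exp (-w ^ 2 / 8) * heatKernel (2 * τ) z / (2 * τ) * (w * √τ)
      = (w / 2 * Real.exp (-w ^ 2 / 8)) * (2 ^ ((d : ℝ) / 2) / √τ * heatKernel (2 * τ) z) := by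
        field_simp
        rw [Real.sq_sqrt hτ.le]
        ring
    _ ≤ 1 * (2 ^ ((d : ℝ) / 2) / √τ * heatKernel (2 * τ) z) := by gcongr
    _ = _ := one_mul _

lemma integrable_gradient_heatKernel {τ : ℝ} (hτ : 0 < τ) :
    Integrable (gradient (heatKernel τ) : E → E) := by
  refine Integrable.mono' ((integrable_heatKernel (d := d) (τ := 2 * τ) (by positivity)).const_mul
    (2 ^ ((d : ℝ) / 2) / √τ)) (continuous_gradient_heatKernel hτ).aestronglyMeasurable ?_
  exact .of_forall fun z => norm_gradient_heatKernel_le hτ z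

lemma integral_norm_gradient_heatKernel_le {τ : ℝ} (hτ : 0 < τ) :
    ∫ z : E, ‖gradient (heatKernel τ) z‖ ≤ 2 ^ ((d : ℝ) / 2) / √τ := by
  calc ∫ z : E, ‖gradient (heatKernel τ) z‖
      ≤ ∫ z : E, 2 ^ ((d : ℝ) / 2) / √τ * heatKernel (2 * τ) z :=
        integral_mono (integrable_gradient_heatKernel hτ).norm
          ((integrable_heatKernel (by positivity)).const_mul _)
          fun z => norm_gradient_heatKernel_le hτ z
    _ = _ := by rw [integral_const_mul, integral_heatKernel (by positivity), mul_one]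

lemma norm_mul_heatKernel {τ : ℝ} (hτ : 0 < τ) (z : E) :
    ‖z‖ * heatKernel τ z = 2 * τ * ‖gradient (heatKernel τ) z‖ := by
  rw [gradient_heatKernel hτ, norm_smul, norm_neg, Real.norm_eq_abs, abs_of_nonneg
    (div_nonneg (heatKernel_nonneg hτ z) (by positivity))]
  field_simp

lemma integrable_norm_mul_heatKernel {τ : ℝ} (hτ : 0 < τ) :
    Integrable (fun z : E => ‖z‖ * heatKernel τ z) := by
  simp_rw [norm_mul_heatKernel hτ]
  exact (integrable_gradient_heatKernel hτ).norm.const_mul _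

lemma integral_norm_mul_heatKernel_le {τ : ℝ} (hτ : 0 < τ) :
    ∫ z : E, ‖z‖ * heatKernel τ z ≤ 2 * 2 ^ ((d : ℝ) / 2) * √τ := by
  simp_rw [norm_mul_heatKernel hτ]
  rw [integral_const_mul]
  have hs : 0 < √τ := Real.sqrt_pos.2 hτ
  have hss : √τ * √τ = τ := Real.mul_self_sqrt hτ.le
  calc 2 * τ * ∫ z : E, ‖gradient (heatKernel τ) z‖ ≤ 2 * τ * (2 ^ ((d : ℝ) / 2) / √τ) := by
        gcongr; exact integral_norm_gradient_heatKernel_le hτ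
    _ = _ := by
      field_simp
      rw [Real.sq_sqrt hτ.le]

/-- A heat kernel near a point is dominated by a wider heat kernel at that point. -/
lemma heatKernel_le_of_norm_sub_le {τ : ℝ} (hτ : 0 < τ) {z w : E} (h : ‖z - w‖ ≤ 1) :
    heatKernel τ z ≤ 2 ^ ((d : ℝ) / 2) * Real.exp (1 / (4 * τ)) * heatKernel (2 * τ) w := by
  unfold heatKernel
  rw [show 4 * Real.pi * (2 * τ) = 2 * (4 * Real.pi * τ) by ring,
    Real.mul_rpow (x := 2) (y := 4 * Real.pi * τ) (by positivity) (by positivity)]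
  have h1 : (2 : ℝ) ^ ((d : ℝ) / 2) * 2 ^ (-(d : ℝ) / 2) = 1 := by
    rw [← Real.rpow_add (by positivity), show (d : ℝ) / 2 + -(d : ℝ) / 2 = 0 by ring,
      Real.rpow_zero]
  have h2 : Real.exp (-‖z‖ ^ 2 / (4 * τ))
      ≤ Real.exp (1 / (4 * τ)) * Real.exp (-‖w‖ ^ 2 / (4 * (2 * τ))) := by
    rw [← Real.exp_add]
    apply Real.exp_le_exp.2
    have h3 : ‖w‖ ≤ ‖z‖ + 1 := by
      have := norm_sub_norm_le w z
      rw [norm_sub_rev] at this; linarith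
    have h4 : ‖w‖ ^ 2 ≤ 2 * ‖z‖ ^ 2 + 2 := by
      nlinarith [norm_nonneg w, norm_nonneg z, sq_nonneg (‖z‖ - 1)]
    have : (1 / (4 * τ) + -‖w‖ ^ 2 / (4 * (2 * τ))) - (-‖z‖ ^ 2 / (4 * τ))
        = (2 * ‖z‖ ^ 2 + 2 - ‖w‖ ^ 2) / (8 * τ) := by field_simp; ring
    have h5 : 0 ≤ (2 * ‖z‖ ^ 2 + 2 - ‖w‖ ^ 2) / (8 * τ) := div_nonneg (by linarith) (by positivity)
    linarith
  calc _ ≤ (4 * Real.pi * τ) ^ (-(d : ℝ) / 2) * (Real.exp (1 / (4 * τ)) *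
        Real.exp (-‖w‖ ^ 2 / (4 * (2 * τ)))) := by gcongr
    _ = _ := by
      linear_combination (-((4 * Real.pi * τ) ^ (-(d : ℝ) / 2) * (Real.exp (1 / (4 * τ)) *
        Real.exp (-‖w‖ ^ 2 / (4 * (2 * τ)))))) * h1

/-! ### The heat flow of bounded and of Lipschitz functions -/

lemma heatFlow_eq_integral_sub (τ : ℝ) (f : E → ℝ) (x : E) :
    heatFlow τ f x = ∫ z, heatKernel τ z * f (x - z) := by
  unfold heatFlow
  rw [← integral_sub_left_eq_self (fun y => heatKernel τ (x - y) * f y) volume x]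
  simp

lemma heatFlow_eq_integral_add (τ : ℝ) (f : E → ℝ) (x : E) :
    heatFlow τ f x = ∫ z, heatKernel τ z * f (x + z) := by
  rw [heatFlow_eq_integral_sub, ← integral_neg_eq_self]
  simp [heatKernel_neg]

/-- The convolution of `φ` with the gradient of the heat kernel, which is the gradient of the
heat flow of `φ`. -/
def heatFlowGrad (τ : ℝ) (φ : E → ℝ) (x : E) : E :=
  ∫ y, φ y • gradient (heatKernel τ) (x - y)

lemma heatFlowGrad_eq_integral_sub (τ : ℝ) (φ : E → ℝ) (x : E) :
    heatFlowGrad τ φ x = ∫ z, φ (x - z) • gradient (heatKernel τ) z := by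
  unfold heatFlowGrad
  rw [← integral_sub_left_eq_self (fun y => φ y • gradient (heatKernel τ) (x - y)) volume x]
  simp

section Bounded

variable {τ B : ℝ}

lemma integrable_heatKernel_mul {φ : E → ℝ} (hτ : 0 < τ) (hφ : Continuous φ) (hB : ∀ x, |φ x| ≤ B) :
    Integrable (fun z => heatKernel τ z * φ z) := by
  refine (integrable_heatKernel hτ).mul_bdd (c := B) hφ.aestronglyMeasurable ?_
  exact .of_forall hB

lemma integrable_heatKernel_sub_mul {φ : E → ℝ} (hτ : 0 < τ) (hφ : Continuous φ) (hB : ∀ x, |φ x| ≤ B)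
    (x : E) : Integrable (fun y => heatKernel τ (x - y) * φ y) := by
  refine ((integrable_heatKernel hτ).comp_sub_left x).mul_bdd (c := B) hφ.aestronglyMeasurable ?_
  exact .of_forall hB

lemma abs_heatFlow_le {φ : E → ℝ} (hτ : 0 < τ) (hB : ∀ x, |φ x| ≤ B) (x : E) :
    |heatFlow τ φ x| ≤ B := by
  rw [heatFlow_eq_integral_sub]
  calc |∫ z, heatKernel τ z * φ (x - z)| ≤ ∫ z : E, heatKernel τ z * B := by
        rw [← Real.norm_eq_abs]
        refine norm_integral_le_of_norm_le ((integrable_heatKernel hτ).mul_const B)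
          (.of_forall fun z => ?_)
        rw [norm_mul, Real.norm_of_nonneg (heatKernel_nonneg hτ z)]
        exact mul_le_mul_of_nonneg_left (hB _) (heatKernel_nonneg hτ z)
    _ = B := by rw [integral_mul_const, integral_heatKernel hτ, one_mul]

lemma hasGradientAt_heatFlow {φ : E → ℝ} (hτ : 0 < τ) (hφ : Continuous φ) (hB : ∀ x, |φ x| ≤ B) (x : E) :
    HasGradientAt (heatFlow τ φ) (heatFlowGrad τ φ x) x := by
  have hB0 : 0 ≤ B := (abs_nonneg _).trans (hB 0)
  set c : ℝ := 2 ^ ((d : ℝ) / 2) / √τ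
  set c' : ℝ := 2 ^ ((d : ℝ) / 2) * Real.exp (1 / (4 * (2 * τ)))
  set F' : E → E → (E →L[ℝ] ℝ) := fun w y =>
    φ y • InnerProductSpace.toDual ℝ E (gradient (heatKernel τ) (w - y)) with hF'
  have key : HasFDerivAt (fun w => ∫ y, heatKernel τ (w - y) * φ y) (∫ y, F' x y) x := by
    refine hasFDerivAt_integral_of_dominated_of_fderiv_le (F' := F')
      (bound := fun y => B * (c * (c' * heatKernel (2 * (2 * τ)) (x - y))))
      (Metric.ball_mem_nhds x one_pos) ?_ ?_ ?_ ?_ ?_ ?_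
    · exact .of_forall fun w => (integrable_heatKernel_sub_mul hτ hφ hB w).aestronglyMeasurable
    · exact integrable_heatKernel_sub_mul hτ hφ hB x
    · have := continuous_gradient_heatKernel (d := d) hτ
      apply Continuous.aestronglyMeasurable
      simp only [hF']
      fun_prop
    · refine .of_forall fun y w hw => ?_
      simp only [hF', norm_smul, LinearIsometryEquiv.norm_map, Real.norm_eq_abs]
      refine mul_le_mul (hB y) ?_ (norm_nonneg _) hB0
      refine (norm_gradient_heatKernel_le hτ _).trans ?_
      refine mul_le_mul_of_nonneg_left ?_ (by positivity)
      refine heatKernel_le_of_norm_sub_le (by positivity) ?_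
      rw [sub_sub_sub_cancel_right, ← dist_eq_norm]
      exact (Metric.mem_ball.1 hw).le
    · exact ((((integrable_heatKernel (by positivity)).comp_sub_left x).const_mul _).const_mul
        _).const_mul _
    · refine .of_forall fun y w _ => ?_
      have h1 : HasFDerivAt (fun w => heatKernel τ (w - y))
          (InnerProductSpace.toDual ℝ E (gradient (heatKernel τ) (w - y))) w := by
        have h2 := (hasGradientAt_heatKernel hτ (w - y)).differentiableAt.hasGradientAt.hasFDerivAt
        exact h2.comp w ((hasFDerivAt_id w).sub_const y)
      exact h1.mul_const (φ y)
  rw [hasGradientAt_iff_hasFDerivAt]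
  convert! key using 1
  unfold heatFlowGrad
  have hint : Integrable (fun y => φ y • gradient (heatKernel τ) (x - y)) :=
    ((integrable_gradient_heatKernel hτ).comp_sub_left x).bdd_smul B
      hφ.aestronglyMeasurable (.of_forall hB)
  have := (InnerProductSpace.toDual ℝ E).toContinuousLinearEquiv.toContinuousLinearMap
    |>.integral_comp_comm hint
  refine this.symm.trans ?_
  refine integral_congr_ae (.of_forall fun y => ?_)
  simp [hF']

lemma continuous_heatFlow {φ : E → ℝ} (hτ : 0 < τ) (hφ : Continuous φ) (hB : ∀ x, |φ x| ≤ B) :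
    Continuous (heatFlow τ φ) :=
  continuous_iff_continuousAt.2 fun x => (hasGradientAt_heatFlow hτ hφ hB x).continuousAt

lemma continuous_heatFlowGrad {φ : E → ℝ} (hτ : 0 < τ) (hφ : Continuous φ)
    (hB : ∀ x, |φ x| ≤ B) : Continuous (heatFlowGrad τ φ) := by
  have hG := continuous_gradient_heatKernel (d := d) hτ
  rw [show heatFlowGrad τ φ = fun x => ∫ z, φ (x - z) • gradient (heatKernel τ) z from
    funext (heatFlowGrad_eq_integral_sub τ φ)]
  refine continuous_of_dominated (bound := fun z => B * ‖gradient (heatKernel τ) z‖)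
    (fun x => Continuous.aestronglyMeasurable (by fun_prop)) (fun x => .of_forall fun z => ?_)
    ((integrable_gradient_heatKernel hτ).norm.const_mul B) (.of_forall fun z => by fun_prop)
  rw [norm_smul]
  exact mul_le_mul_of_nonneg_right (hB _) (norm_nonneg _)

lemma norm_heatFlowGrad_le {φ : E → ℝ} (hτ : 0 < τ) (hB : ∀ x, |φ x| ≤ B) (x : E) :
    ‖heatFlowGrad τ φ x‖ ≤ B * (2 ^ ((d : ℝ) / 2) / √τ) := by
  have hB0 : 0 ≤ B := (abs_nonneg _).trans (hB 0)
  rw [heatFlowGrad_eq_integral_sub]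
  calc _ ≤ ∫ z : E, B * ‖gradient (heatKernel τ) z‖ := by
        refine norm_integral_le_of_norm_le ((integrable_gradient_heatKernel hτ).norm.const_mul B)
          (.of_forall fun z => ?_)
        rw [norm_smul]
        exact mul_le_mul_of_nonneg_right (hB _) (norm_nonneg _)
    _ ≤ _ := by
        rw [integral_const_mul]
        exact mul_le_mul_of_nonneg_left (integral_norm_gradient_heatKernel_le hτ) hB0

/-- The mean value inequality for a function with a bounded gradient. -/
lemma abs_sub_le_of_hasGradientAt {f : E → ℝ} {f' : E → E} {C : ℝ}
    (hf : ∀ x, HasGradientAt f (f' x) x) (hC : ∀ x, ‖f' x‖ ≤ C) (x y : E) :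
    |f x - f y| ≤ C * ‖x - y‖ := by
  have := convex_univ.norm_image_sub_le_of_norm_hasFDerivWithin_le (𝕜 := ℝ) (f := f)
    (f' := fun x => InnerProductSpace.toDual ℝ E (f' x)) (C := C)
    (fun x _ => (hf x).hasFDerivAt.hasFDerivWithinAt) (fun x _ => by simpa using hC x)
    (mem_univ y) (mem_univ x)
  simpa using this

/-- First order Taylor expansion of a function with a Lipschitz gradient. -/
lemma abs_taylor_le_of_hasGradientAt {f : E → ℝ} {f' : E → E} {C : ℝ}
    (hf : ∀ x, HasGradientAt f (f' x) x) (hC : ∀ x y, ‖f' x - f' y‖ ≤ C * ‖x - y‖) (x z : E) :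
    |f (x + z) - f x - inner ℝ (f' x) z| ≤ C * ‖z‖ ^ 2 := by
  rcases eq_or_ne z 0 with rfl | hz
  · simp
  have hz' : 0 < ‖z‖ := norm_pos_iff.2 hz
  have hC0 : 0 ≤ C := by
    have := (norm_nonneg _).trans (hC (x + z) x)
    rw [add_sub_cancel_left] at this
    exact nonneg_of_mul_nonneg_left this hz'
  have := (convex_closedBall x ‖z‖).norm_image_sub_le_of_norm_hasFDerivWithin_le' (𝕜 := ℝ)
    (f := f) (f' := fun x => InnerProductSpace.toDual ℝ E (f' x))
    (φ := InnerProductSpace.toDual ℝ E (f' x)) (C := C * ‖z‖) (x := x) (y := x + z)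
    (fun y _ => (hf y).hasFDerivAt.hasFDerivWithinAt) (fun y hy => by
      rw [← map_sub, LinearIsometryEquiv.norm_map]
      refine (hC y x).trans ?_
      gcongr
      simpa [dist_eq_norm] using hy) (by simp) (by simp)
  simp only [add_sub_cancel_left, InnerProductSpace.toDual_apply_apply, Real.norm_eq_abs] at this
  calc _ ≤ C * ‖z‖ * ‖z‖ := this
    _ = _ := by ring

lemma abs_heatFlow_sub_le {φ : E → ℝ} (hτ : 0 < τ) (hφ : Continuous φ) (hB : ∀ x, |φ x| ≤ B) (x y : E) :
    |heatFlow τ φ x - heatFlow τ φ y| ≤ B * (2 ^ ((d : ℝ) / 2) / √τ) * ‖x - y‖ :=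
  abs_sub_le_of_hasGradientAt (hasGradientAt_heatFlow hτ hφ hB) (norm_heatFlowGrad_le hτ hB) x y

lemma heatFlow_heatFlow {φ : E → ℝ} {a b : ℝ} (ha : 0 < a) (hb : 0 < b) (hφ : Continuous φ)
    (hB : ∀ x, |φ x| ≤ B) (x : E) :
    heatFlow a (heatFlow b φ) x = heatFlow (a + b) φ x := by
  unfold heatFlow
  simp_rw [← integral_const_mul]
  rw [integral_integral_swap]
  · refine integral_congr_ae (.of_forall fun w => ?_)
    simp only
    rw [← integral_heatKernel_mul_heatKernel ha hb, ← integral_mul_const]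
    refine integral_congr_ae (.of_forall fun y => ?_)
    simp only; ring
  · have h2 : Integrable (fun p : E × E => heatKernel a (x - p.1) * heatKernel b (p.1 - p.2))
        (volume.prod volume) := by
      refine ((((integrable_heatKernel ha).comp_sub_left x).convolution_integrand
        (ContinuousLinearMap.mul ℝ ℝ) (integrable_heatKernel hb)).swap).congr
        (.of_forall fun p => ?_)
      simp [← heatKernel_neg b (p.1 - p.2)]
    have h4 := h2.mul_bdd (c := B) (g := fun p => φ p.2)
      (by fun_prop) (.of_forall fun p => hB _)
    refine h4.congr (.of_forall fun p => ?_)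
    simp [Function.uncurry, mul_assoc]

end Bounded

section Lipschitz

variable {τ B K : ℝ}

lemma heatFlow_sub_le_of_lipschitz {φ : E → ℝ} (hτ : 0 < τ) (hφ : Continuous φ) (hB : ∀ x, |φ x| ≤ B)
    (hK : ∀ x y, |φ x - φ y| ≤ K * ‖x - y‖) (x y : E) :
    |heatFlow τ φ x - heatFlow τ φ y| ≤ K * ‖x - y‖ := by
  have hi : ∀ x, Integrable (fun z => heatKernel τ z * φ (x - z)) := fun x =>
    integrable_heatKernel_mul hτ (by fun_prop) (fun z => hB (x - z))
  rw [heatFlow_eq_integral_sub, heatFlow_eq_integral_sub, ← integral_sub (hi x) (hi y)]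
  calc _ ≤ ∫ z : E, heatKernel τ z * (K * ‖x - y‖) := by
        rw [← Real.norm_eq_abs]
        refine norm_integral_le_of_norm_le ((integrable_heatKernel hτ).mul_const _)
          (.of_forall fun z => ?_)
        rw [← mul_sub, norm_mul, Real.norm_of_nonneg (heatKernel_nonneg hτ z)]
        refine mul_le_mul_of_nonneg_left ?_ (heatKernel_nonneg hτ z)
        simpa using hK (x - z) (y - z)
    _ = _ := by rw [integral_mul_const, integral_heatKernel hτ, one_mul]

lemma norm_gradient_le_of_lipschitz {f : E → ℝ} {v x : E} (hf : HasGradientAt f v x)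
    (hK0 : 0 ≤ K) (hK : ∀ x y, |f x - f y| ≤ K * ‖x - y‖) : ‖v‖ ≤ K := by
  have h : LipschitzWith K.toNNReal f := LipschitzWith.of_dist_le_mul fun x y => by
    rw [Real.coe_toNNReal K hK0, dist_eq_norm, dist_eq_norm]; exact hK x y
  have := hf.hasFDerivAt.le_of_lipschitz h
  rwa [LinearIsometryEquiv.norm_map, Real.coe_toNNReal K hK0] at this

lemma norm_heatFlowGrad_le_of_lipschitz {φ : E → ℝ} (hτ : 0 < τ) (hφ : Continuous φ) (hB : ∀ x, |φ x| ≤ B)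
    (hK0 : 0 ≤ K) (hK : ∀ x y, |φ x - φ y| ≤ K * ‖x - y‖) (x : E) :
    ‖heatFlowGrad τ φ x‖ ≤ K :=
  norm_gradient_le_of_lipschitz (hasGradientAt_heatFlow hτ hφ hB x) hK0
    (heatFlow_sub_le_of_lipschitz hτ hφ hB hK)

lemma norm_heatFlowGrad_sub_le {φ : E → ℝ} (hτ : 0 < τ) (hφ : Continuous φ) (hB : ∀ x, |φ x| ≤ B)
    (hK0 : 0 ≤ K) (hK : ∀ x y, |φ x - φ y| ≤ K * ‖x - y‖) (x y : E) :
    ‖heatFlowGrad τ φ x - heatFlowGrad τ φ y‖ ≤ K * (2 ^ ((d : ℝ) / 2) / √τ) * ‖x - y‖ := by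
  have hi : ∀ x, Integrable (fun z => φ (x - z) • gradient (heatKernel τ) z) := fun x =>
    (integrable_gradient_heatKernel hτ).bdd_smul B
      (hφ.comp (continuous_sub_left x)).aestronglyMeasurable (.of_forall fun z => hB (x - z))
  rw [heatFlowGrad_eq_integral_sub, heatFlowGrad_eq_integral_sub, ← integral_sub (hi x) (hi y)]
  calc _ ≤ ∫ z : E, K * ‖x - y‖ * ‖gradient (heatKernel τ) z‖ := by
        refine norm_integral_le_of_norm_le ((integrable_gradient_heatKernel hτ).norm.const_mul _)
          (.of_forall fun z => ?_)
        rw [← sub_smul, norm_smul]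
        refine mul_le_mul_of_nonneg_right ?_ (norm_nonneg _)
        simpa using hK (x - z) (y - z)
    _ ≤ K * ‖x - y‖ * (2 ^ ((d : ℝ) / 2) / √τ) := by
        rw [integral_const_mul]
        exact mul_le_mul_of_nonneg_left (integral_norm_gradient_heatKernel_le hτ) (by positivity)
    _ = _ := by ring

/-- The gradient commutes with the heat flow. -/
lemma heatFlowGrad_add {φ : E → ℝ} {a b : ℝ} (ha : 0 < a) (hb : 0 < b) (hφ : Continuous φ)
    (hB : ∀ x, |φ x| ≤ B) (x : E) :
    heatFlowGrad (b + a) φ x = ∫ z, heatKernel b z • heatFlowGrad a φ (x - z) := by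
  have hc := continuous_heatFlow ha hφ hB
  have hB' := abs_heatFlow_le (τ := a) ha hB
  have h1 := hasGradientAt_heatFlow (add_pos hb ha) hφ hB x
  have h0 : heatFlow (b + a) φ = fun x => ∫ z, heatKernel b z * heatFlow a φ (x - z) := by
    ext w
    rw [← heatFlow_heatFlow hb ha hφ hB, heatFlow_eq_integral_sub]
  have hgc : Continuous (heatFlowGrad a φ) := continuous_heatFlowGrad ha hφ hB
  have hi : Integrable (fun z => heatKernel b z • heatFlowGrad a φ (x - z)) :=
    (integrable_heatKernel hb).smul_bdd (B * (2 ^ ((d : ℝ) / 2) / √a))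
      (Continuous.aestronglyMeasurable (by fun_prop))
      (.of_forall fun z => norm_heatFlowGrad_le ha hB _)
  set F' : E → E → (E →L[ℝ] ℝ) := fun w z =>
    heatKernel b z • InnerProductSpace.toDual ℝ E (heatFlowGrad a φ (w - z)) with hF'
  have key : HasFDerivAt (fun w => ∫ z, heatKernel b z * heatFlow a φ (w - z))
      (∫ z, F' x z) x := by
    refine hasFDerivAt_integral_of_dominated_of_fderiv_le (F' := F')
      (bound := fun z => heatKernel b z * (B * (2 ^ ((d : ℝ) / 2) / √a))) univ_mem
      ?_ ?_ ?_ ?_ ?_ ?_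
    · exact .of_forall fun w => (integrable_heatKernel_mul hb (φ := fun z => heatFlow a φ (w - z))
        (by fun_prop) (fun z => hB' _)).aestronglyMeasurable
    · exact integrable_heatKernel_mul hb (φ := fun z => heatFlow a φ (x - z))
        (by fun_prop) (fun z => hB' _)
    · apply Continuous.aestronglyMeasurable
      simp only [hF']
      fun_prop
    · refine .of_forall fun z w _ => ?_
      simp only [hF', norm_smul, LinearIsometryEquiv.norm_map]
      rw [Real.norm_of_nonneg (heatKernel_nonneg hb z)]
      exact mul_le_mul_of_nonneg_left (norm_heatFlowGrad_le ha hB _) (heatKernel_nonneg hb z)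
    · exact (integrable_heatKernel hb).mul_const _
    · refine .of_forall fun z w _ => ?_
      have h2 := (hasGradientAt_heatFlow ha hφ hB (w - z)).hasFDerivAt
      exact (h2.comp w ((hasFDerivAt_id w).sub_const z)).const_mul (heatKernel b z)
  have h3 : HasGradientAt (heatFlow (b + a) φ) (∫ z, heatKernel b z • heatFlowGrad a φ (x - z)) x := by
    rw [hasGradientAt_iff_hasFDerivAt, h0]
    convert! key using 1
    have := (InnerProductSpace.toDual ℝ E).toContinuousLinearEquiv.toContinuousLinearMap
      |>.integral_comp_comm hi
    refine this.symm.trans ?_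
    refine integral_congr_ae (.of_forall fun y => ?_)
    simp [hF']
  exact h1.unique h3

end Lipschitz

/-! ### Hölder inequalities for correlated Gaussian vectors -/

section Gaussian

open ProbabilityTheory

/-- Rotation invariance of a centered Gaussian measure: the sum of two independent copies is
distributed as `√2` times one copy. -/
lemma integral_integral_add_gaussian {V : Type*} [NormedAddCommGroup V] [NormedSpace ℝ V]
    [MeasurableSpace V] [BorelSpace V] [SecondCountableTopology V] [CompleteSpace V]
    {Γ : Measure V} [IsGaussian Γ] (h0 : ∫ x, x ∂Γ = 0) {H : V → ℝ} (hH : Continuous H) {B : ℝ}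
    (hB : ∀ v, |H v| ≤ B) (s : ℝ) :
    ∫ z, ∫ w, H (s • z + s • w) ∂Γ ∂Γ = ∫ z, H ((√2 * s) • z) ∂Γ := by
  have hrot := IsGaussian.map_rotation_eq_self (μ := Γ) (by simpa using h0) (Real.pi / 4)
  have h1 : ∫ z, H ((√2 * s) • z) ∂Γ = ∫ p, H ((√2 * s) • p.1) ∂(Γ.prod Γ) := by
    rw [integral_fun_fst (fun z => H ((√2 * s) • z))]; simp
  have h2 : Integrable (fun p : V × V => H (s • p.1 + s • p.2)) (Γ.prod Γ) :=
    Integrable.of_bound (Continuous.aestronglyMeasurable (by fun_prop)) B (.of_forall fun p => hB _)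
  -- the rotation by `π / 4` sends `(z, w)` to `((z + w) / √2, (w - z) / √2)`
  rw [h1, ← hrot, integral_map (ContinuousLinearMap.continuous _).aemeasurable
    (Continuous.aestronglyMeasurable (by fun_prop)), ← integral_prod _ h2]
  refine integral_congr_ae (.of_forall fun p => ?_)
  simp only [ContinuousLinearMap.rotation_apply, Real.cos_pi_div_four, Real.sin_pi_div_four]
  congr 1
  have : √2 * √2 = 2 := Real.mul_self_sqrt (by norm_num)
  rw [smul_add, smul_smul, smul_smul, show √2 * s * (√2 / 2) = s by
    rw [show √2 * s * (√2 / 2) = (√2 * √2) * s / 2 by ring, this]; ring]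

lemma abs_exp_sub_quadratic_le (w : ℝ) :
    |Real.exp w - 1 - w - w ^ 2 / 2| ≤ |w| ^ 3 * Real.exp |w| := by
  have := Complex.norm_exp_sub_sum_le_norm_mul_exp (w : ℂ) 3
  simp only [Finset.sum_range_succ, Finset.sum_range_zero, Complex.norm_real, Real.norm_eq_abs]
    at this
  rw [← Real.norm_eq_abs, ← Complex.norm_real]
  convert! this using 2
  push_cast
  simp [Nat.factorial]
  ring

/-- Second order expansion of the moment generating function of a centered variable `Z - E Z`,
where `Z` is uniformly bounded and is linear up to a quadratic error. -/
lemma abs_integral_exp_sub_le {Ω : Type*} [MeasurableSpace Ω] {P : Measure Ω}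
    [IsProbabilityMeasure P] {ρ : Ω → ℝ} (hρ : MemLp ρ 3 P) (hρ0 : ∀ t, 0 ≤ ρ t)
    {Z l : Ω → ℝ} {K s R : ℝ} (hs : 0 ≤ s) (hs1 : s ≤ 1) (hK : 0 ≤ K)
    (hR : 1 + ∫ t, ρ t ^ 2 ∂P ≤ R)
    (hZm : AEStronglyMeasurable Z P) (hlm : AEStronglyMeasurable l P)
    (hZK : ∀ t, |Z t| ≤ K) (hZs : ∀ t, |Z t| ≤ K * s * ρ t)
    (hZl : ∀ t, |Z t - s * l t| ≤ K * s ^ 2 * ρ t ^ 2) (hl : ∀ t, |l t| ≤ K * ρ t)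
    (hl0 : ∫ t, l t ∂P = 0) :
    |∫ t, Real.exp (Z t - ∫ t, Z t ∂P) ∂P - (1 + s ^ 2 / 2 * ∫ t, l t ^ 2 ∂P)|
      ≤ s ^ 3 * ((K ^ 3 * Real.exp (2 * K) + K ^ 2) * ∫ t, (R + ρ t) ^ 3 ∂P) := by
  have hρ2 : MemLp ρ 2 P := hρ.mono_exponent (by norm_num)
  have hρ1 : Integrable ρ P := hρ.integrable (by norm_num)
  have hsq : Integrable (fun t => ρ t ^ 2) P := hρ2.integrable_sq
  have hR2 : 0 ≤ ∫ t, ρ t ^ 2 ∂P := integral_nonneg fun t => by positivity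
  set R2 := ∫ t, ρ t ^ 2 ∂P
  have hR1 : 1 ≤ R := by linarith
  have hi3 : Integrable (fun t => (R + ρ t) ^ 3) P := by
    have h1 : MemLp (fun t => R + ρ t) 3 P := (memLp_const R).add hρ
    have := h1.integrable_norm_pow (p := 3) (by norm_num)
    refine this.congr (.of_forall fun t => ?_)
    simp only
    rw [Real.norm_of_nonneg (by linarith [hρ0 t])]
  have hZi : Integrable Z P := Integrable.of_bound hZm K (.of_forall hZK)
  have hli : Integrable l P := Integrable.mono' (hρ1.const_mul K) hlm (.of_forall hl)
  have hl2 : Integrable (fun t => l t ^ 2) P := by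
    refine Integrable.mono' (hsq.const_mul (K ^ 2)) (hlm.pow 2) (.of_forall fun t => ?_)
    rw [Real.norm_of_nonneg (by positivity), ← sq_abs, ← mul_pow]
    exact pow_le_pow_left₀ (abs_nonneg _) (hl t) 2
  set m := ∫ t, Z t ∂P with hm
  have hmK : |m| ≤ K := by
    have := norm_integral_le_of_norm_le_const (μ := P) (.of_forall hZK : ∀ᵐ t ∂P, ‖Z t‖ ≤ K)
    simpa using this
  have hms : |m| ≤ K * s ^ 2 * R2 := by
    have h1 : m = ∫ t, (Z t - s * l t) ∂P := by
      rw [integral_sub hZi (hli.const_mul s), integral_const_mul, hl0]; simp [hm]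
    rw [h1, ← Real.norm_eq_abs]
    calc _ ≤ ∫ t, K * s ^ 2 * ρ t ^ 2 ∂P :=
          norm_integral_le_of_norm_le (hsq.const_mul _) (.of_forall hZl)
      _ = _ := integral_const_mul _ _
  have hss : s ^ 2 ≤ s := by nlinarith
  -- the mean is of second order in `s`, so that `W` keeps the linear part `s l`
  set W : Ω → ℝ := fun t => Z t - m with hW
  have hWm : AEStronglyMeasurable W P := hZm.sub aestronglyMeasurable_const
  have hWK : ∀ t, |W t| ≤ 2 * K := fun t => by
    have := abs_sub (Z t) m; have := hZK t; simp only [hW]; linarith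
  have hWi : Integrable W P := hZi.sub (integrable_const m)
  have hWs : ∀ t, |W t| ≤ K * s * (R + ρ t) := fun t => by
    have h1 := abs_sub (Z t) m
    have h2 := hZs t
    have h3 : K * s ^ 2 * R2 ≤ K * s * R := by gcongr; linarith
    simp only [hW]; linarith
  have hWl : ∀ t, |W t - s * l t| ≤ K * s ^ 2 * (R + ρ t) ^ 2 := fun t => by
    have h1 := abs_sub (Z t - s * l t) m
    have h2 := hZl t
    have h3 : K * s ^ 2 * ρ t ^ 2 + K * s ^ 2 * R2 ≤ K * s ^ 2 * (R + ρ t) ^ 2 := by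
      rw [← mul_add]; gcongr; nlinarith [hρ0 t]
    have : W t - s * l t = Z t - s * l t - m := by simp only [hW]; ring
    rw [this]; linarith
  have hW2 : Integrable (fun t => W t ^ 2) P :=
    Integrable.of_bound (hWm.pow 2) ((2 * K) ^ 2) (.of_forall fun t => by
      rw [norm_pow]; exact pow_le_pow_left₀ (norm_nonneg _) (hWK t) 2)
  have hWe : Integrable (fun t => Real.exp (W t)) P :=
    Integrable.of_bound (Real.continuous_exp.comp_aestronglyMeasurable hWm) (Real.exp (2 * K))
      (.of_forall fun t => by
        rw [Real.norm_of_nonneg (Real.exp_pos _).le]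
        exact Real.exp_le_exp.2 ((le_abs_self _).trans (hWK t)))
  have hW0 : ∫ t, W t ∂P = 0 := by
    simp only [hW]; rw [integral_sub hZi (integrable_const m)]; simp [hm]
  have hid : ∫ t, Real.exp (W t) ∂P - (1 + s ^ 2 / 2 * ∫ t, l t ^ 2 ∂P)
      = ∫ t, ((Real.exp (W t) - 1 - W t - W t ^ 2 / 2) + (W t ^ 2 - s ^ 2 * l t ^ 2) / 2) ∂P := by
    have : ∀ t, (Real.exp (W t) - 1 - W t - W t ^ 2 / 2) + (W t ^ 2 - s ^ 2 * l t ^ 2) / 2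
        = (Real.exp (W t) - W t) - (1 + s ^ 2 / 2 * l t ^ 2) := fun t => by ring
    simp_rw [this]
    have i1 : Integrable (fun t => Real.exp (W t) - W t) P := hWe.sub hWi
    have i2 : Integrable (fun t => s ^ 2 / 2 * l t ^ 2) P := hl2.const_mul _
    have i3 : Integrable (fun t => 1 + s ^ 2 / 2 * l t ^ 2) P := (integrable_const _).add i2
    rw [integral_sub i1 i3, integral_sub hWe hWi, hW0, integral_add (integrable_const _) i2,
      integral_const_mul]
    simp
  rw [hid, ← Real.norm_eq_abs]
  calc _ ≤ ∫ t, s ^ 3 * (K ^ 3 * Real.exp (2 * K) + K ^ 2) * (R + ρ t) ^ 3 ∂P := by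
        refine norm_integral_le_of_norm_le (hi3.const_mul _) (.of_forall fun t => ?_)
        have hq : 1 ≤ R + ρ t := by linarith [hρ0 t]
        have h1 : |Real.exp (W t) - 1 - W t - W t ^ 2 / 2|
            ≤ (K * s * (R + ρ t)) ^ 3 * Real.exp (2 * K) := by
          refine (abs_exp_sub_quadratic_le _).trans ?_
          exact mul_le_mul (pow_le_pow_left₀ (abs_nonneg _) (hWs t) 3)
            (Real.exp_le_exp.2 (hWK t)) (Real.exp_pos _).le (by positivity)
        have h2 : |(W t ^ 2 - s ^ 2 * l t ^ 2) / 2| ≤ K ^ 2 * s ^ 3 * (R + ρ t) ^ 3 := by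
          have h3 : (W t ^ 2 - s ^ 2 * l t ^ 2) / 2
              = (W t - s * l t) * ((W t + s * l t) / 2) := by ring
          rw [h3, abs_mul]
          have h4 : |(W t + s * l t) / 2| ≤ K * s * (R + ρ t) := by
            rw [abs_div, abs_two]
            have h5 := abs_add_le (W t) (s * l t)
            have h6 : |s * l t| ≤ K * s * (R + ρ t) := by
              rw [abs_mul, abs_of_nonneg hs]
              calc s * |l t| ≤ s * (K * ρ t) := by gcongr; exact hl t
                _ = K * s * ρ t := by ring
                _ ≤ _ := by gcongr; linarith
            have := hWs t
            rw [div_le_iff₀ (by norm_num)]; linarith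
          calc _ ≤ (K * s ^ 2 * (R + ρ t) ^ 2) * (K * s * (R + ρ t)) :=
                mul_le_mul (hWl t) h4 (abs_nonneg _) (by positivity)
            _ = _ := by ring
        calc _ ≤ _ := norm_add_le _ _
          _ ≤ (K * s * (R + ρ t)) ^ 3 * Real.exp (2 * K) + K ^ 2 * s ^ 3 * (R + ρ t) ^ 3 :=
              add_le_add h1 h2
          _ = _ := by ring
    _ = _ := by rw [integral_const_mul]; ring

/-- Smooth functions between two positive constants, with uniform control of the gradient and of
the first order Taylor remainder. The class is stable under averages of translates. -/
structure IsTame (m M L : ℝ) (f : E → ℝ) : Prop where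
  cont : Continuous f
  lower : ∀ x, m ≤ f x
  upper : ∀ x, f x ≤ M
  lip : ∀ x z, |f (x + z) - f x| ≤ L * ‖z‖
  taylor : ∃ v : E → E, Continuous v ∧ (∀ x, ‖v x‖ ≤ L) ∧
    ∀ x z, |f (x + z) - f x - inner ℝ (v x) z| ≤ L * ‖z‖ ^ 2

lemma IsTame.average {m M L : ℝ} {f : E → ℝ} (hf : IsTame m M L f) (hm : 0 ≤ m)
    {P : Measure E} [IsProbabilityMeasure P] :
    IsTame m M L (fun x => ∫ z, f (x + z) ∂P) := by
  have hfB : ∀ x, ‖f x‖ ≤ M := fun x => by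
    rw [Real.norm_of_nonneg (hm.trans (hf.lower x))]; exact hf.upper x
  have hc := hf.cont
  have hi : ∀ x, Integrable (fun z => f (x + z)) P := fun x =>
    Integrable.of_bound (Continuous.aestronglyMeasurable (by fun_prop)) M (.of_forall fun z => hfB _)
  refine ⟨?_, ?_, ?_, ?_, ?_⟩
  · exact continuous_of_dominated (bound := fun _ => M)
      (fun x => Continuous.aestronglyMeasurable (by fun_prop))
      (fun x => .of_forall fun z => hfB _) (integrable_const M) (.of_forall fun z => by fun_prop)
  · intro x
    have := integral_mono (μ := P) (integrable_const m) (hi x) (fun z => hf.lower (x + z))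
    simpa using this
  · intro x
    have := integral_mono (μ := P) (hi x) (integrable_const M) (fun z => hf.upper (x + z))
    simpa using this
  · intro x z
    rw [← integral_sub (hi _) (hi _), ← Real.norm_eq_abs]
    have := norm_integral_le_of_norm_le_const (μ := P) (C := L * ‖z‖)
      (f := fun w => f (x + z + w) - f (x + w)) (.of_forall fun w => by
        have := hf.lip (x + w) z
        rwa [add_right_comm] at this)
    simpa using this
  · obtain ⟨v, hv, hvL, hvt⟩ := hf.taylor
    have hvi : ∀ x, Integrable (fun w => v (x + w)) P := fun x =>
      Integrable.of_bound (Continuous.aestronglyMeasurable (by fun_prop)) L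
        (.of_forall fun z => hvL _)
    refine ⟨fun x => ∫ w, v (x + w) ∂P, ?_, ?_, ?_⟩
    · exact continuous_of_dominated (bound := fun _ => L)
        (fun x => Continuous.aestronglyMeasurable (by fun_prop))
        (fun x => .of_forall fun z => hvL _) (integrable_const L) (.of_forall fun z => by fun_prop)
    · intro x
      have := norm_integral_le_of_norm_le_const (μ := P) (C := L) (f := fun w => v (x + w))
        (.of_forall fun w => hvL _)
      simpa using this
    · intro x z
      have h1 : inner ℝ (∫ w, v (x + w) ∂P) z = ∫ w, inner ℝ (v (x + w)) z ∂P := by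
        rw [real_inner_comm, ← integral_inner (hvi x)]
        exact integral_congr_ae (.of_forall fun w => real_inner_comm _ _)
      have h2 : Integrable (fun w => inner ℝ (v (x + w)) z) P := by
        refine ((hvi x).const_inner z).congr (.of_forall fun w => real_inner_comm _ _)
      have h3 : ∫ w, (f (x + z + w) - f (x + w) - inner ℝ (v (x + w)) z) ∂P
          = ∫ w, f (x + z + w) ∂P - ∫ w, f (x + w) ∂P - ∫ w, inner ℝ (v (x + w)) z ∂P := by
        have i1 : Integrable (fun w => f (x + z + w) - f (x + w)) P := (hi _).sub (hi _)
        rw [integral_sub i1 h2, integral_sub (hi _) (hi _)]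
      rw [h1, ← h3, ← Real.norm_eq_abs]
      have := norm_integral_le_of_norm_le_const (μ := P) (C := L * ‖z‖ ^ 2)
        (f := fun w => f (x + z + w) - f (x + w) - inner ℝ (v (x + w)) z)
        (.of_forall fun w => by
          have := hvt (x + w) z
          rwa [add_right_comm] at this)
      simpa using this

/-- First order expansion of the logarithm of a tame function. -/
lemma IsTame.log {m M L : ℝ} {f : E → ℝ} (hf : IsTame m M L f) (hm : 0 < m) :
    ∃ K : ℝ, K = Real.log M - Real.log m + L / m + L ^ 2 / m ^ 2 ∧
      ∀ x, ∃ v : E, ‖v‖ ≤ K ∧ ∀ z, |Real.log (f (x + z)) - Real.log (f x)| ≤ K ∧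
        |Real.log (f (x + z)) - Real.log (f x)| ≤ K * ‖z‖ ∧
        |Real.log (f (x + z)) - Real.log (f x) - inner ℝ v z| ≤ K * ‖z‖ ^ 2 := by
  refine ⟨_, rfl, fun x => ?_⟩
  obtain ⟨v, -, hvL, hvt⟩ := hf.taylor
  have hL : 0 ≤ L := (norm_nonneg _).trans (hvL 0)
  have hpos : ∀ x, 0 < f x := fun x => hm.trans_le (hf.lower x)
  have hlog0 : 0 ≤ Real.log M - Real.log m :=
    sub_nonneg.2 (Real.log_le_log hm ((hf.lower 0).trans (hf.upper 0)))
  have hq : 0 ≤ L / m := by positivity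
  have hq2 : 0 ≤ L ^ 2 / m ^ 2 := by positivity
  -- the elementary bounds `(b - a) / b ≤ log b - log a ≤ (b - a) / a`
  have hup : ∀ a b : ℝ, 0 < a → 0 < b → Real.log b - Real.log a ≤ (b - a) / a := by
    intro a b ha hb
    rw [← Real.log_div hb.ne' ha.ne', sub_div, div_self ha.ne']
    exact Real.log_le_sub_one_of_pos (by positivity)
  refine ⟨(f x)⁻¹ • v x, ?_, fun z => ⟨?_, ?_, ?_⟩⟩
  · rw [norm_smul, norm_inv, Real.norm_of_nonneg (hpos x).le]
    calc (f x)⁻¹ * ‖v x‖ ≤ m⁻¹ * L := by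
          gcongr
          · exact hf.lower x
          · exact hvL x
      _ = L / m := by ring
      _ ≤ _ := by linarith
  · have h1 := Real.log_le_log hm (hf.lower (x + z))
    have h2 := Real.log_le_log hm (hf.lower x)
    have h3 := Real.log_le_log (hpos x) (hf.upper x)
    have h4 := Real.log_le_log (hpos _) (hf.upper (x + z))
    rw [abs_le]; constructor <;> linarith
  · have h1 := hup _ _ (hpos x) (hpos (x + z))
    have h2 := hup _ _ (hpos (x + z)) (hpos x)
    have h3 := abs_le.1 (hf.lip x z)
    have hB : ∀ a b : ℝ, m ≤ a → b ≤ L * ‖z‖ → b / a ≤ L / m * ‖z‖ := by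
      intro a b ha hb
      have ha0 : 0 < a := hm.trans_le ha
      calc b / a ≤ L * ‖z‖ / a := by gcongr
        _ ≤ L * ‖z‖ / m := by gcongr
        _ = _ := by ring
    have h4 := hB _ _ (hf.lower x) h3.2
    have h5 := hB _ (f x - f (x + z)) (hf.lower (x + z)) (by linarith [h3.1])
    have h6 : L / m * ‖z‖ ≤ (Real.log M - Real.log m + L / m + L ^ 2 / m ^ 2) * ‖z‖ := by
      gcongr; linarith
    rw [abs_le]; constructor <;> linarith
  · have h1 := hup _ _ (hpos x) (hpos (x + z))
    have h2 := hup _ _ (hpos (x + z)) (hpos x)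
    set a := f x with ha
    set b := f (x + z) with hb
    have hapos : 0 < a := hpos x
    have hbpos : 0 < b := hpos _
    have h3 : |Real.log b - Real.log a - (b - a) / a| ≤ L ^ 2 / m ^ 2 * ‖z‖ ^ 2 := by
      have h4 : (b - a) / a - (b - a) / b = (b - a) ^ 2 / (a * b) := by field_simp
      have h5 : (b - a) ^ 2 / (a * b) ≤ (L * ‖z‖) ^ 2 / (m * m) := by
        refine div_le_div₀ (by positivity) ?_ (by positivity)
          (mul_le_mul (hf.lower x) (hf.lower _) hm.le hapos.le)
        rw [← sq_abs (b - a)]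
        exact pow_le_pow_left₀ (abs_nonneg _) (hf.lip x z) 2
      have h6 : (L * ‖z‖) ^ 2 / (m * m) = L ^ 2 / m ^ 2 * ‖z‖ ^ 2 := by ring
      have h7 : (a - b) / b = -((b - a) / b) := by ring
      rw [abs_le]; constructor <;> linarith [sq_nonneg ‖z‖, mul_nonneg hq2 (sq_nonneg ‖z‖)]
    have h4 : |(b - a) / a - inner ℝ (a⁻¹ • v x) z| ≤ L / m * ‖z‖ ^ 2 := by
      rw [real_inner_smul_left, show (b - a) / a - a⁻¹ * inner ℝ (v x) z
        = (b - a - inner ℝ (v x) z) / a by field_simp, abs_div, abs_of_pos hapos]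
      calc _ ≤ L * ‖z‖ ^ 2 / a := by gcongr; exact hvt x z
        _ ≤ L * ‖z‖ ^ 2 / m := by gcongr; exact hf.lower x
        _ = _ := by ring
    have h5 := abs_add_le (Real.log b - Real.log a - (b - a) / a)
      ((b - a) / a - inner ℝ (a⁻¹ • v x) z)
    rw [sub_add_sub_cancel] at h5
    have h6 : 0 ≤ (Real.log M - Real.log m) * ‖z‖ ^ 2 := by positivity
    linarith [add_mul (Real.log M - Real.log m + L / m) (L ^ 2 / m ^ 2) (‖z‖ ^ 2),
      add_mul (Real.log M - Real.log m) (L / m) (‖z‖ ^ 2)]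

/-- The two-function inequality
`E[f(x + s X)^θ₁ g(y + s Y)^θ₂] ≤ e^κ E[f(x + s X)]^θ₁ E[g(y + s Y)]^θ₂` for tame `f`, `g`, where
`(X, Y)` has law `Γ`. -/
def CorrelationBound (Γ : Measure (E × E)) (θ₁ θ₂ m M L s κ : ℝ) : Prop :=
  ∀ f g : E → ℝ, IsTame m M L f → IsTame m M L g → ∀ x y : E,
    ∫ z, f (x + s • z.1) ^ θ₁ * g (y + s • z.2) ^ θ₂ ∂Γ
      ≤ Real.exp κ * ((∫ z, f (x + s • z.1) ∂Γ) ^ θ₁ * (∫ z, g (y + s • z.2) ∂Γ) ^ θ₂)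

lemma exp_sub_two_mul_sq_le {t : ℝ} (ht : |t| ≤ 1 / 2) : Real.exp (t - 2 * t ^ 2) ≤ 1 + t := by
  have h0 := abs_le.1 ht
  have h1 : 0 < 1 + t := by linarith
  have h2 : (1 + t)⁻¹ ≤ Real.exp (-t + 2 * t ^ 2) := by
    refine le_trans ?_ (Real.add_one_le_exp _)
    rw [inv_le_iff_one_le_mul₀ h1]
    nlinarith [mul_nonneg (sq_nonneg t) (by linarith : 0 ≤ 1 + 2 * t)]
  have h3 : Real.exp (t - 2 * t ^ 2) = (Real.exp (-t + 2 * t ^ 2))⁻¹ := by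
    rw [← Real.exp_neg]; congr 1; ring
  rw [h3]
  exact inv_le_of_inv_le₀ h1 h2

/-- Cumulant comparison: if the second moments of the linear parts `l₁`, `l₂` of `X`, `Y` satisfy
`E (θ₁ l₁ + θ₂ l₂)² ≤ θ₁ E l₁² + θ₂ E l₂²`, then
`E exp (θ₁ X + θ₂ Y) ≤ (E exp X)^θ₁ (E exp Y)^θ₂` up to an error of third order in the size `s` of
`X` and `Y`. -/
lemma integral_exp_add_le_of_variance_le {Ω : Type*} [MeasurableSpace Ω] {P : Measure Ω}
    [IsProbabilityMeasure P] {ρ : Ω → ℝ} (hρ : MemLp ρ 3 P) (hρ0 : ∀ t, 0 ≤ ρ t)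
    {θ₁ θ₂ : ℝ} (h₁ : 0 ≤ θ₁) (h₁' : θ₁ ≤ 1) (h₂ : 0 ≤ θ₂) (h₂' : θ₂ ≤ 1)
    {K₀ R D Q T s : ℝ} (hK0 : 0 ≤ K₀) (hR : R = 1 + ∫ z, ρ z ^ 2 ∂P)
    (hD : D = ((2 * K₀) ^ 3 * Real.exp (2 * (2 * K₀)) + (2 * K₀) ^ 2) * ∫ z, (R + ρ z) ^ 3 ∂P)
    (hQ : Q = (2 * K₀) ^ 2 * ∫ z, ρ z ^ 2 ∂P) (hT : T = D + Q / 2)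
    (hs : 0 < s) (hs1 : s ≤ 1) (hsT : s * T ≤ 1 / 2) {X Y l₁ l₂ : Ω → ℝ}
    (hXm : AEStronglyMeasurable X P) (hYm : AEStronglyMeasurable Y P)
    (hm₁ : AEStronglyMeasurable l₁ P) (hm₂ : AEStronglyMeasurable l₂ P)
    (hX1 : ∀ z, |X z| ≤ K₀) (hY1 : ∀ z, |Y z| ≤ K₀)
    (hX2 : ∀ z, |X z| ≤ K₀ * s * ρ z) (hY2 : ∀ z, |Y z| ≤ K₀ * s * ρ z)
    (hX3 : ∀ z, |X z - s * l₁ z| ≤ K₀ * s ^ 2 * ρ z ^ 2)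
    (hY3 : ∀ z, |Y z - s * l₂ z| ≤ K₀ * s ^ 2 * ρ z ^ 2)
    (hl1 : ∀ z, |l₁ z| ≤ K₀ * ρ z) (hl2 : ∀ z, |l₂ z| ≤ K₀ * ρ z)
    (hz1 : ∫ z, l₁ z ∂P = 0) (hz2 : ∫ z, l₂ z ∂P = 0)
    (hV : ∫ z, (θ₁ * l₁ z + θ₂ * l₂ z) ^ 2 ∂P
      ≤ θ₁ * ∫ z, l₁ z ^ 2 ∂P + θ₂ * ∫ z, l₂ z ^ 2 ∂P) :
    ∫ z, Real.exp (θ₁ * X z + θ₂ * Y z) ∂P ≤ Real.exp ((D + 2 * (D + 2 * T ^ 2)) * s ^ 3)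
      * ((∫ z, Real.exp (X z) ∂P) ^ θ₁ * (∫ z, Real.exp (Y z) ∂P) ^ θ₂) := by
  set K := 2 * K₀ with hKdef
  have hρ2i : Integrable (fun z => ρ z ^ 2) P := (hρ.mono_exponent (by norm_num)).integrable_sq
  have hρ1 : Integrable ρ P := hρ.integrable (by norm_num)
  have hρ2 : 0 ≤ ∫ z, ρ z ^ 2 ∂P := integral_nonneg fun z => by positivity
  have hQ0 : 0 ≤ Q := by rw [hQ]; positivity
  have hD0 : 0 ≤ D := by
    have : 0 ≤ ∫ z, (R + ρ z) ^ 3 ∂P := integral_nonneg fun z => by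
      have := hρ0 z
      have hR0 : 0 ≤ R := by linarith
      simp only [Pi.zero_apply]; positivity
    rw [hD]; positivity
  have hT0 : 0 ≤ T := by linarith
  have hKK : K₀ ≤ K := by rw [hKdef]; linarith
  have hK00 : 0 ≤ K := by rw [hKdef]; linarith
  have hI1 : Integrable l₁ P := Integrable.mono' (hρ1.const_mul K₀) hm₁ (.of_forall hl1)
  have hI2 : Integrable l₂ P := Integrable.mono' (hρ1.const_mul K₀) hm₂ (.of_forall hl2)
  set Z : Ω → ℝ := fun z => θ₁ * X z + θ₂ * Y z with hZ
  set l : Ω → ℝ := fun z => θ₁ * l₁ z + θ₂ * l₂ z with hl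
  have habs : ∀ {a b c : ℝ}, |a| ≤ c → |b| ≤ c → |θ₁ * a + θ₂ * b| ≤ 2 * c := by
    intro a b c ha hb
    have hc : 0 ≤ c := (abs_nonneg _).trans ha
    calc |θ₁ * a + θ₂ * b| ≤ |θ₁ * a| + |θ₂ * b| := abs_add_le _ _
      _ = θ₁ * |a| + θ₂ * |b| := by rw [abs_mul, abs_mul, abs_of_nonneg h₁, abs_of_nonneg h₂]
      _ ≤ 1 * c + 1 * c := by gcongr
      _ = 2 * c := by ring
  have up : ∀ {a r : ℝ}, 0 ≤ r → |a| ≤ K₀ * r → |a| ≤ K * r := fun hr h =>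
    h.trans (mul_le_mul_of_nonneg_right hKK hr)
  have up1 : ∀ {a : ℝ} {z : Ω}, |a| ≤ K₀ * s * ρ z → |a| ≤ K * s * ρ z := fun {a z} h => by
    rw [mul_assoc] at h ⊢; exact up (mul_nonneg hs.le (hρ0 z)) h
  have up2 : ∀ {a : ℝ} {z : Ω}, |a| ≤ K₀ * s ^ 2 * ρ z ^ 2 → |a| ≤ K * s ^ 2 * ρ z ^ 2 :=
    fun {a z} h => by rw [mul_assoc] at h ⊢; exact up (by positivity) h
  have eX := abs_integral_exp_sub_le hρ hρ0 hs.le hs1 hK00 hR.symm.le hXm hm₁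
    (fun z => (hX1 z).trans hKK) (fun z => up1 (hX2 z)) (fun z => up2 (hX3 z))
    (fun z => up (hρ0 z) (hl1 z)) hz1
  have eY := abs_integral_exp_sub_le hρ hρ0 hs.le hs1 hK00 hR.symm.le hYm hm₂
    (fun z => (hY1 z).trans hKK) (fun z => up1 (hY2 z)) (fun z => up2 (hY3 z))
    (fun z => up (hρ0 z) (hl2 z)) hz2
  have eZ := abs_integral_exp_sub_le hρ hρ0 hs.le hs1 hK00 hR.symm.le (Z := Z) (l := l)
    ((hXm.const_mul θ₁).add (hYm.const_mul θ₂)) ((hm₁.const_mul θ₁).add (hm₂.const_mul θ₂))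
    (fun z => habs (hX1 z) (hY1 z))
    (fun z => (habs (hX2 z) (hY2 z)).trans (le_of_eq (by rw [hKdef]; ring)))
    (fun z => by
      have := habs (hX3 z) (hY3 z)
      rw [show Z z - s * l z = θ₁ * (X z - s * l₁ z) + θ₂ * (Y z - s * l₂ z) by
        simp only [hZ, hl]; ring]
      exact this.trans (le_of_eq (by rw [hKdef]; ring)))
    (fun z => (habs (hl1 z) (hl2 z)).trans (le_of_eq (by rw [hKdef]; ring))) (by
      simp only [hl]
      rw [integral_add (hI1.const_mul _) (hI2.const_mul _), integral_const_mul,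
        integral_const_mul, hz1, hz2]; simp)
  rw [← hD] at eX eY eZ
  set q₁ := ∫ z, l₁ z ^ 2 ∂P with hq₁
  set q₂ := ∫ z, l₂ z ^ 2 ∂P with hq₂
  set m₁ := ∫ z, X z ∂P with hm₁
  set m₂ := ∫ z, Y z ∂P with hm₂
  have hXi : Integrable X P := Integrable.of_bound hXm K₀ (.of_forall hX1)
  have hYi : Integrable Y P := Integrable.of_bound hYm K₀ (.of_forall hY1)
  have hmZ : ∫ z, Z z ∂P = θ₁ * m₁ + θ₂ * m₂ := by
    simp only [hZ]
    rw [integral_add (hXi.const_mul _) (hYi.const_mul _), integral_const_mul, integral_const_mul]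
  -- lower bounds for the two averages on the right-hand side
  have lower : ∀ (A q : ℝ), |A - (1 + s ^ 2 / 2 * q)| ≤ s ^ 3 * D → 0 ≤ q → q ≤ Q →
      Real.exp (s ^ 2 / 2 * q - s ^ 3 * (D + 2 * T ^ 2)) ≤ A := by
    intro A q hA hq0 hqQ
    set t := s ^ 2 / 2 * q - s ^ 3 * D with ht
    have h3 : s ^ 3 ≤ s ^ 2 := pow_le_pow_of_le_one hs.le hs1 (by norm_num)
    have htT : |t| ≤ s ^ 2 * T := by
      have h4 : s ^ 3 * D ≤ s ^ 2 * D := by gcongr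
      have h5 : s ^ 2 / 2 * q ≤ s ^ 2 / 2 * Q := by gcongr
      have h6 : 0 ≤ s ^ 2 / 2 * q := by positivity
      have h7 : 0 ≤ s ^ 3 * D := by positivity
      have h8 : s ^ 2 * T = s ^ 2 * D + s ^ 2 / 2 * Q := by rw [hT]; ring
      have h9 : 0 ≤ s ^ 2 * D := by positivity
      have h10 : 0 ≤ s ^ 2 / 2 * Q := by positivity
      rw [abs_le]; constructor <;> linarith
    have ht2 : |t| ≤ 1 / 2 := by
      refine htT.trans (le_trans ?_ hsT)
      gcongr
      nlinarith
    have hsq : t ^ 2 ≤ s ^ 3 * T ^ 2 := by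
      rw [← sq_abs]
      calc |t| ^ 2 ≤ (s ^ 2 * T) ^ 2 := pow_le_pow_left₀ (abs_nonneg _) htT 2
        _ = s ^ 4 * T ^ 2 := by ring
        _ ≤ s ^ 3 * T ^ 2 := by
          gcongr ?_ * _
          exact pow_le_pow_of_le_one hs.le hs1 (by norm_num)
    calc _ ≤ Real.exp (t - 2 * t ^ 2) := Real.exp_le_exp.2 (by rw [ht] at hsq ⊢; linarith)
      _ ≤ 1 + t := exp_sub_two_mul_sq_le ht2
      _ ≤ A := by linarith [(abs_le.1 hA).1]
  have hqQ : ∀ l' : Ω → ℝ, (∀ z, |l' z| ≤ K₀ * ρ z) → ∫ z, l' z ^ 2 ∂P ≤ Q := by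
    intro l' hl'
    rw [hQ, ← integral_const_mul]
    refine integral_mono_of_nonneg (.of_forall fun z => by positivity) (hρ2i.const_mul _)
      (.of_forall fun z => ?_)
    simp only
    rw [← sq_abs, ← mul_pow]
    exact pow_le_pow_left₀ (abs_nonneg _) (up (hρ0 z) (hl' z)) 2
  have lX := lower _ _ eX (integral_nonneg fun z => by positivity) (hqQ _ hl1)
  have lY := lower _ _ eY (integral_nonneg fun z => by positivity) (hqQ _ hl2)
  have uZ : ∫ z, Real.exp (Z z - ∫ z, Z z ∂P) ∂P
      ≤ Real.exp (s ^ 2 / 2 * (θ₁ * q₁ + θ₂ * q₂) + s ^ 3 * D) := by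
    have h1 := (abs_le.1 eZ).2
    have h2 : s ^ 2 / 2 * ∫ z, l z ^ 2 ∂P ≤ s ^ 2 / 2 * (θ₁ * q₁ + θ₂ * q₂) := by
      gcongr
    refine le_trans ?_ (Real.add_one_le_exp _)
    linarith
  have hshift : ∀ W : Ω → ℝ, ∀ a : ℝ,
      ∫ z, Real.exp (W z) ∂P = Real.exp a * ∫ z, Real.exp (W z - a) ∂P := fun W a => by
    rw [← integral_const_mul]
    refine integral_congr_ae (.of_forall fun z => ?_)
    simp only
    rw [← Real.exp_add]; congr 1; ring
  have hRf : Real.exp (θ₁ * (m₁ + (s ^ 2 / 2 * q₁ - s ^ 3 * (D + 2 * T ^ 2))))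
      ≤ (∫ z, Real.exp (X z) ∂P) ^ θ₁ := by
    rw [mul_comm, Real.exp_mul]
    refine Real.rpow_le_rpow (Real.exp_pos _).le ?_ h₁
    rw [hshift X m₁, Real.exp_add]
    gcongr
  have hRg : Real.exp (θ₂ * (m₂ + (s ^ 2 / 2 * q₂ - s ^ 3 * (D + 2 * T ^ 2))))
      ≤ (∫ z, Real.exp (Y z) ∂P) ^ θ₂ := by
    rw [mul_comm, Real.exp_mul]
    refine Real.rpow_le_rpow (Real.exp_pos _).le ?_ h₂
    rw [hshift Y m₂, Real.exp_add]
    gcongr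
  have hDT : 0 ≤ s ^ 3 * (D + 2 * T ^ 2) := by positivity
  rw [hshift Z (∫ z, Z z ∂P)]
  calc _ ≤ Real.exp (∫ z, Z z ∂P)
        * Real.exp (s ^ 2 / 2 * (θ₁ * q₁ + θ₂ * q₂) + s ^ 3 * D) := by gcongr
    _ ≤ Real.exp ((D + 2 * (D + 2 * T ^ 2)) * s ^ 3)
        * (Real.exp (θ₁ * (m₁ + (s ^ 2 / 2 * q₁ - s ^ 3 * (D + 2 * T ^ 2))))
          * Real.exp (θ₂ * (m₂ + (s ^ 2 / 2 * q₂ - s ^ 3 * (D + 2 * T ^ 2))))) := by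
        rw [← Real.exp_add, ← Real.exp_add, ← Real.exp_add, hmZ]
        apply Real.exp_le_exp.2
        have e1 := mul_le_mul_of_nonneg_right h₁' hDT
        have e2 := mul_le_mul_of_nonneg_right h₂' hDT
        linarith
    _ ≤ _ := by gcongr

/-- The two-function inequality for a small step, with an error of third order. -/
lemma exists_correlationBound_of_variance_le {Γ : Measure (E × E)} [IsGaussian Γ]
    (h0 : ∫ z, z ∂Γ = 0) {θ₁ θ₂ : ℝ} (h₁ : 0 ≤ θ₁) (h₁' : θ₁ ≤ 1) (h₂ : 0 ≤ θ₂) (h₂' : θ₂ ≤ 1)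
    (hV : ∀ u v : E, ∫ z, (θ₁ * inner ℝ u z.1 + θ₂ * inner ℝ v z.2) ^ 2 ∂Γ
      ≤ θ₁ * ∫ z, inner ℝ u z.1 ^ 2 ∂Γ + θ₂ * ∫ z, inner ℝ v z.2 ^ 2 ∂Γ)
    {m M L : ℝ} (hm : 0 < m) (hmM : m ≤ M) (hL : 0 ≤ L) :
    ∃ C s₀ : ℝ, 0 < s₀ ∧ ∀ s, 0 < s → s ≤ s₀ → CorrelationBound Γ θ₁ θ₂ m M L s (C * s ^ 3) := by
  obtain ⟨K₀, hK₀⟩ : ∃ K₀, K₀ = Real.log M - Real.log m + L / m + L ^ 2 / m ^ 2 := ⟨_, rfl⟩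
  have hK0 : 0 ≤ K₀ := by
    have := Real.log_le_log hm hmM
    have h2 : 0 ≤ L / m := by positivity
    have h3 : 0 ≤ L ^ 2 / m ^ 2 := by positivity
    linarith
  obtain ⟨ρ, hρdef⟩ : ∃ ρ : E × E → ℝ, ρ = fun z => ‖z‖ := ⟨_, rfl⟩
  have hρ : MemLp ρ 3 Γ := hρdef ▸ (IsGaussian.memLp_id Γ 3 (by norm_num)).norm
  have hρ0 : ∀ z, 0 ≤ ρ z := fun z => hρdef ▸ norm_nonneg z
  obtain ⟨R, hR⟩ : ∃ R, R = 1 + ∫ z, ρ z ^ 2 ∂Γ := ⟨_, rfl⟩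
  obtain ⟨D, hD⟩ : ∃ D, D = ((2 * K₀) ^ 3 * Real.exp (2 * (2 * K₀)) + (2 * K₀) ^ 2)
    * ∫ z, (R + ρ z) ^ 3 ∂Γ := ⟨_, rfl⟩
  obtain ⟨Q, hQ⟩ : ∃ Q, Q = (2 * K₀) ^ 2 * ∫ z, ρ z ^ 2 ∂Γ := ⟨_, rfl⟩
  obtain ⟨T, hT⟩ : ∃ T, T = D + Q / 2 := ⟨_, rfl⟩
  have hρ2 : 0 ≤ ∫ z, ρ z ^ 2 ∂Γ := integral_nonneg fun z => by positivity
  have hT0 : 0 ≤ T := by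
    have : 0 ≤ ∫ z, (R + ρ z) ^ 3 ∂Γ := integral_nonneg fun z => by
      have := hρ0 z
      have hR0 : 0 ≤ R := by linarith
      simp only [Pi.zero_apply]; positivity
    rw [hT, hD, hQ]; positivity
  refine ⟨D + 2 * (D + 2 * T ^ 2), 1 / (1 + 2 * T), by positivity, ?_⟩
  intro s hs hss f g hf hg x y
  have hs1 : s ≤ 1 := hss.trans ((div_le_one (by positivity)).2 (by linarith))
  have hsT : s * T ≤ 1 / 2 := by
    have : s * T ≤ 1 / (1 + 2 * T) * T := by gcongr
    refine this.trans ?_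
    rw [div_mul_eq_mul_div, div_le_div_iff₀ (by positivity) (by norm_num)]
    linarith
  obtain ⟨_, rfl, hfl⟩ := hf.log hm
  obtain ⟨_, rfl, hgl⟩ := hg.log hm
  rw [← hK₀] at hfl hgl
  obtain ⟨u, huK, hu⟩ := hfl x
  obtain ⟨v, hvK, hv⟩ := hgl y
  have hfpos : ∀ x, 0 < f x := fun x => hm.trans_le (hf.lower x)
  have hgpos : ∀ x, 0 < g x := fun x => hm.trans_le (hg.lower x)
  have hfc := hf.cont
  have hgc := hg.cont
  have hn1 : ∀ z : E × E, ‖s • z.1‖ ≤ s * ρ z := fun z => by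
    rw [norm_smul, Real.norm_of_nonneg hs.le, hρdef]
    exact mul_le_mul_of_nonneg_left (norm_fst_le z) hs.le
  have hn2 : ∀ z : E × E, ‖s • z.2‖ ≤ s * ρ z := fun z => by
    rw [norm_smul, Real.norm_of_nonneg hs.le, hρdef]
    exact mul_le_mul_of_nonneg_left (norm_snd_le z) hs.le
  have lin : ∀ {a b r : ℝ}, |a| ≤ K₀ * b → b ≤ s * r → |a| ≤ K₀ * s * r := fun h h' => by
    rw [mul_assoc]; exact h.trans (mul_le_mul_of_nonneg_left h' hK0)
  have quad : ∀ {a b r : ℝ}, |a| ≤ K₀ * b ^ 2 → 0 ≤ b → b ≤ s * r → |a| ≤ K₀ * s ^ 2 * r ^ 2 :=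
    fun h hb h' => by
      rw [mul_assoc, ← mul_pow]
      exact h.trans (mul_le_mul_of_nonneg_left (pow_le_pow_left₀ hb h' 2) hK0)
  have hid : Integrable (fun z : E × E => z) Γ := IsGaussian.integrable_id
  have key := integral_exp_add_le_of_variance_le hρ hρ0 h₁ h₁' h₂ h₂' hK0 hR hD hQ hT hs hs1 hsT
    (X := fun z => Real.log (f (x + s • z.1)) - Real.log (f x))
    (Y := fun z => Real.log (g (y + s • z.2)) - Real.log (g y))
    (l₁ := fun z => inner ℝ u z.1) (l₂ := fun z => inner ℝ v z.2)
    (((Continuous.log (by fun_prop) fun z => (hfpos _).ne').sub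
      continuous_const).aestronglyMeasurable)
    (((Continuous.log (by fun_prop) fun z => (hgpos _).ne').sub
      continuous_const).aestronglyMeasurable)
    (Continuous.aestronglyMeasurable (by fun_prop))
    (Continuous.aestronglyMeasurable (by fun_prop))
    (fun z => (hu (s • z.1)).1) (fun z => (hv (s • z.2)).1)
    (fun z => lin (hu (s • z.1)).2.1 (hn1 z)) (fun z => lin (hv (s • z.2)).2.1 (hn2 z))
    (fun z => by
      have h := (hu (s • z.1)).2.2
      rw [real_inner_smul_right] at h
      exact quad h (norm_nonneg _) (hn1 z))
    (fun z => by
      have h := (hv (s • z.2)).2.2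
      rw [real_inner_smul_right] at h
      exact quad h (norm_nonneg _) (hn2 z))
    (fun z => (abs_real_inner_le_norm _ _).trans
      (hρdef ▸ mul_le_mul huK (norm_fst_le z) (norm_nonneg _) hK0))
    (fun z => (abs_real_inner_le_norm _ _).trans
      (hρdef ▸ mul_le_mul hvK (norm_snd_le z) (norm_nonneg _) hK0))
    (by rw [integral_inner hid.fst, ← fst_integral hid, h0]; simp)
    (by rw [integral_inner hid.snd, ← snd_integral hid, h0]; simp) (hV u v)
  have hfe : ∀ z : E × E, Real.exp (Real.log (f (x + s • z.1)) - Real.log (f x))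
      = f (x + s • z.1) / f x := fun z => by
    rw [Real.exp_sub, Real.exp_log (hfpos _), Real.exp_log (hfpos _)]
  have hge : ∀ z : E × E, Real.exp (Real.log (g (y + s • z.2)) - Real.log (g y))
      = g (y + s • z.2) / g y := fun z => by
    rw [Real.exp_sub, Real.exp_log (hgpos _), Real.exp_log (hgpos _)]
  simp_rw [Real.exp_add, mul_comm θ₁, mul_comm θ₂, Real.exp_mul, hfe, hge] at key
  have hi1 : 0 ≤ ∫ z, f (x + s • z.1) ∂Γ := integral_nonneg fun z => (hfpos _).le
  have hi2 : 0 ≤ ∫ z, g (y + s • z.2) ∂Γ := integral_nonneg fun z => (hgpos _).le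
  rw [integral_div, integral_div, Real.div_rpow hi1 (hfpos x).le,
    Real.div_rpow hi2 (hgpos y).le] at key
  have hcongr : ∀ z : E × E, (f (x + s • z.1) / f x) ^ θ₁ * (g (y + s • z.2) / g y) ^ θ₂
      = (f (x + s • z.1) ^ θ₁ * g (y + s • z.2) ^ θ₂) / (f x ^ θ₁ * g y ^ θ₂) := fun z => by
    rw [Real.div_rpow (hfpos _).le (hfpos _).le, Real.div_rpow (hgpos _).le (hgpos _).le,
      div_mul_div_comm]
  simp_rw [hcongr] at key
  have hp1 := Real.rpow_pos_of_pos (hfpos x) θ₁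
  have hp2 := Real.rpow_pos_of_pos (hgpos y) θ₂
  rw [integral_div, div_mul_div_comm, ← mul_div_assoc, div_le_div_iff_of_pos_right
    (by positivity)] at key
  rw [Real.exp_mul]
  exact key

lemma IsTame.average_gaussian {Γ : Measure (E × E)} [IsProbabilityMeasure Γ] {m M L : ℝ}
    {f : E → ℝ} (hf : IsTame m M L f) (hm : 0 ≤ m) (s : ℝ) {π : E × E → E} (hπ : Continuous π) :
    IsTame m M L (fun x => ∫ z, f (x + s • π z) ∂Γ) := by
  have hφ : Continuous fun z : E × E => s • π z := by fun_prop
  have := Measure.isProbabilityMeasure_map (μ := Γ) hφ.aemeasurable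
  have h := hf.average hm (P := Γ.map fun z => s • π z)
  have hc := hf.cont
  convert! h using 2 with x
  rw [integral_map hφ.aemeasurable (Continuous.aestronglyMeasurable (by fun_prop))]

/-- Doubling the variance doubles the error, since the class of tame functions is stable under
Gaussian averages and the increment is the sum of two independent halves. -/
lemma CorrelationBound.sqrt_two_mul {Γ : Measure (E × E)} [IsGaussian Γ]
    (h0 : ∫ z, z ∂Γ = 0) {θ₁ θ₂ : ℝ} (h₁ : 0 ≤ θ₁) (h₂ : 0 ≤ θ₂) {m M L s κ : ℝ} (hm : 0 < m)
    (h : CorrelationBound Γ θ₁ θ₂ m M L s κ) :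
    CorrelationBound Γ θ₁ θ₂ m M L (√2 * s) (2 * κ) := by
  intro f g hf hg x y
  have hfc := hf.cont
  have hgc := hg.cont
  have hpow : ∀ {k : E → ℝ} {θ : ℝ}, 0 ≤ θ → IsTame m M L k → ∀ x, |k x ^ θ| ≤ M ^ θ := by
    intro k θ hθ hk x
    have hp : 0 ≤ k x := hm.le.trans (hk.lower x)
    rw [abs_of_nonneg (Real.rpow_nonneg hp _)]
    exact Real.rpow_le_rpow hp (hk.upper x) hθ
  have hM : 0 ≤ M := hm.le.trans ((hf.lower 0).trans (hf.upper 0))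
  have hprod : ∀ {k k' : E → ℝ}, IsTame m M L k → IsTame m M L k' → ∀ x y,
      |k x ^ θ₁ * k' y ^ θ₂| ≤ M ^ θ₁ * M ^ θ₂ := fun hk hk' x y => by
    rw [abs_mul]
    exact mul_le_mul (hpow h₁ hk x) (hpow h₂ hk' y) (abs_nonneg _) (Real.rpow_nonneg hM _)
  have hrc : ∀ {k : E → ℝ} {θ : ℝ}, 0 ≤ θ → IsTame m M L k → Continuous fun x => k x ^ θ :=
    fun hθ hk => hk.cont.rpow_const fun x => Or.inr hθ
  have hf1 := hrc h₁ hf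
  have hg2 := hrc h₂ hg
  set F : E → ℝ := fun x => ∫ z, f (x + s • z.1) ∂Γ with hF
  set G : E → ℝ := fun x => ∫ z, g (x + s • z.2) ∂Γ with hG
  have hFt : IsTame m M L F := hf.average_gaussian hm.le s continuous_fst
  have hGt : IsTame m M L G := hg.average_gaussian hm.le s continuous_snd
  have e1 : ∫ z, F (x + s • z.1) ∂Γ = ∫ z, f (x + (√2 * s) • z.1) ∂Γ := by
    have := integral_integral_add_gaussian h0 (H := fun v : E × E => f (x + v.1)) (by fun_prop)
      (B := M) (fun v => by
        rw [abs_of_nonneg (hm.le.trans (hf.lower _))]; exact hf.upper _) s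
    simpa only [hF, Prod.fst_add, Prod.smul_fst, add_assoc] using this
  have e2 : ∫ z, G (y + s • z.2) ∂Γ = ∫ z, g (y + (√2 * s) • z.2) ∂Γ := by
    have := integral_integral_add_gaussian h0 (H := fun v : E × E => g (y + v.2)) (by fun_prop)
      (B := M) (fun v => by
        rw [abs_of_nonneg (hm.le.trans (hg.lower _))]; exact hg.upper _) s
    simpa only [hG, Prod.snd_add, Prod.smul_snd, add_assoc] using this
  have e3 := integral_integral_add_gaussian h0
    (H := fun v : E × E => f (x + v.1) ^ θ₁ * g (y + v.2) ^ θ₂)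
    (by fun_prop) (fun v => hprod hf hg _ _) s
  simp only [Prod.fst_add, Prod.smul_fst, Prod.snd_add, Prod.smul_snd, ← add_assoc] at e3
  rw [← e3, ← e1, ← e2]
  -- the bound is used twice: for `f`, `g` at translated base points, then for their averages
  have hstep : ∀ z : E × E, ∫ w, f (x + s • z.1 + s • w.1) ^ θ₁ * g (y + s • z.2 + s • w.2) ^ θ₂ ∂Γ
      ≤ Real.exp κ * (F (x + s • z.1) ^ θ₁ * G (y + s • z.2) ^ θ₂) := fun z => h f g hf hg _ _
  have hF1 := hrc h₁ hFt
  have hG2 := hrc h₂ hGt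
  have hi : Integrable (fun z : E × E => F (x + s • z.1) ^ θ₁ * G (y + s • z.2) ^ θ₂) Γ :=
    Integrable.of_bound ((hF1.comp (by fun_prop : Continuous fun z : E × E => x + s • z.1)).mul
      (hG2.comp (by fun_prop : Continuous fun z : E × E => y + s • z.2))).aestronglyMeasurable _
      (.of_forall fun z => hprod hFt hGt _ _)
  calc _ ≤ ∫ z, Real.exp κ * (F (x + s • z.1) ^ θ₁ * G (y + s • z.2) ^ θ₂) ∂Γ := by
        refine integral_mono_of_nonneg (.of_forall fun z => integral_nonneg fun w => ?_)
          (hi.const_mul _) (.of_forall hstep)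
        exact mul_nonneg (Real.rpow_nonneg (hm.le.trans (hf.lower _)) _)
          (Real.rpow_nonneg (hm.le.trans (hg.lower _)) _)
    _ = Real.exp κ * ∫ z, F (x + s • z.1) ^ θ₁ * G (y + s • z.2) ^ θ₂ ∂Γ := integral_const_mul _ _
    _ ≤ Real.exp κ * (Real.exp κ * ((∫ z, F (x + s • z.1) ∂Γ) ^ θ₁
          * (∫ z, G (y + s • z.2) ∂Γ) ^ θ₂)) := by
        gcongr; exact h F G hFt hGt x y
    _ = _ := by rw [two_mul, Real.exp_add]; ring

lemma CorrelationBound.sqrt_two_pow_mul {Γ : Measure (E × E)} [IsGaussian Γ]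
    (h0 : ∫ z, z ∂Γ = 0) {θ₁ θ₂ : ℝ} (h₁ : 0 ≤ θ₁) (h₂ : 0 ≤ θ₂) {m M L s κ : ℝ} (hm : 0 < m)
    (h : CorrelationBound Γ θ₁ θ₂ m M L s κ) (n : ℕ) :
    CorrelationBound Γ θ₁ θ₂ m M L (√2 ^ n * s) (2 ^ n * κ) := by
  induction n with
  | zero => simpa using h
  | succ n ih =>
    have := ih.sqrt_two_mul h0 h₁ h₂ hm
    rw [pow_succ', pow_succ', mul_assoc, mul_assoc]
    exact this

/-- Gaussian correlation inequality for tame functions: the third order errors of `2ⁿ` small steps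
of variance `2⁻ⁿ` add up to `O(2^{-n/2})`. -/
lemma integral_rpow_mul_rpow_le_of_isTame {Γ : Measure (E × E)} [IsGaussian Γ]
    (h0 : ∫ z, z ∂Γ = 0) {θ₁ θ₂ : ℝ} (h₁ : 0 ≤ θ₁) (h₁' : θ₁ ≤ 1) (h₂ : 0 ≤ θ₂) (h₂' : θ₂ ≤ 1)
    (hV : ∀ u v : E, ∫ z, (θ₁ * inner ℝ u z.1 + θ₂ * inner ℝ v z.2) ^ 2 ∂Γ
      ≤ θ₁ * ∫ z, inner ℝ u z.1 ^ 2 ∂Γ + θ₂ * ∫ z, inner ℝ v z.2 ^ 2 ∂Γ)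
    {m M L : ℝ} (hm : 0 < m) {f g : E → ℝ} (hf : IsTame m M L f) (hg : IsTame m M L g) :
    ∫ z, f z.1 ^ θ₁ * g z.2 ^ θ₂ ∂Γ ≤ (∫ z, f z.1 ∂Γ) ^ θ₁ * (∫ z, g z.2 ∂Γ) ^ θ₂ := by
  have hL : 0 ≤ L := by
    obtain ⟨v, -, hv, -⟩ := hf.taylor
    exact (norm_nonneg _).trans (hv 0)
  obtain ⟨C, s₀, hs₀, hC⟩ := exists_correlationBound_of_variance_le h0 h₁ h₁' h₂ h₂' hV hm
    ((hf.lower 0).trans (hf.upper 0)) hL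
  have hsq : (√2 : ℝ)⁻¹ < 1 := inv_lt_one_of_one_lt₀ (by
    rw [Real.lt_sqrt (by norm_num)]; norm_num)
  have htend : Tendsto (fun n : ℕ => (√2 : ℝ)⁻¹ ^ n) atTop (𝓝 0) :=
    tendsto_pow_atTop_nhds_zero_of_lt_one (by positivity) hsq
  have hlim : Tendsto (fun n : ℕ => Real.exp (C * (√2 : ℝ)⁻¹ ^ n)
      * ((∫ z, f z.1 ∂Γ) ^ θ₁ * (∫ z, g z.2 ∂Γ) ^ θ₂)) atTop
      (𝓝 (1 * ((∫ z, f z.1 ∂Γ) ^ θ₁ * (∫ z, g z.2 ∂Γ) ^ θ₂))) := by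
    refine Tendsto.mul_const _ ?_
    have := (Real.continuous_exp.tendsto _).comp (htend.const_mul C)
    simpa [Function.comp_def] using this
  rw [← one_mul ((∫ z, f z.1 ∂Γ) ^ θ₁ * (∫ z, g z.2 ∂Γ) ^ θ₂)]
  refine ge_of_tendsto hlim ?_
  filter_upwards [htend.eventually (Iic_mem_nhds hs₀)] with n hn
  -- `n` doublings of the variance lead from `s = 2^{-n/2}` to `1`
  have h := (hC _ (by positivity) hn).sqrt_two_pow_mul h0 h₁ h₂ hm n f g hf hg 0 0
  have e1 : (√2 : ℝ) ^ n * (√2)⁻¹ ^ n = 1 := by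
    rw [← mul_pow, mul_inv_cancel₀ (by positivity), one_pow]
  have e2 : (2 : ℝ) ^ n * (C * ((√2)⁻¹ ^ n) ^ 3) = C * (√2)⁻¹ ^ n := by
    have : (2 : ℝ) ^ n = √2 ^ n * √2 ^ n := by
      rw [← mul_pow, Real.mul_self_sqrt (by norm_num)]
    rw [this]
    linear_combination (C * (√2)⁻¹ ^ n * (√2 ^ n * (√2)⁻¹ ^ n + 1)) * e1
  rw [e1, e2] at h
  simpa using h

/-- Averages against the heat kernel of functions of at most linear growth. -/
lemma integral_heatKernel_mul_le {τ η D : ℝ} (hτ : 0 < τ) (hD : 0 ≤ D) {h : E → ℝ}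
    (h0 : ∀ z, 0 ≤ h z) (hh : ∀ z, h z ≤ η + D * ‖z‖) :
    ∫ z, heatKernel τ z * h z ≤ η + D * (2 * 2 ^ ((d : ℝ) / 2) * √τ) := by
  have i1 := (integrable_heatKernel (d := d) hτ).mul_const η
  have i2 := (integrable_norm_mul_heatKernel (d := d) hτ).const_mul D
  calc ∫ z, heatKernel τ z * h z
      ≤ ∫ z, (heatKernel τ z * η + D * (‖z‖ * heatKernel τ z)) := by
        refine integral_mono_of_nonneg (.of_forall fun z => mul_nonneg (heatKernel_nonneg hτ z)
          (h0 z)) (i1.add i2) (.of_forall fun z => ?_)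
        have := mul_le_mul_of_nonneg_left (hh z) (heatKernel_nonneg hτ z)
        simp only
        linarith
    _ = η + D * ∫ z : E, ‖z‖ * heatKernel τ z := by
        rw [integral_add i1 i2, integral_mul_const, integral_const_mul, integral_heatKernel hτ,
          one_mul]
    _ ≤ _ := by gcongr; exact integral_norm_mul_heatKernel_le hτ

lemma tendsto_heatFlow {φ : E → ℝ} {B : ℝ} (hφ : Continuous φ) (hB : ∀ x, |φ x| ≤ B) (x : E) :
    Tendsto (fun τ => heatFlow τ φ x) (𝓝[>] 0) (𝓝 (φ x)) := by
  have hB0 : 0 ≤ B := (abs_nonneg _).trans (hB 0)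
  rw [Metric.tendsto_nhds]
  intro ε hε
  obtain ⟨δ, hδ, hδ'⟩ := Metric.continuousAt_iff.1 (hφ.continuousAt (x := x)) (ε / 2) (by positivity)
  have hlim : Tendsto (fun τ : ℝ => ε / 2 + 2 * B / δ * (2 * 2 ^ ((d : ℝ) / 2) * √τ)) (𝓝[>] 0)
      (𝓝 (ε / 2 + 2 * B / δ * (2 * 2 ^ ((d : ℝ) / 2) * √0))) :=
    (Continuous.tendsto (by fun_prop) 0).mono_left nhdsWithin_le_nhds
  filter_upwards [hlim.eventually_lt_const (u := ε) (by simpa using hε),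
    self_mem_nhdsWithin] with τ h1 hτ
  rw [Real.dist_eq, heatFlow_eq_integral_add]
  have i1 : Integrable fun z => heatKernel τ z * φ (x + z) :=
    integrable_heatKernel_mul hτ (by fun_prop) fun z => hB (x + z)
  have e1 : (∫ z, heatKernel τ z * φ (x + z)) - φ x = ∫ z, heatKernel τ z * (φ (x + z) - φ x) := by
    simp_rw [mul_sub]
    rw [integral_sub i1 ((integrable_heatKernel hτ).mul_const _), integral_mul_const,
      integral_heatKernel hτ, one_mul]
  rw [e1]
  refine lt_of_le_of_lt ?_ h1
  calc |∫ z, heatKernel τ z * (φ (x + z) - φ x)|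
      ≤ ∫ z, |heatKernel τ z * (φ (x + z) - φ x)| := abs_integral_le_integral_abs
    _ = ∫ z, heatKernel τ z * |φ (x + z) - φ x| := by
        simp_rw [abs_mul, fun z : E => abs_of_nonneg (heatKernel_nonneg hτ z)]
    _ ≤ _ := by
        refine integral_heatKernel_mul_le hτ (by positivity)
          (fun z => abs_nonneg _) fun z => ?_
        rcases lt_or_ge ‖z‖ δ with hz | hz
        · have := hδ' (x := x + z) (by simpa [dist_eq_norm] using hz)
          rw [Real.dist_eq] at this
          have h2 : 0 ≤ 2 * B / δ * ‖z‖ := by positivity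
          linarith
        · have h2 : 2 * B ≤ 2 * B / δ * ‖z‖ := by
            rw [div_mul_eq_mul_div, le_div_iff₀ hδ]; gcongr
          have h3 := abs_sub (φ (x + z)) (φ x)
          have := hB (x + z)
          have := hB x
          linarith

/-- The heat flow of bounded continuous functions is tame, with constants that depend only on the
time and on the bound. -/
lemma exists_isTame_heatFlow {B ε : ℝ} (hε : 0 < ε) (hB0 : 0 ≤ B) :
    ∃ L, ∀ φ : E → ℝ, Continuous φ → (∀ x, 0 ≤ φ x) → (∀ x, φ x ≤ B) →
      IsTame ε (B + ε) L (fun x => heatFlow ε φ x + ε) := by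
  obtain ⟨K, hK⟩ : ∃ K, K = B * (2 ^ ((d : ℝ) / 2) / √(ε / 2)) := ⟨_, rfl⟩
  have hK0 : 0 ≤ K := by rw [hK]; positivity
  refine ⟨max K (K * (2 ^ ((d : ℝ) / 2) / √(ε / 2))), fun φ hφ h0 h1 => ?_⟩
  have hε2 : 0 < ε / 2 := by positivity
  have hB : ∀ x, |φ x| ≤ B := fun x => by rw [abs_of_nonneg (h0 x)]; exact h1 x
  -- half of the time makes `φ` Lipschitz, the other half makes the gradient Lipschitz
  set ψ := heatFlow (ε / 2) φ with hψ
  have hψc : Continuous ψ := continuous_heatFlow hε2 hφ hB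
  have hψB : ∀ x, |ψ x| ≤ B := abs_heatFlow_le hε2 hB
  have hψK : ∀ x y, |ψ x - ψ y| ≤ K * ‖x - y‖ := hK ▸ abs_heatFlow_sub_le hε2 hφ hB
  have heq : heatFlow ε φ = heatFlow (ε / 2) ψ := by
    ext x; rw [hψ, heatFlow_heatFlow hε2 hε2 hφ hB, add_halves]
  have hg := hasGradientAt_heatFlow hε2 hψc hψB
  rw [heq]
  have hnn : ∀ x, 0 ≤ heatFlow (ε / 2) ψ x := fun x => by
    rw [← heq]
    exact integral_nonneg fun y => mul_nonneg (heatKernel_nonneg hε _) (h0 y)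
  refine ⟨(continuous_heatFlow hε2 hψc hψB).add continuous_const, fun x => ?_, fun x => ?_,
    fun x z => ?_, heatFlowGrad (ε / 2) ψ, continuous_heatFlowGrad hε2 hψc hψB, fun x => ?_,
    fun x z => ?_⟩
  · linarith [hnn x]
  · have := (abs_le.1 (abs_heatFlow_le hε2 hψB x)).2
    linarith
  · rw [add_sub_add_right_eq_sub]
    have := heatFlow_sub_le_of_lipschitz hε2 hψc hψB hψK (x + z) x
    rw [add_sub_cancel_left] at this
    exact this.trans (by gcongr; exact le_max_left _ _)
  · exact (norm_heatFlowGrad_le_of_lipschitz hε2 hψc hψB hK0 hψK x).trans (le_max_left _ _)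
  · rw [add_sub_add_right_eq_sub]
    refine (abs_taylor_le_of_hasGradientAt hg
      (norm_heatFlowGrad_sub_le hε2 hψc hψB hK0 hψK) x z).trans ?_
    gcongr; exact le_max_right _ _

/-- Gaussian correlation inequality for bounded continuous functions. -/
lemma integral_rpow_mul_rpow_le {Γ : Measure (E × E)} [IsGaussian Γ]
    (h0 : ∫ z, z ∂Γ = 0) {θ₁ θ₂ : ℝ} (h₁ : 0 ≤ θ₁) (h₁' : θ₁ ≤ 1) (h₂ : 0 ≤ θ₂) (h₂' : θ₂ ≤ 1)
    (hV : ∀ u v : E, ∫ z, (θ₁ * inner ℝ u z.1 + θ₂ * inner ℝ v z.2) ^ 2 ∂Γ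
      ≤ θ₁ * ∫ z, inner ℝ u z.1 ^ 2 ∂Γ + θ₂ * ∫ z, inner ℝ v z.2 ^ 2 ∂Γ)
    {f g : E → ℝ} {B : ℝ} (hf : Continuous f) (hf0 : ∀ x, 0 ≤ f x) (hfB : ∀ x, f x ≤ B)
    (hg : Continuous g) (hg0 : ∀ x, 0 ≤ g x) (hgB : ∀ x, g x ≤ B) :
    ∫ z, f z.1 ^ θ₁ * g z.2 ^ θ₂ ∂Γ ≤ (∫ z, f z.1 ∂Γ) ^ θ₁ * (∫ z, g z.2 ∂Γ) ^ θ₂ := by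
  have hB0 : 0 ≤ B := (hf0 0).trans (hfB 0)
  set ε : ℕ → ℝ := fun n => 1 / ((n : ℝ) + 1) with hεdef
  have hε : ∀ n, 0 < ε n := fun n => by positivity
  have hε1 : ∀ n, ε n ≤ 1 := fun n => by
    rw [hεdef]; exact (div_le_one (by positivity)).2 (by linarith [(Nat.cast_nonneg n : (0:ℝ) ≤ n)])
  have hε0 : Tendsto ε atTop (𝓝 0) := tendsto_one_div_add_atTop_nhds_zero_nat
  have hεw : Tendsto ε atTop (𝓝[>] 0) :=
    tendsto_nhdsWithin_iff.2 ⟨hε0, .of_forall hε⟩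
  have happrox : ∀ k : E → ℝ, Continuous k → (∀ x, 0 ≤ k x) → (∀ x, k x ≤ B) →
      (∀ x, Tendsto (fun n => heatFlow (ε n) k x + ε n) atTop (𝓝 (k x))) ∧
      (∀ n, Continuous fun x => heatFlow (ε n) k x + ε n) ∧
      (∀ n x, 0 ≤ heatFlow (ε n) k x + ε n ∧ heatFlow (ε n) k x + ε n ≤ B + 1) := by
    intro k hk hk0 hkB
    have habs : ∀ x, |k x| ≤ B := fun x => by rw [abs_of_nonneg (hk0 x)]; exact hkB x
    refine ⟨fun x => ?_, fun n => ?_, fun n x => ⟨?_, ?_⟩⟩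
    · simpa using ((tendsto_heatFlow hk habs x).comp hεw).add hε0
    · exact (continuous_heatFlow (hε n) hk habs).add continuous_const
    · exact add_nonneg (integral_nonneg fun y => mul_nonneg (heatKernel_nonneg (hε n) _) (hk0 y))
        (hε n).le
    · exact add_le_add ((le_abs_self _).trans (abs_heatFlow_le (hε n) habs x)) (hε1 n)
  obtain ⟨tf, cf, bf⟩ := happrox f hf hf0 hfB
  obtain ⟨tg, cg, bg⟩ := happrox g hg hg0 hgB
  have key : ∀ n, ∫ z, (heatFlow (ε n) f z.1 + ε n) ^ θ₁ * (heatFlow (ε n) g z.2 + ε n) ^ θ₂ ∂Γ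
      ≤ (∫ z, (heatFlow (ε n) f z.1 + ε n) ∂Γ) ^ θ₁
        * (∫ z, (heatFlow (ε n) g z.2 + ε n) ∂Γ) ^ θ₂ := fun n => by
    obtain ⟨L, hL⟩ := exists_isTame_heatFlow (d := d) (hε n) hB0
    exact integral_rpow_mul_rpow_le_of_isTame h0 h₁ h₁' h₂ h₂' hV (hε n) (hL f hf hf0 hfB)
      (hL g hg hg0 hgB)
  have l1 : Tendsto (fun n => ∫ z, (heatFlow (ε n) f z.1 + ε n) ∂Γ) atTop (𝓝 (∫ z, f z.1 ∂Γ)) := by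
    refine tendsto_integral_of_dominated_convergence (fun _ => B + 1) (fun n => ?_)
      (integrable_const _) (fun n => .of_forall fun z => ?_) (.of_forall fun z => tf z.1)
    · exact ((cf n).comp continuous_fst).aestronglyMeasurable
    · rw [Real.norm_of_nonneg (bf n _).1]; exact (bf n _).2
  have l2 : Tendsto (fun n => ∫ z, (heatFlow (ε n) g z.2 + ε n) ∂Γ) atTop (𝓝 (∫ z, g z.2 ∂Γ)) := by
    refine tendsto_integral_of_dominated_convergence (fun _ => B + 1) (fun n => ?_)
      (integrable_const _) (fun n => .of_forall fun z => ?_) (.of_forall fun z => tg z.2)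
    · exact ((cg n).comp continuous_snd).aestronglyMeasurable
    · rw [Real.norm_of_nonneg (bg n _).1]; exact (bg n _).2
  have l3 : Tendsto (fun n => ∫ z, (heatFlow (ε n) f z.1 + ε n) ^ θ₁
      * (heatFlow (ε n) g z.2 + ε n) ^ θ₂ ∂Γ) atTop (𝓝 (∫ z, f z.1 ^ θ₁ * g z.2 ^ θ₂ ∂Γ)) := by
    refine tendsto_integral_of_dominated_convergence (fun _ => (B + 1) ^ θ₁ * (B + 1) ^ θ₂)
      (fun n => ?_) (integrable_const _) (fun n => .of_forall fun z => ?_)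
      (.of_forall fun z => ((tf z.1).rpow_const (Or.inr h₁)).mul
        ((tg z.2).rpow_const (Or.inr h₂)))
    · exact ((((cf n).comp continuous_fst).rpow_const fun _ => Or.inr h₁).mul
        (((cg n).comp continuous_snd).rpow_const fun _ => Or.inr h₂)).aestronglyMeasurable
    · rw [Real.norm_of_nonneg (mul_nonneg (Real.rpow_nonneg (bf n _).1 _)
        (Real.rpow_nonneg (bg n _).1 _))]
      exact mul_le_mul (Real.rpow_le_rpow (bf n _).1 (bf n _).2 h₁)
        (Real.rpow_le_rpow (bg n _).1 (bg n _).2 h₂) (Real.rpow_nonneg (bg n _).1 _)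
        (by positivity)
  exact le_of_tendsto_of_tendsto' l3 ((l1.rpow_const (Or.inr h₁)).mul (l2.rpow_const (Or.inr h₂)))
    key

/-! ### The sharp smoothing estimate for the heat flow -/

/-- The law of a Gaussian vector of variance `2 τ` is given by the heat kernel at time `τ`. -/
lemma map_smul_stdGaussian {τ : ℝ} (hτ : 0 < τ) :
    (stdGaussian E).map (fun z => √(2 * τ) • z)
      = volume.withDensity (fun z => ENNReal.ofReal (heatKernel τ z)) := by
  have hfin : IsFiniteMeasure
      ((volume : Measure E).withDensity (fun z => ENNReal.ofReal (heatKernel τ z))) :=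
    isFiniteMeasure_withDensity_ofReal (integrable_heatKernel hτ).2
  refine Measure.ext_of_charFun ?_
  ext t
  rw [charFun_map_smul, charFun_stdGaussian, charFun_apply,
    integral_withDensity_eq_integral_toReal_smul (by fun_prop) (.of_forall fun z => by simp)]
  have hb : 0 < ((1 / (4 * τ) : ℝ) : ℂ).re := by simp; positivity
  have key := GaussianFourier.integral_cexp_neg_mul_sq_norm_add hb Complex.I t
  have h1 : ∀ z : E, (ENNReal.ofReal (heatKernel τ z)).toReal
        • Complex.exp ((inner ℝ z t : ℝ) * Complex.I)
      = (((4 * Real.pi * τ) ^ (-(d : ℝ) / 2) : ℝ) : ℂ)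
        * Complex.exp (-((1 / (4 * τ) : ℝ) : ℂ) * ‖z‖ ^ 2 + Complex.I * (inner ℝ t z : ℝ)) := by
    intro z
    rw [ENNReal.toReal_ofReal (heatKernel_nonneg hτ z), heatKernel, Complex.real_smul,
      Complex.exp_add, real_inner_comm]
    push_cast
    rw [mul_assoc, mul_comm Complex.I]
    congr 3
    ring
  simp_rw [h1]
  rw [integral_const_mul, key, finrank_euclideanSpace_fin, ← mul_assoc]
  have h2 : (((4 * Real.pi * τ) ^ (-(d : ℝ) / 2) : ℝ) : ℂ)
      * ((Real.pi : ℂ) / ((1 / (4 * τ) : ℝ) : ℂ)) ^ ((d : ℂ) / 2) = 1 := by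
    rw [show (Real.pi : ℂ) / ((1 / (4 * τ) : ℝ) : ℂ) = ((4 * Real.pi * τ : ℝ) : ℂ) by
        push_cast; field_simp,
      show (d : ℂ) / 2 = (((d : ℝ) / 2 : ℝ) : ℂ) by push_cast; ring,
      ← Complex.ofReal_cpow (by positivity), ← Complex.ofReal_mul,
      ← Real.rpow_add (by positivity), show -(d : ℝ) / 2 + (d : ℝ) / 2 = 0 by ring]
    simp
  rw [h2, one_mul]
  congr 1
  rw [norm_smul, Real.norm_of_nonneg (Real.sqrt_nonneg _)]
  push_cast
  rw [mul_pow, Complex.I_sq, ← Complex.ofReal_pow, Real.sq_sqrt (by positivity)]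
  have : (τ : ℂ) ≠ 0 := by exact_mod_cast hτ.ne'
  push_cast
  field_simp

lemma lintegral_stdGaussian_smul {τ : ℝ} (hτ : 0 < τ) {H : E → ℝ≥0∞} (hH : Measurable H) :
    ∫⁻ z, H (√(2 * τ) • z) ∂(stdGaussian E) = ∫⁻ z, ENNReal.ofReal (heatKernel τ z) * H z := by
  rw [← lintegral_map (f := H) hH (by fun_prop : Measurable fun z : E => √(2 * τ) • z),
    map_smul_stdGaussian hτ, lintegral_withDensity_eq_lintegral_mul _ (by fun_prop) hH]
  rfl

/-- The linear map sending two independent standard Gaussians to the pair `(X, Y)` with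
`X` of variance `2 α` and `Y - κ X` independent of `X` of variance `2 η`. -/
def jointMap (α η κ : ℝ) : E × E →L[ℝ] E × E :=
  (√(2 * α) • ContinuousLinearMap.fst ℝ E E).prod
    ((κ * √(2 * α)) • ContinuousLinearMap.fst ℝ E E + √(2 * η) • ContinuousLinearMap.snd ℝ E E)

/-- For `α, η > 0`, the Gaussian measure on `E × E` with density `heatKernel α x * heatKernel η (y - κ x)`. -/
def jointGaussian (α η κ : ℝ) : Measure (E × E) :=
  ((stdGaussian E).prod (stdGaussian E)).map (jointMap α η κ)

instance (α η κ : ℝ) : IsGaussian (jointGaussian α η κ : Measure (E × E)) := by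
  unfold jointGaussian; infer_instance

lemma integral_id_jointGaussian (α η κ : ℝ) : ∫ z : E × E, z ∂(jointGaussian α η κ) = 0 := by
  have hid : Integrable (fun z : E × E => z) ((stdGaussian E).prod (stdGaussian E)) :=
    IsGaussian.integrable_id
  have h1 : Integrable (fun z : E => z) (stdGaussian E) := IsGaussian.integrable_id
  unfold jointGaussian
  rw [integral_map (jointMap α η κ).continuous.aemeasurable (by fun_prop),
    (jointMap α η κ).integral_comp_comm hid]
  have : ∫ z : E × E, z ∂((stdGaussian E).prod (stdGaussian E)) = 0 := by
    ext1
    · rw [fst_integral hid, integral_fun_fst (fun z : E => z)]; simp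
    · rw [snd_integral hid, integral_fun_snd (fun z : E => z)]; simp
  rw [this, map_zero]

lemma lintegral_jointGaussian {α η κ : ℝ} (hα : 0 < α) (hη : 0 < η) {H : E × E → ℝ≥0∞}
    (hH : Measurable H) :
    ∫⁻ z, H z ∂(jointGaussian α η κ) = ∫⁻ x, ∫⁻ y, ENNReal.ofReal (heatKernel α x)
      * (ENNReal.ofReal (heatKernel η (y - κ • x)) * H (x, y)) := by
  unfold jointGaussian
  rw [lintegral_map hH (jointMap α η κ).continuous.measurable, lintegral_prod
    (fun a => H (jointMap α η κ a)) (hH.comp (jointMap α η κ).continuous.measurable).aemeasurable]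
  have h1 : ∀ z : E, ∫⁻ w, H (jointMap α η κ (z, w)) ∂(stdGaussian E)
      = (fun x => ∫⁻ y, ENNReal.ofReal (heatKernel η (y - κ • x)) * H (x, y)) (√(2 * α) • z) := by
    intro z
    have h2 : ∀ w, jointMap α η κ (z, w)
        = (√(2 * α) • z, κ • √(2 * α) • z + √(2 * η) • w) := fun w => by
      simp [jointMap, mul_smul]
    simp_rw [h2]
    rw [lintegral_stdGaussian_smul hη
      (H := fun w => H (√(2 * α) • z, κ • √(2 * α) • z + w)) (by fun_prop)]
    refine Eq.trans ?_ (lintegral_add_right_eq_self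
      (fun y => ENNReal.ofReal (heatKernel η (y - κ • √(2 * α) • z)) * H (√(2 * α) • z, y))
      (κ • √(2 * α) • z))
    refine lintegral_congr fun w => ?_
    rw [add_sub_cancel_right, add_comm w]
  refine (lintegral_congr h1).trans ?_
  have h3 := lintegral_stdGaussian_smul hα
    (H := fun x => ∫⁻ y, ENNReal.ofReal (heatKernel η (y - κ • x)) * H (x, y))
    (Measurable.lintegral_prod_right' (f := fun p : E × E =>
      ENNReal.ofReal (heatKernel η (p.2 - κ • p.1)) * H p) (by fun_prop))
  refine h3.trans (lintegral_congr fun x => ?_)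
  rw [← lintegral_const_mul' _ _ ENNReal.ofReal_ne_top]

lemma integral_inner_sq_stdGaussian (u : E) :
    ∫ z, inner ℝ u z ^ 2 ∂(stdGaussian E) = ‖u‖ ^ 2 := by
  have h1 := variance_dual_stdGaussian (innerSL ℝ u : StrongDual ℝ E)
  rw [variance_of_integral_eq_zero (ContinuousLinearMap.continuous _).aemeasurable
    (integral_strongDual_stdGaussian _)] at h1
  simpa using h1

lemma integral_inner_stdGaussian (u : E) : ∫ z, inner ℝ u z ∂(stdGaussian E) = 0 :=
  integral_strongDual_stdGaussian (innerSL ℝ u : StrongDual ℝ E)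

lemma integral_inner_add_inner_sq (α η κ : ℝ) (hα : 0 ≤ α) (hη : 0 ≤ η) (u v : E) :
    ∫ z, (inner ℝ u z.1 + inner ℝ v z.2) ^ 2 ∂(jointGaussian α η κ)
      = 2 * α * ‖u‖ ^ 2 + 4 * α * κ * inner ℝ u v + 2 * (κ ^ 2 * α + η) * ‖v‖ ^ 2 := by
  have h2 : ∀ w : E, Integrable (fun z => inner ℝ w z ^ 2) (stdGaussian E) := fun w =>
    (IsGaussian.memLp_dual (stdGaussian E) (innerSL ℝ w) 2 (by norm_num)).integrable_sq
  have h1 : ∀ w : E, Integrable (fun z => inner ℝ w z) (stdGaussian E) := fun w =>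
    IsGaussian.integrable_dual (stdGaussian E) (innerSL ℝ w)
  unfold jointGaussian
  rw [integral_map (jointMap α η κ).continuous.aemeasurable (by fun_prop)]
  set U : E := √(2 * α) • u + (κ * √(2 * α)) • v with hU
  set V : E := √(2 * η) • v with hV
  have h3 : ∀ p : E × E, (inner ℝ u (jointMap α η κ p).1 + inner ℝ v (jointMap α η κ p).2) ^ 2
      = inner ℝ U p.1 ^ 2 + 2 * (inner ℝ U p.1 * inner ℝ V p.2) + inner ℝ V p.2 ^ 2 := by
    intro p
    simp only [jointMap, hU, hV, ContinuousLinearMap.prod_apply, smul_apply,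
      ContinuousLinearMap.coe_fst', ContinuousLinearMap.coe_snd', add_apply,
      inner_add_left, inner_add_right, real_inner_smul_left, real_inner_smul_right]
    ring
  simp_rw [h3]
  have i1 := (h2 U).comp_fst (stdGaussian E)
  have i2 := ((h1 U).mul_prod (h1 V)).const_mul 2
  have i3 := (h2 V).comp_snd (stdGaussian E)
  have i12 : Integrable (fun p : E × E => inner ℝ U p.1 ^ 2 + 2 * (inner ℝ U p.1 * inner ℝ V p.2))
    ((stdGaussian E).prod (stdGaussian E)) := i1.add i2
  rw [integral_add i12 i3, integral_add i1 i2, integral_const_mul,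
    integral_prod_mul (fun z => inner ℝ U z) (fun z => inner ℝ V z),
    integral_fun_fst (fun z => inner ℝ U z ^ 2), integral_fun_snd (fun z => inner ℝ V z ^ 2)]
  simp only [integral_inner_stdGaussian, integral_inner_sq_stdGaussian]
  have s1 : √(2 * α) ^ 2 = 2 * α := Real.sq_sqrt (by positivity)
  have s2 : √(2 * η) ^ 2 = 2 * η := Real.sq_sqrt (by positivity)
  have n1 : ‖U‖ ^ 2 = 2 * α * ‖u‖ ^ 2 + 4 * α * κ * inner ℝ u v + 2 * κ ^ 2 * α * ‖v‖ ^ 2 := by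
    rw [hU, norm_add_sq_real, norm_smul, norm_smul, real_inner_smul_left, real_inner_smul_right,
      mul_pow, mul_pow, Real.norm_eq_abs, Real.norm_eq_abs, sq_abs, sq_abs, mul_pow, s1]
    linear_combination (2 * κ * inner ℝ u v) * s1
  have n2 : ‖V‖ ^ 2 = 2 * η * ‖v‖ ^ 2 := by
    rw [hV, norm_smul, mul_pow, Real.norm_eq_abs, sq_abs, s2]
  rw [n1, n2]
  simp
  ring

lemma norm_sub_smul_sq (x y : E) (κ : ℝ) :
    ‖y - κ • x‖ ^ 2 = ‖y‖ ^ 2 - 2 * κ * inner ℝ x y + κ ^ 2 * ‖x‖ ^ 2 := by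
  rw [norm_sub_sq_real, norm_smul, mul_pow, Real.norm_eq_abs, sq_abs, real_inner_smul_right,
    real_inner_comm]
  ring

/-- The density of `jointGaussian α η κ`, disintegrated over the second variable. -/
lemma heatKernel_mul_heatKernel_sub_smul {α η κ β : ℝ} (hα : 0 < α) (hη : 0 < η)
    (hβ : β = κ ^ 2 * α + η) (x y : E) :
    heatKernel α x * heatKernel η (y - κ • x)
      = heatKernel β y * heatKernel (α * η / β) (x - (κ * α / β) • y) := by
  have hβ0 : 0 < β := by rw [hβ]; positivity
  unfold heatKernel
  rw [mul_mul_mul_comm, mul_mul_mul_comm ((4 * Real.pi * β) ^ _), ← Real.exp_add, ← Real.exp_add,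
    ← Real.mul_rpow (by positivity) (by positivity), ← Real.mul_rpow (by positivity) (by positivity),
    norm_sub_smul_sq, norm_sub_smul_sq, real_inner_comm]
  congr 2
  · field_simp
  · field_simp
    rw [hβ]
    ring

lemma lintegral_snd_jointGaussian {α η κ β : ℝ} (hα : 0 < α) (hη : 0 < η)
    (hβ : β = κ ^ 2 * α + η) {H : E → ℝ≥0∞} (hH : Measurable H) :
    ∫⁻ z, H z.2 ∂(jointGaussian α η κ) = ∫⁻ y, ENNReal.ofReal (heatKernel β y) * H y := by
  have hβ0 : 0 < β := by rw [hβ]; positivity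
  have hαη : 0 < α * η / β := by positivity
  rw [lintegral_jointGaussian hα hη (H := fun z => H z.2) (by fun_prop), lintegral_lintegral_swap]
  · refine lintegral_congr fun y => ?_
    have h1 : ∀ x : E, ENNReal.ofReal (heatKernel α x)
        * (ENNReal.ofReal (heatKernel η (y - κ • x)) * H y)
        = ENNReal.ofReal (heatKernel (α * η / β) (x - (κ * α / β) • y))
          * (ENNReal.ofReal (heatKernel β y) * H y) := fun x => by
      rw [← mul_assoc, ← ENNReal.ofReal_mul (heatKernel_nonneg hα x),
        heatKernel_mul_heatKernel_sub_smul hα hη hβ, ENNReal.ofReal_mul (heatKernel_nonneg hβ0 y)]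
      ring
    simp_rw [h1]
    have hm : Measurable fun x : E =>
        ENNReal.ofReal (heatKernel (α * η / β) (x - (κ * α / β) • y)) :=
      ((continuous_heatKernel _).comp (by fun_prop)).measurable.ennreal_ofReal
    rw [lintegral_mul_const _ hm,
      lintegral_sub_right_eq_self (fun x : E => ENNReal.ofReal (heatKernel (α * η / β) x)),
      ← ofReal_integral_eq_lintegral_ofReal (integrable_heatKernel hαη)
        (.of_forall fun x => heatKernel_nonneg hαη x), integral_heatKernel hαη]
    simp
  · have h2 : Continuous fun p : E × E => heatKernel η (p.2 - κ • p.1) :=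
      (continuous_heatKernel η).comp (by fun_prop)
    have h3 : Continuous fun p : E × E => heatKernel α p.1 :=
      (continuous_heatKernel α).comp (by fun_prop)
    exact (h3.measurable.ennreal_ofReal.mul (h2.measurable.ennreal_ofReal.mul
      (hH.comp measurable_snd))).aemeasurable

lemma lintegral_fst_jointGaussian {α η κ : ℝ} (hα : 0 < α) (hη : 0 < η)
    {H : E → ℝ≥0∞} (hH : Measurable H) :
    ∫⁻ z, H z.1 ∂(jointGaussian α η κ) = ∫⁻ x, ENNReal.ofReal (heatKernel α x) * H x := by
  rw [lintegral_jointGaussian hα hη (H := fun z => H z.1) (by fun_prop)]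
  refine lintegral_congr fun x => ?_
  have hm : Measurable fun y : E => ENNReal.ofReal (heatKernel η (y - κ • x)) :=
    ((continuous_heatKernel _).comp (by fun_prop)).measurable.ennreal_ofReal
  change ∫⁻ y, ENNReal.ofReal (heatKernel α x) * (ENNReal.ofReal (heatKernel η (y - κ • x)) * H x)
    = _
  rw [lintegral_const_mul _ (hm.mul_const _), lintegral_mul_const _ hm,
    lintegral_sub_right_eq_self (fun y : E => ENNReal.ofReal (heatKernel η y)),
    ← ofReal_integral_eq_lintegral_ofReal (integrable_heatKernel hη)
      (.of_forall fun x => heatKernel_nonneg hη x), integral_heatKernel hη]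
  simp

/-- The function `K` in the variable `t = 1 / r`. -/
def conjRatio (t : ℝ) : ℝ := t ^ t / (1 - t) ^ (1 - t)

lemma conjRatio_pos {t : ℝ} (h0 : 0 < t) (h1 : t < 1) : 0 < conjRatio t :=
  div_pos (Real.rpow_pos_of_pos h0 _) (Real.rpow_pos_of_pos (by linarith) _)

lemma conjRatio_one_sub (t : ℝ) : conjRatio (1 - t) = (conjRatio t)⁻¹ := by
  rw [conjRatio, conjRatio, inv_div, sub_sub_cancel]

/-- The sharp constant of `e^{τΔ} : L^a → L^b`, in terms of `x = 1 / a` and `y = 1 / b`. -/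
def smoothingConst (d : ℕ) (x y τ : ℝ) : ℝ :=
  (conjRatio y / conjRatio x) ^ ((d : ℝ) / 2)
    * (4 * Real.pi * τ / (x - y)) ^ (-((d : ℝ) / 2) * (x - y))

lemma smoothingConst_pos {x y τ : ℝ} (hy : 0 < y) (hyx : y < x) (hx : x < 1) (hτ : 0 < τ) :
    0 < smoothingConst d x y τ := by
  have := conjRatio_pos hy (hyx.trans hx)
  have := conjRatio_pos (hy.trans hyx) hx
  have : 0 < x - y := by linarith
  unfold smoothingConst
  positivity

section Sharp

variable {x y τ : ℝ}

lemma smoothingConst_eq (hy : 0 < y) (hyx : y < x) (hx : x < 1) (hτ : 0 < τ) :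
    smoothingConst d x y τ = ((4 * Real.pi * (τ * (x * (1 - x)) / (x - y))) ^ (1 - x)
      * (4 * Real.pi * (τ * ((1 - y) * y) / (x - y))) ^ (-(1 - y)) * (y / x)) ^ ((d : ℝ) / 2) := by
  have hk : 0 < x - y := by linarith
  have hx0 : 0 < x := hy.trans hyx
  have hx1 : 0 < 1 - x := by linarith
  have hy1 : 0 < 1 - y := by linarith
  have hT : 0 < 4 * Real.pi * τ / (x - y) := by positivity
  rw [smoothingConst, show -((d : ℝ) / 2) * (x - y) = (-(x - y)) * ((d : ℝ) / 2) by ring,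
    Real.rpow_mul hT.le, ← Real.mul_rpow (div_pos (conjRatio_pos hy (hyx.trans hx))
      (conjRatio_pos hx0 hx)).le (Real.rpow_nonneg hT.le _)]
  congr 1
  rw [show 4 * Real.pi * (τ * (x * (1 - x)) / (x - y)) = (4 * Real.pi * τ / (x - y)) * (x * (1 - x))
      by ring, show 4 * Real.pi * (τ * ((1 - y) * y) / (x - y))
      = (4 * Real.pi * τ / (x - y)) * ((1 - y) * y) by ring]
  unfold conjRatio
  apply Real.log_injOn_pos
  · have := Real.rpow_pos_of_pos hy y
    simp only [mem_Ioi]; positivity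
  · simp only [mem_Ioi]; positivity
  generalize 4 * Real.pi * τ / (x - y) = T at hT
  have e1 : ∀ a b : ℝ, 0 < a → Real.log (a ^ b) = b * Real.log a := fun a b h => Real.log_rpow h b
  rw [Real.log_mul (by positivity) (by positivity), Real.log_div (by positivity) (by positivity),
    Real.log_div (by positivity) (by positivity), Real.log_div (by positivity) (by positivity),
    Real.log_mul (by positivity) (by positivity), Real.log_mul (by positivity) (by positivity),
    Real.log_div (by positivity) (by positivity), e1 _ _ hy, e1 _ _ hy1, e1 _ _ hx0, e1 _ _ hx1,
    e1 _ _ hT, e1 _ _ (by positivity), e1 _ _ (by positivity),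
    Real.log_mul (by positivity) (by positivity), Real.log_mul (by positivity) (by positivity),
    Real.log_mul (by positivity) (by positivity), Real.log_mul (by positivity) (by positivity)]
  ring

/-- The density of the extremal Gaussian for the bilinear form
`∫∫ f(v) G_τ(v - w) h(w)`: the heat kernel weighted by powers of the marginals of a joint Gaussian is
a multiple of its density, and the factor is the sharp constant. -/
lemma heatKernel_sub_mul_eq (hy : 0 < y) (hyx : y < x) (hx : x < 1) (hτ : 0 < τ) (v w : E) :
    heatKernel τ (v - w) * heatKernel (τ * (x * (1 - x)) / (x - y)) v ^ x
        * heatKernel (τ * ((1 - y) * y) / (x - y)) w ^ (1 - y)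
      = smoothingConst d x y τ * (heatKernel (τ * (x * (1 - x)) / (x - y)) v
        * heatKernel (τ * (y / x)) (w - (y / x) • v)) := by
  have hk : 0 < x - y := by linarith
  have hx0 : 0 < x := hy.trans hyx
  have hx1 : 0 < 1 - x := by linarith
  have hy1 : 0 < 1 - y := by linarith
  rw [smoothingConst_eq hy hyx hx hτ]
  set α := τ * (x * (1 - x)) / (x - y) with hα
  set β := τ * ((1 - y) * y) / (x - y) with hβ
  have hα0 : 0 < α := by positivity
  have hβ0 : 0 < β := by positivity
  have hn : ‖v - w‖ ^ 2 = ‖v‖ ^ 2 - 2 * inner ℝ v w + ‖w‖ ^ 2 := norm_sub_sq_real v w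
  have hexp : Real.exp (-‖v - w‖ ^ 2 / (4 * τ)) * Real.exp (-‖v‖ ^ 2 / (4 * α) * x)
      * Real.exp (-‖w‖ ^ 2 / (4 * β) * (1 - y))
      = Real.exp (-‖v‖ ^ 2 / (4 * α)) * Real.exp (-‖w - (y / x) • v‖ ^ 2 / (4 * (τ * (y / x)))) := by
    rw [← Real.exp_add, ← Real.exp_add, ← Real.exp_add, norm_sub_smul_sq, hn]
    congr 1
    rw [hα, hβ]
    field_simp
    ring
  have hpre : (4 * Real.pi * τ) ^ (-(d : ℝ) / 2) * ((4 * Real.pi * α) ^ (-(d : ℝ) / 2)) ^ x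
      * ((4 * Real.pi * β) ^ (-(d : ℝ) / 2)) ^ (1 - y)
      = ((4 * Real.pi * α) ^ (1 - x) * (4 * Real.pi * β) ^ (-(1 - y)) * (y / x)) ^ ((d : ℝ) / 2)
        * ((4 * Real.pi * α) ^ (-(d : ℝ) / 2) * (4 * Real.pi * (τ * (y / x))) ^ (-(d : ℝ) / 2)) := by
    have hA : 0 < 4 * Real.pi * α := by positivity
    have hB : 0 < 4 * Real.pi * β := by positivity
    have hC : 0 < 4 * Real.pi * τ := by positivity
    have hD : 0 < y / x := by positivity
    rw [show 4 * Real.pi * (τ * (y / x)) = (4 * Real.pi * τ) * (y / x) by ring]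
    generalize 4 * Real.pi * α = A at *
    generalize 4 * Real.pi * β = B at *
    generalize 4 * Real.pi * τ = C at *
    generalize y / x = D at *
    have e1 : ∀ a b : ℝ, 0 < a → Real.log (a ^ b) = b * Real.log a := fun a b h => Real.log_rpow h b
    apply Real.log_injOn_pos
    · simp only [mem_Ioi]; positivity
    · simp only [mem_Ioi]; positivity
    rw [Real.log_mul (by positivity) (by positivity), Real.log_mul (by positivity) (by positivity),
      Real.log_mul (by positivity) (by positivity), Real.log_mul (by positivity) (by positivity),
      e1 C _ hC, e1 _ x (by positivity), e1 _ (1 - y) (by positivity), e1 A _ hA, e1 B _ hB,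
      e1 _ _ (by positivity), e1 _ _ (by positivity), Real.log_mul (by positivity) (by positivity),
      Real.log_mul (by positivity) (by positivity), Real.log_mul (by positivity) (by positivity),
      e1 _ _ hA, e1 _ _ hB]
    ring
  unfold heatKernel
  rw [Real.mul_rpow (x := (4 * Real.pi * α) ^ _) (z := x) (by positivity) (by positivity),
    Real.mul_rpow (x := (4 * Real.pi * β) ^ _) (z := 1 - y) (by positivity) (by positivity),
    ← Real.exp_mul, ← Real.exp_mul]
  linear_combination (Real.exp (-‖v - w‖ ^ 2 / (4 * τ)) * Real.exp (-‖v‖ ^ 2 / (4 * α) * x)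
      * Real.exp (-‖w‖ ^ 2 / (4 * β) * (1 - y))) * hpre +
    (((4 * Real.pi * α) ^ (1 - x) * (4 * Real.pi * β) ^ (-(1 - y)) * (y / x)) ^ ((d : ℝ) / 2)
        * ((4 * Real.pi * α) ^ (-(d : ℝ) / 2) * (4 * Real.pi * (τ * (y / x))) ^ (-(d : ℝ) / 2)))
      * hexp

/-- The Gaussian correlation inequality for the extremal Gaussian. -/
lemma lintegral_rpow_mul_rpow_jointGaussian_le (hy : 0 < y) (hyx : y < x) (hx : x < 1)
    (hτ : 0 < τ) {f h : E → ℝ} {B : ℝ} (hf : Continuous f) (hf0 : ∀ v, 0 ≤ f v)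
    (hfB : ∀ v, f v ≤ B) (hh : Continuous h) (hh0 : ∀ v, 0 ≤ h v) (hhB : ∀ v, h v ≤ B) :
    ∫⁻ z, ENNReal.ofReal (f z.1 ^ x * h z.2 ^ (1 - y))
        ∂(jointGaussian (τ * (x * (1 - x)) / (x - y)) (τ * (y / x)) (y / x))
      ≤ (∫⁻ v, ENNReal.ofReal (heatKernel (τ * (x * (1 - x)) / (x - y)) v)
          * ENNReal.ofReal (f v)) ^ x
        * (∫⁻ w, ENNReal.ofReal (heatKernel (τ * ((1 - y) * y) / (x - y)) w)
          * ENNReal.ofReal (h w)) ^ (1 - y) := by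
  have hk : 0 < x - y := by linarith
  have hx0 : 0 < x := hy.trans hyx
  have hx1 : 0 < 1 - x := by linarith
  have hy1 : 0 < 1 - y := by linarith
  set α := τ * (x * (1 - x)) / (x - y) with hα
  set β := τ * ((1 - y) * y) / (x - y) with hβ
  have hα0 : 0 < α := by positivity
  have hβ0 : 0 < β := by positivity
  have hη0 : 0 < τ * (y / x) := by positivity
  have hβe : β = (y / x) ^ 2 * α + τ * (y / x) := by
    rw [hα, hβ]; field_simp; ring
  set Γ : Measure (E × E) := jointGaussian α (τ * (y / x)) (y / x) with hΓ
  have hV : ∀ u v : E, ∫ z, (x * inner ℝ u z.1 + (1 - y) * inner ℝ v z.2) ^ 2 ∂Γ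
      ≤ x * ∫ z, inner ℝ u z.1 ^ 2 ∂Γ + (1 - y) * ∫ z, inner ℝ v z.2 ^ 2 ∂Γ := by
    intro u v
    have a1 := integral_inner_add_inner_sq α (τ * (y / x)) (y / x) hα0.le hη0.le (x • u)
      ((1 - y) • v)
    have a2 := integral_inner_add_inner_sq α (τ * (y / x)) (y / x) hα0.le hη0.le u 0
    have a3 := integral_inner_add_inner_sq α (τ * (y / x)) (y / x) hα0.le hη0.le 0 v
    simp only [real_inner_smul_left, real_inner_smul_right, norm_smul, inner_zero_left,
      inner_zero_right, norm_zero, add_zero, zero_add, mul_pow, Real.norm_eq_abs, sq_abs, ← hΓ,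
      ← hβe] at a1 a2 a3
    rw [a1, a2, a3]
    have h1 : 2 * inner ℝ ((x * (1 - x)) • u) (((1 - y) * y) • v)
        ≤ ‖(x * (1 - x)) • u‖ ^ 2 + ‖((1 - y) * y) • v‖ ^ 2 := by
      have := real_inner_le_norm ((x * (1 - x)) • u) (((1 - y) * y) • v)
      nlinarith [sq_nonneg (‖(x * (1 - x)) • u‖ - ‖((1 - y) * y) • v‖)]
    rw [real_inner_smul_left, real_inner_smul_right, norm_smul, norm_smul, mul_pow, mul_pow,
      Real.norm_eq_abs, Real.norm_eq_abs, sq_abs, sq_abs] at h1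
    have h2 := mul_le_mul_of_nonneg_left h1 (by positivity : 0 ≤ 2 * τ / (x - y))
    have e1 : α * (y / x) = τ * ((1 - x) * y) / (x - y) := by rw [hα]; field_simp
    have e2 : 4 * α * (y / x) = 4 * (α * (y / x)) := by ring
    rw [e2, e1, hα, hβ]
    have e3 : ∀ r : ℝ, r / (x - y) = r * (1 / (x - y)) := fun r => by ring
    rw [e3] at h2 ⊢
    rw [e3 (τ * ((1 - x) * y)), e3 (τ * ((1 - y) * y))]
    linarith
  have key := integral_rpow_mul_rpow_le (Γ := Γ) (integral_id_jointGaussian _ _ _) hx0.le hx.le hy1.le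
    (by linarith) hV hf hf0 hfB hh hh0 hhB
  have hB0 : 0 ≤ B := (hf0 0).trans (hfB 0)
  have i1 : Integrable (fun z : E × E => f z.1) Γ :=
    Integrable.of_bound (hf.comp continuous_fst).aestronglyMeasurable B (.of_forall fun z => by
      rw [Real.norm_of_nonneg (hf0 _)]; exact hfB _)
  have i2 : Integrable (fun z : E × E => h z.2) Γ :=
    Integrable.of_bound (hh.comp continuous_snd).aestronglyMeasurable B (.of_forall fun z => by
      rw [Real.norm_of_nonneg (hh0 _)]; exact hhB _)
  have p12 : ∀ z : E × E, 0 ≤ f z.1 ^ x * h z.2 ^ (1 - y) := fun z =>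
    mul_nonneg (Real.rpow_nonneg (hf0 _) _) (Real.rpow_nonneg (hh0 _) _)
  have i12 : Integrable (fun z : E × E => f z.1 ^ x * h z.2 ^ (1 - y)) Γ := by
    refine Integrable.of_bound (((hf.comp continuous_fst).rpow_const fun _ => Or.inr hx0.le).mul
      ((hh.comp continuous_snd).rpow_const fun _ => Or.inr hy1.le)).aestronglyMeasurable
      (B ^ x * B ^ (1 - y)) (.of_forall fun z => ?_)
    rw [Real.norm_of_nonneg (p12 z)]
    exact mul_le_mul (Real.rpow_le_rpow (hf0 _) (hfB _) hx0.le)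
      (Real.rpow_le_rpow (hh0 _) (hhB _) hy1.le) (Real.rpow_nonneg (hh0 _) _) (by positivity)
  rw [← lintegral_fst_jointGaussian (κ := y / x) hα0 hη0 hf.measurable.ennreal_ofReal,
    ← lintegral_snd_jointGaussian hα0 hη0 hβe hh.measurable.ennreal_ofReal, ← hΓ,
    ← ofReal_integral_eq_lintegral_ofReal i12 (.of_forall p12),
    ← ofReal_integral_eq_lintegral_ofReal i1 (.of_forall fun z => hf0 _),
    ← ofReal_integral_eq_lintegral_ofReal i2 (.of_forall fun z => hh0 _),
    ENNReal.ofReal_rpow_of_nonneg (integral_nonneg fun z => hf0 _) hx0.le,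
    ENNReal.ofReal_rpow_of_nonneg (integral_nonneg fun z => hh0 _) hy1.le,
    ← ENNReal.ofReal_mul (Real.rpow_nonneg (integral_nonneg fun z => hf0 _) _)]
  exact ENNReal.ofReal_le_ofReal key

end Sharp

end Gaussian

section Sharp

variable {x y τ : ℝ}

lemma min_mul_tendsto {c r : ℝ} (hr : 0 < r) :
    Tendsto (fun n : ℕ => min c (n * r)) atTop (𝓝 c) := by
  obtain ⟨N, hN⟩ := exists_nat_ge (c / r)
  refine tendsto_const_nhds.congr' ?_
  filter_upwards [eventually_ge_atTop N] with n hn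
  rw [min_eq_left]
  have : (N : ℝ) ≤ n := by exact_mod_cast hn
  rw [← div_le_iff₀ hr]
  exact hN.trans this

lemma min_mul_mono {c r : ℝ} (hr : 0 < r) : Monotone (fun n : ℕ => min c (n * r)) := by
  intro m n h
  have : (m : ℝ) ≤ n := by exact_mod_cast h
  exact min_le_min_left _ (by gcongr)

/-- The sharp bilinear estimate for functions dominated by powers of the Gaussian marginals: the
Gaussian correlation inequality is applied to `f^{1/x}` and `h^{1/(1-y)}` divided by these
marginals. -/
lemma lintegral_lintegral_heatKernel_le_of_le (hy : 0 < y) (hyx : y < x) (hx : x < 1)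
    (hτ : 0 < τ) {f h : E → ℝ} {B : ℝ} (hf : Continuous f) (hf0 : ∀ v, 0 ≤ f v)
    (hfB : ∀ v, f v ≤ B * heatKernel (τ * (x * (1 - x)) / (x - y)) v ^ x)
    (hh : Continuous h) (hh0 : ∀ v, 0 ≤ h v)
    (hhB : ∀ v, h v ≤ B * heatKernel (τ * ((1 - y) * y) / (x - y)) v ^ (1 - y)) :
    ∫⁻ v, ∫⁻ w, ENNReal.ofReal (f v * heatKernel τ (v - w) * h w)
      ≤ ENNReal.ofReal (smoothingConst d x y τ) * ((∫⁻ v, ENNReal.ofReal (f v ^ x⁻¹)) ^ x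
        * (∫⁻ w, ENNReal.ofReal (h w ^ (1 - y)⁻¹)) ^ (1 - y)) := by
  have hk : 0 < x - y := by linarith
  have hx0 : 0 < x := hy.trans hyx
  have hx1 : 0 < 1 - x := by linarith
  have hy1 : 0 < 1 - y := by linarith
  set α := τ * (x * (1 - x)) / (x - y) with hα
  set β := τ * ((1 - y) * y) / (x - y) with hβ
  have hα0 : 0 < α := by positivity
  have hβ0 : 0 < β := by positivity
  have hη0 : 0 < τ * (y / x) := by positivity
  have pα := heatKernel_pos (d := d) hα0
  have pβ := heatKernel_pos (d := d) hβ0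
  -- the powers `f^{1/x}` and `h^{1/(1-y)}` relative to the Gaussian marginals
  have build : ∀ (θ γ : ℝ) (k : E → ℝ), 0 < θ → 0 < γ → Continuous k → (∀ v, 0 ≤ k v) →
      (∀ v, k v ≤ B * heatKernel γ v ^ θ) →
      Continuous (fun v => k v ^ θ⁻¹ / heatKernel γ v) ∧ (∀ v, 0 ≤ k v ^ θ⁻¹ / heatKernel γ v) ∧
      (∀ v, k v ^ θ⁻¹ / heatKernel γ v ≤ B ^ θ⁻¹) ∧
      (∀ v, (k v ^ θ⁻¹ / heatKernel γ v) ^ θ = k v / heatKernel γ v ^ θ) ∧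
      (∀ v, heatKernel γ v * (k v ^ θ⁻¹ / heatKernel γ v) = k v ^ θ⁻¹) := by
    intro θ γ k hθ hγ hk hk0 hkB
    have pγ := heatKernel_pos (d := d) hγ
    have hB : 0 ≤ B := by
      have := (hk0 0).trans (hkB 0)
      exact nonneg_of_mul_nonneg_left this (Real.rpow_pos_of_pos (pγ 0) θ)
    refine ⟨(hk.rpow_const fun _ => Or.inr (by positivity)).div (continuous_heatKernel γ)
      fun v => (pγ v).ne', fun v => div_nonneg (Real.rpow_nonneg (hk0 v) _) (pγ v).le,
      fun v => ?_, fun v => ?_, fun v => ?_⟩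
    · rw [div_le_iff₀ (pγ v)]
      calc k v ^ θ⁻¹ ≤ (B * heatKernel γ v ^ θ) ^ θ⁻¹ :=
            Real.rpow_le_rpow (hk0 v) (hkB v) (by positivity)
        _ = B ^ θ⁻¹ * heatKernel γ v := by
            rw [Real.mul_rpow hB (Real.rpow_nonneg (pγ v).le _), Real.rpow_rpow_inv (pγ v).le hθ.ne']
    · rw [Real.div_rpow (Real.rpow_nonneg (hk0 v) _) (pγ v).le, Real.rpow_inv_rpow (hk0 v) hθ.ne']
    · rw [mul_div_cancel₀ _ (pγ v).ne']
  obtain ⟨cF, F0, FB, Fp, Fi⟩ := build x α f hx0 hα0 hf hf0 hfB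
  obtain ⟨cH, H0, HB, Hp, Hi⟩ := build (1 - y) β h hy1 hβ0 hh hh0 hhB
  have key := lintegral_rpow_mul_rpow_jointGaussian_le (d := d) hy hyx hx hτ
    (B := max (B ^ x⁻¹) (B ^ (1 - y)⁻¹)) cF F0
    (fun v => (FB v).trans (le_max_left _ _)) cH H0 (fun v => (HB v).trans (le_max_right _ _))
  rw [← hα, ← hβ] at key
  simp_rw [← ENNReal.ofReal_mul (pα _).le, ← ENNReal.ofReal_mul (pβ _).le, Fi, Hi, Fp, Hp] at key
  rw [lintegral_jointGaussian hα0 hη0] at key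
  · calc _ = ENNReal.ofReal (smoothingConst d x y τ) * ∫⁻ v, ∫⁻ w, ENNReal.ofReal (heatKernel α v)
          * (ENNReal.ofReal (heatKernel (τ * (y / x)) (w - (y / x) • v))
          * ENNReal.ofReal (f v / heatKernel α v ^ x * (h w / heatKernel β w ^ (1 - y)))) := by
          rw [← lintegral_const_mul' _ _ ENNReal.ofReal_ne_top]
          refine lintegral_congr fun v => ?_
          rw [← lintegral_const_mul' _ _ ENNReal.ofReal_ne_top]
          refine lintegral_congr fun w => ?_
          rw [← ENNReal.ofReal_mul (heatKernel_nonneg hη0 _), ← ENNReal.ofReal_mul (pα v).le,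
            ← ENNReal.ofReal_mul (smoothingConst_pos hy hyx hx hτ).le]
          congr 1
          have e := heatKernel_sub_mul_eq hy hyx hx hτ v w
          rw [← hα, ← hβ] at e
          have r1 := Real.rpow_pos_of_pos (pα v) x
          have r2 := Real.rpow_pos_of_pos (pβ w) (1 - y)
          have e' : heatKernel τ (v - w) = smoothingConst d x y τ * (heatKernel α v
              * heatKernel (τ * (y / x)) (w - (y / x) • v))
              / (heatKernel α v ^ x * heatKernel β w ^ (1 - y)) := by
            rw [eq_div_iff (by positivity), ← e, mul_assoc]
          rw [e']
          ring
      _ ≤ _ := by gcongr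
  · have m1 : Continuous fun z : E × E => f z.1 / heatKernel α z.1 ^ x :=
      (hf.comp continuous_fst).div (((continuous_heatKernel α).comp continuous_fst).rpow_const
        fun _ => Or.inr hx0.le) fun z => (Real.rpow_pos_of_pos (pα _) x).ne'
    have m2 : Continuous fun z : E × E => h z.2 / heatKernel β z.2 ^ (1 - y) :=
      (hh.comp continuous_snd).div (((continuous_heatKernel β).comp continuous_snd).rpow_const
        fun _ => Or.inr hy1.le) fun z => (Real.rpow_pos_of_pos (pβ _) (1 - y)).ne'
    exact (m1.mul m2).measurable.ennreal_ofReal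

/-- The sharp bilinear estimate for the heat kernel. -/
lemma lintegral_lintegral_heatKernel_le (hy : 0 < y) (hyx : y < x) (hx : x < 1)
    (hτ : 0 < τ) {f h : E → ℝ} (hf : Continuous f) (hf0 : ∀ v, 0 ≤ f v)
    (hh : Continuous h) (hh0 : ∀ v, 0 ≤ h v) :
    ∫⁻ v, ∫⁻ w, ENNReal.ofReal (f v * heatKernel τ (v - w) * h w)
      ≤ ENNReal.ofReal (smoothingConst d x y τ) * ((∫⁻ v, ENNReal.ofReal (f v ^ x⁻¹)) ^ x
        * (∫⁻ w, ENNReal.ofReal (h w ^ (1 - y)⁻¹)) ^ (1 - y)) := by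
  have hk : 0 < x - y := by linarith
  have hx0 : 0 < x := hy.trans hyx
  have hx1 : 0 < 1 - x := by linarith
  have hy1 : 0 < 1 - y := by linarith
  set α := τ * (x * (1 - x)) / (x - y) with hα
  set β := τ * ((1 - y) * y) / (x - y) with hβ
  have hα0 : 0 < α := by positivity
  have hβ0 : 0 < β := by positivity
  have pα := fun v => Real.rpow_pos_of_pos (heatKernel_pos (d := d) hα0 v) x
  have pβ := fun v => Real.rpow_pos_of_pos (heatKernel_pos (d := d) hβ0 v) (1 - y)
  have cα : Continuous fun v : E => heatKernel α v ^ x :=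
    (continuous_heatKernel α).rpow_const fun _ => Or.inr hx0.le
  have cβ : Continuous fun v : E => heatKernel β v ^ (1 - y) :=
    (continuous_heatKernel β).rpow_const fun _ => Or.inr hy1.le
  -- truncations of `f` and `h` by multiples of the Gaussian marginals
  set F : ℕ → E → ℝ := fun n v => min (f v) (n * heatKernel α v ^ x) with hF
  set H : ℕ → E → ℝ := fun n v => min (h v) (n * heatKernel β v ^ (1 - y)) with hH
  have cF : ∀ n, Continuous (F n) := fun n => hf.min (continuous_const.mul cα)
  have cH : ∀ n, Continuous (H n) := fun n => hh.min (continuous_const.mul cβ)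
  have F0 : ∀ n v, 0 ≤ F n v := fun n v => le_min (hf0 v) (by have := pα v; positivity)
  have H0 : ∀ n v, 0 ≤ H n v := fun n v => le_min (hh0 v) (by have := pβ v; positivity)
  have cG : Continuous fun z : E × E => heatKernel τ (z.1 - z.2) :=
    (continuous_heatKernel τ).comp (by fun_prop)
  have prodEq : ∀ f h : E → ℝ, Continuous f → Continuous h →
      ∫⁻ v, ∫⁻ w, ENNReal.ofReal (f v * heatKernel τ (v - w) * h w)
        = ∫⁻ z : E × E, ENNReal.ofReal (f z.1 * heatKernel τ (z.1 - z.2) * h z.2) := by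
    intro f h hf hh
    exact (lintegral_prod (fun z : E × E => ENNReal.ofReal (f z.1 * heatKernel τ (z.1 - z.2) * h z.2))
      (((hf.comp continuous_fst).mul cG).mul
        (hh.comp continuous_snd)).measurable.ennreal_ofReal.aemeasurable).symm
  have bd : ∀ n, ∫⁻ z : E × E, ENNReal.ofReal (F n z.1 * heatKernel τ (z.1 - z.2) * H n z.2)
      ≤ ENNReal.ofReal (smoothingConst d x y τ) * ((∫⁻ v, ENNReal.ofReal (f v ^ x⁻¹)) ^ x
        * (∫⁻ w, ENNReal.ofReal (h w ^ (1 - y)⁻¹)) ^ (1 - y)) := by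
    intro n
    rw [← prodEq _ _ (cF n) (cH n)]
    refine (lintegral_lintegral_heatKernel_le_of_le hy hyx hx hτ (B := n) (cF n) (F0 n)
      (fun v => min_le_right _ _) (cH n) (H0 n) (fun v => min_le_right _ _)).trans ?_
    gcongr with v v
    · exact F0 n v
    · exact min_le_left _ _
    · exact H0 n v
    · exact min_le_left _ _
  rw [prodEq _ _ hf hh]
  refine le_of_tendsto' (lintegral_tendsto_of_tendsto_of_monotone
    (f := fun n (z : E × E) => ENNReal.ofReal (F n z.1 * heatKernel τ (z.1 - z.2) * H n z.2))
    (fun n => ?_) (.of_forall fun z => ?_) (.of_forall fun z => ?_)) bd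
  · exact ((((cF n).comp continuous_fst).mul cG).mul
        ((cH n).comp continuous_snd)).measurable.ennreal_ofReal.aemeasurable
  · intro m n hmn
    have a1 := min_mul_mono (c := f z.1) (pα z.1) hmn
    have a2 := min_mul_mono (c := h z.2) (pβ z.2) hmn
    have a3 := heatKernel_nonneg hτ (z.1 - z.2)
    exact ENNReal.ofReal_le_ofReal (mul_le_mul (mul_le_mul_of_nonneg_right a1 a3) a2 (H0 m _)
      (mul_nonneg (F0 n _) a3))
  · exact ENNReal.tendsto_ofReal (((min_mul_tendsto (pα z.1)).mul_const _).mul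
      (min_mul_tendsto (pβ z.2)))

/-- The sharp smoothing estimate for nonnegative functions, by duality from the bilinear one: the
heat flow is tested against truncations of its own power `1/y - 1`. -/
lemma lintegral_heatFlow_rpow_le (hy : 0 < y) (hyx : y < x) (hx : x < 1)
    (hτ : 0 < τ) {f : E → ℝ} {B : ℝ} (hf : Continuous f) (hf0 : ∀ v, 0 ≤ f v)
    (hfB : ∀ v, f v ≤ B) :
    (∫⁻ v, ENNReal.ofReal (heatFlow τ f v ^ y⁻¹)) ^ y
      ≤ ENNReal.ofReal (smoothingConst d x y τ) * (∫⁻ v, ENNReal.ofReal (f v ^ x⁻¹)) ^ x := by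
  have hk : 0 < x - y := by linarith
  have hx0 : 0 < x := hy.trans hyx
  have hx1 : 0 < 1 - x := by linarith
  have hy1 : 0 < 1 - y := by linarith
  have hab : ∀ v, |f v| ≤ B := fun v => by rw [abs_of_nonneg (hf0 v)]; exact hfB v
  set u : E → ℝ := heatFlow τ f with hu
  have cu : Continuous u := continuous_heatFlow hτ hf hab
  have u0 : ∀ v, 0 ≤ u v := fun v =>
    integral_nonneg fun y => mul_nonneg (heatKernel_nonneg hτ _) (hf0 y)
  have uB : ∀ v, u v ≤ B := fun v => (le_abs_self _).trans (abs_heatFlow_le hτ hab v)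
  have hB0 : 0 ≤ B := (hf0 0).trans (hfB 0)
  have hyi : 1 < y⁻¹ := (one_lt_inv₀ hy).2 (by linarith)
  -- the truncation makes the pairing with `u` finite, so that it can be divided out
  set H : ℕ → E → ℝ := fun n v => min (u v ^ (y⁻¹ - 1)) (n * heatKernel 1 v) with hH
  have cU : Continuous fun v => u v ^ (y⁻¹ - 1) := cu.rpow_const fun _ => Or.inr (by linarith)
  have cH : ∀ n, Continuous (H n) := fun n => cU.min (continuous_const.mul (continuous_heatKernel 1))
  have p1 := heatKernel_pos (d := d) one_pos
  have H0 : ∀ n v, 0 ≤ H n v := fun n v =>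
    le_min (Real.rpow_nonneg (u0 v) _) (by have := p1 v; positivity)
  set R := ENNReal.ofReal (smoothingConst d x y τ) * (∫⁻ v, ENNReal.ofReal (f v ^ x⁻¹)) ^ x with hR
  have step : ∀ n, (∫⁻ v, ENNReal.ofReal (H n v * u v)) ≤ R ^ y⁻¹ := by
    intro n
    set I := ∫⁻ v, ENNReal.ofReal (H n v * u v) with hI
    have hfin : I ≠ ⊤ := by
      refine ne_of_lt (lt_of_le_of_lt (b := ∫⁻ v : E, ENNReal.ofReal (n * B * heatKernel 1 v)) ?_ ?_)
      · refine lintegral_mono fun v => ENNReal.ofReal_le_ofReal ?_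
        calc H n v * u v ≤ (n * heatKernel 1 v) * B :=
              mul_le_mul (min_le_right _ _) (uB v) (u0 v) (by have := p1 v; positivity)
          _ = _ := by ring
      · exact Integrable.lintegral_lt_top ((integrable_heatKernel one_pos).const_mul _)
    have b1 : I ≤ R * I ^ (1 - y) := by
      have b2 := lintegral_lintegral_heatKernel_le hy hyx hx hτ hf hf0 (cH n) (H0 n)
      rw [lintegral_lintegral_swap] at b2
      · calc I = ∫⁻ w, ∫⁻ v, ENNReal.ofReal (f v * heatKernel τ (v - w) * H n w) := by
              refine lintegral_congr fun w => ?_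
              rw [hu, heatFlow, ← integral_const_mul, ofReal_integral_eq_lintegral_ofReal
                ((integrable_heatKernel_sub_mul hτ hf hab _).const_mul _)
                (.of_forall fun v => mul_nonneg (H0 n w)
                  (mul_nonneg (heatKernel_nonneg hτ _) (hf0 v)))]
              refine lintegral_congr fun v => ?_
              rw [← heatKernel_neg τ (w - v), neg_sub]
              congr 1; ring
          _ ≤ _ := b2
          _ ≤ R * I ^ (1 - y) := by
              rw [hR, mul_assoc]
              refine mul_le_mul_right (mul_le_mul_right (ENNReal.rpow_le_rpow (lintegral_mono fun w =>
                ENNReal.ofReal_le_ofReal ?_) hy1.le) _) _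
              have : H n w ^ (1 - y)⁻¹ = H n w * H n w ^ ((1 - y)⁻¹ - 1) := by
                rcases (H0 n w).eq_or_lt with h | h
                · rw [← h, Real.zero_rpow (by positivity), zero_mul]
                · rw [← Real.rpow_one_add' h.le (by rw [add_sub_cancel]; positivity), add_sub_cancel]
              rw [this]
              refine mul_le_mul_of_nonneg_left ?_ (H0 n w)
              have h1 : 0 ≤ (1 - y)⁻¹ - 1 := by
                rw [sub_nonneg]; exact (one_le_inv₀ hy1).2 (by linarith)
              calc H n w ^ ((1 - y)⁻¹ - 1) ≤ (u w ^ (y⁻¹ - 1)) ^ ((1 - y)⁻¹ - 1) :=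
                    Real.rpow_le_rpow (H0 n w) (min_le_left _ _) h1
                _ = u w := by
                    rw [← Real.rpow_mul (u0 w), show (y⁻¹ - 1) * ((1 - y)⁻¹ - 1) = 1 by
                      field_simp; ring, Real.rpow_one]
      · have cG : Continuous fun z : E × E => heatKernel τ (z.1 - z.2) :=
          (continuous_heatKernel τ).comp (by fun_prop)
        exact (((hf.comp continuous_fst).mul cG).mul
          ((cH n).comp continuous_snd)).measurable.ennreal_ofReal.aemeasurable
    rcases eq_or_ne I 0 with h0 | h0
    · rw [h0]; exact zero_le
    · have : I ^ y ≤ R := by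
        have e : I = I ^ y * I ^ (1 - y) := by
          rw [← ENNReal.rpow_add _ _ h0 hfin, add_sub_cancel, ENNReal.rpow_one]
        have hne : I ^ (1 - y) ≠ 0 := by
          simp [ENNReal.rpow_eq_zero_iff, h0, hfin]
        have hnt : I ^ (1 - y) ≠ ⊤ := ENNReal.rpow_ne_top_of_nonneg hy1.le hfin
        exact (ENNReal.mul_le_mul_iff_left hne hnt).1 (e.symm.le.trans b1)
      calc I = (I ^ y) ^ y⁻¹ := by rw [ENNReal.rpow_rpow_inv hy.ne']
        _ ≤ _ := by gcongr
  have lim : Tendsto (fun n => ∫⁻ v, ENNReal.ofReal (H n v * u v)) atTop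
      (𝓝 (∫⁻ v, ENNReal.ofReal (u v ^ y⁻¹))) := by
    have e : ∀ v, u v ^ y⁻¹ = u v ^ (y⁻¹ - 1) * u v := fun v => by
      rw [← Real.rpow_add_one' (u0 v) (by rw [sub_add_cancel]; positivity), sub_add_cancel]
    simp_rw [e]
    refine lintegral_tendsto_of_tendsto_of_monotone
      (fun n => ((cH n).mul cu).measurable.ennreal_ofReal.aemeasurable)
      (.of_forall fun v => fun m n hmn => ENNReal.ofReal_le_ofReal
        (mul_le_mul_of_nonneg_right (min_mul_mono (p1 v) hmn) (u0 v)))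
      (.of_forall fun v => ENNReal.tendsto_ofReal ((min_mul_tendsto (p1 v)).mul_const _))
  calc (∫⁻ v, ENNReal.ofReal (u v ^ y⁻¹)) ^ y ≤ (R ^ y⁻¹) ^ y := by
        gcongr; exact le_of_tendsto' lim step
    _ = R := ENNReal.rpow_inv_rpow hy.ne' _

lemma eLpNorm_ofReal_inv {z : ℝ} (hz : 0 < z) (k : E → ℝ) :
    eLpNorm k (ENNReal.ofReal z⁻¹) volume = (∫⁻ v, ENNReal.ofReal (|k v| ^ z⁻¹)) ^ z := by
  have hz' : 0 < z⁻¹ := inv_pos.2 hz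
  rw [eLpNorm_eq_lintegral_rpow_enorm_toReal (by simpa using hz) ENNReal.ofReal_ne_top,
    ENNReal.toReal_ofReal hz'.le, one_div, inv_inv]
  congr 1
  refine lintegral_congr fun v => ?_
  rw [← ENNReal.ofReal_rpow_of_nonneg (abs_nonneg _) hz'.le, Real.enorm_eq_ofReal_abs]

/-- The sharp `L^a → L^b` smoothing estimate for the heat flow, with `x = 1 / a`, `y = 1 / b`. -/
theorem eLpNorm_heatFlow_le (hy : 0 < y) (hyx : y < x) (hx : x < 1)
    (hτ : 0 < τ) {f : E → ℝ} {B : ℝ} (hf : Continuous f) (hfB : ∀ v, |f v| ≤ B) :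
    eLpNorm (heatFlow τ f) (ENNReal.ofReal y⁻¹) volume
      ≤ ENNReal.ofReal (smoothingConst d x y τ) * eLpNorm f (ENNReal.ofReal x⁻¹) volume := by
  have hx0 : 0 < x := hy.trans hyx
  rw [eLpNorm_ofReal_inv hy, eLpNorm_ofReal_inv hx0]
  refine le_trans ?_ (lintegral_heatFlow_rpow_le hy hyx hx hτ hf.abs (fun v => abs_nonneg _) hfB)
  gcongr with v
  refine (abs_integral_le_integral_abs).trans (le_of_eq ?_)
  refine integral_congr_ae (.of_forall fun w => ?_)
  simp only [abs_mul, abs_of_nonneg (heatKernel_nonneg hτ _)]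

end Sharp

/-! ### Convolution with singular kernels -/

lemma integrable_indicator_norm_rpow {a : ℝ} (ha : 0 ≤ a) (had : a < d) :
    Integrable ((Metric.ball (0 : E) 1).indicator fun z => ‖z‖ ^ (-a)) := by
  have hd : 1 ≤ d := by
    have : (0 : ℝ) < d := ha.trans_lt had
    exact_mod_cast this
  rw [integrable_indicator_iff Metric.isOpen_ball.measurableSet]
  have hn : Nontrivial E := Module.nontrivial_of_finrank_pos (R := ℝ) (by simp; omega)
  refine integrableOn_ball_of_norm_le_rpow (C := 1) (α := a) (by simpa using hd)
    (by simpa using had) ?_ (Measurable.pow_const measurable_norm _).aestronglyMeasurable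
  · refine .of_forall fun z => ?_
    rw [Real.norm_of_nonneg (by positivity), one_mul]

/-- The integral of `|z|^{-a}` over the unit ball. -/
def ballMoment (d : ℕ) (a : ℝ) : ℝ :=
  ∫ z : EuclideanSpace ℝ (Fin d), (Metric.ball 0 1).indicator (fun z => ‖z‖ ^ (-a)) z

lemma ballMoment_nonneg (d : ℕ) (a : ℝ) : 0 ≤ ballMoment d a :=
  integral_nonneg fun z => indicator_nonneg (fun z _ => by positivity) z

lemma aestronglyMeasurable_comp_sub {G : Type*} [NormedAddCommGroup G] {k : E → G} (hk : AEStronglyMeasurable k)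
    (x : E) : AEStronglyMeasurable (fun y => k (x - y)) :=
  hk.comp_measurePreserving (Measure.measurePreserving_sub_left volume x)

section Convolution

variable {G : Type*} [NormedAddCommGroup G] [NormedSpace ℝ G]

lemma ae_ne_sub (hd : 0 < d) (x : E) : ∀ᵐ y : E, x - y ≠ 0 := by
  have hn : Nontrivial E := Module.nontrivial_of_finrank_pos (R := ℝ) (by simpa using hd)
  have : ∀ᵐ y : E, y ≠ x := by
    rw [ae_iff]
    simp
  filter_upwards [this] with y hy
  exact sub_ne_zero.2 (Ne.symm hy)

/-- The convolution of a bounded integrable function with a kernel of size `|z|^{-a}`, `a < d`: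
the part of the kernel in the ball of radius `r` is estimated through the bound of the function,
the rest through its integral. -/
lemma singular_convolution {a δ B C r : ℝ} (ha : 0 ≤ a) (hδ : 0 ≤ δ) (had : a + δ < d) (hr : 0 < r)
    (hr1 : r ≤ 1) {f : E → ℝ} {k : E → G} (hf : Integrable f) (hfB : ∀ᵐ y, |f y| ≤ B) (hC : 0 ≤ C)
    (hk : AEStronglyMeasurable k) (hkC : ∀ z, z ≠ 0 → ‖k z‖ ≤ C * ‖z‖ ^ (-a)) (x : E) :
    Integrable (fun y => f y • k (x - y)) ∧
      ‖∫ y, f y • k (x - y)‖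
        ≤ C * (B * r ^ δ * ballMoment d (a + δ) + r ^ (-a) * ∫ y, |f y|) := by
  have hd : 0 < d := by
    have : (0 : ℝ) < d := by linarith
    exact_mod_cast this
  set w : E → ℝ := (Metric.ball (0 : E) 1).indicator fun z => ‖z‖ ^ (-(a + δ)) with hw
  have hwi : Integrable w := integrable_indicator_norm_rpow (by positivity) had
  have w0 : ∀ z, 0 ≤ w z := fun z => indicator_nonneg (fun z _ => by positivity) z
  have hpt : ∀ z : E, z ≠ 0 → ‖z‖ ^ (-a) ≤ r ^ δ * w z + r ^ (-a) := by
    intro z hz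
    have hz' := norm_pos_iff.2 hz
    rcases lt_or_ge ‖z‖ r with h | h
    · have : z ∈ Metric.ball (0 : E) 1 := by simpa using h.trans_le hr1
      rw [hw, indicator_of_mem this]
      have h1 : ‖z‖ ^ (-a) = ‖z‖ ^ δ * ‖z‖ ^ (-(a + δ)) := by
        rw [← Real.rpow_add hz']; congr 1; ring
      rw [h1]
      have h2 := Real.rpow_le_rpow hz'.le h.le hδ
      have h3 : 0 ≤ ‖z‖ ^ (-(a + δ)) := by positivity
      have h4 : 0 ≤ r ^ (-a) := by positivity
      nlinarith
    · have h2 := Real.rpow_le_rpow_of_nonpos hr h (by linarith : -a ≤ 0)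
      have := mul_nonneg (Real.rpow_nonneg hr.le δ) (w0 z)
      linarith
  have hwx : Integrable fun y => w (x - y) := hwi.comp_sub_left x
  have hdom : Integrable fun y => C * (B * r ^ δ * w (x - y) + r ^ (-a) * |f y|) :=
    ((hwx.const_mul _).add (hf.abs.const_mul _)).const_mul _
  have hle : ∀ᵐ y, ‖f y • k (x - y)‖ ≤ C * (B * r ^ δ * w (x - y) + r ^ (-a) * |f y|) := by
    filter_upwards [hfB, ae_ne_sub hd x] with y hy hxy
    rw [norm_smul, Real.norm_eq_abs]
    calc |f y| * ‖k (x - y)‖ ≤ |f y| * (C * (r ^ δ * w (x - y) + r ^ (-a))) :=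
          mul_le_mul_of_nonneg_left ((hkC _ hxy).trans
            (mul_le_mul_of_nonneg_left (hpt _ hxy) hC)) (abs_nonneg _)
      _ = C * (|f y| * (r ^ δ * w (x - y)) + r ^ (-a) * |f y|) := by ring
      _ ≤ _ := by
          refine mul_le_mul_of_nonneg_left ?_ hC
          have := mul_le_mul_of_nonneg_right hy
            (mul_nonneg (Real.rpow_nonneg hr.le δ) (w0 (x - y)))
          nlinarith
  refine ⟨hdom.mono' (hf.aestronglyMeasurable.smul (aestronglyMeasurable_comp_sub hk x)) hle, ?_⟩
  refine (norm_integral_le_of_norm_le hdom hle).trans (le_of_eq ?_)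
  rw [integral_const_mul, integral_add (hwx.const_mul _) (hf.abs.const_mul _), integral_const_mul,
    integral_const_mul, integral_sub_left_eq_self (fun z => w z)]
  rfl

/-- A singular differentiable kernel is approximated by kernels vanishing near the origin. -/
lemma exists_cutoff_kernel {b δ C : ℝ} (hb : 1 ≤ b) (hδ : 0 ≤ δ) (hC : 0 ≤ C)
    {k : E → G} {k' : E → E →L[ℝ] G} (hk : ∀ z, z ≠ 0 → HasFDerivAt k (k' z) z)
    (hkm : AEStronglyMeasurable k) (hk'm : AEStronglyMeasurable k')
    (hkC : ∀ z, z ≠ 0 → ‖k z‖ ≤ C * ‖z‖ ^ (-(b - 1)))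
    (hk'C : ∀ z, z ≠ 0 → ‖k' z‖ ≤ C * ‖z‖ ^ (-b)) :
    ∃ c, 0 ≤ c ∧ ∀ ε, 0 < ε → ∃ (l : E → G) (l' : E → E →L[ℝ] G) (D : ℝ),
      (∀ z, HasFDerivAt l (l' z) z) ∧ (∀ z, ‖l' z‖ ≤ D) ∧ AEStronglyMeasurable l' ∧
      (∀ z, z ≠ 0 → ‖l z - k z‖ ≤ c * ε ^ δ * ‖z‖ ^ (-(b - 1 + δ))) ∧
      (∀ z, z ≠ 0 → ‖l' z - k' z‖ ≤ c * ε ^ δ * ‖z‖ ^ (-(b + δ))) := by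
  let φ : ContDiffBump (0 : E) := ⟨1, 2, one_pos, one_lt_two⟩
  have φc : ContDiff ℝ 1 φ := φ.contDiff
  have φd : ∀ z, HasFDerivAt φ (fderiv ℝ φ z) z := fun z =>
    (φc.differentiable one_ne_zero z).hasFDerivAt
  have φ'c : Continuous (fderiv ℝ φ) := φc.continuous_fderiv one_ne_zero
  obtain ⟨c₁, hc₁⟩ := φ'c.bounded_above_of_compact_support (φ.hasCompactSupport.fderiv ℝ)
  have hc₁0 : 0 ≤ c₁ := (norm_nonneg _).trans (hc₁ 0)
  have φout : ∀ z : E, 2 < ‖z‖ → φ z = 0 ∧ fderiv ℝ φ z = 0 := by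
    intro z hz
    have h1 : (φ : E → ℝ) =ᶠ[𝓝 z] fun _ => 0 := by
      filter_upwards [(isOpen_lt continuous_const continuous_norm).mem_nhds hz] with y hy
      exact φ.zero_of_le_dist (by simpa using (le_of_lt hy : (2 : ℝ) ≤ ‖y‖))
    exact ⟨h1.self_of_nhds, by rw [h1.fderiv_eq]; simp⟩
  have φin : ∀ z : E, ‖z‖ < 1 → φ z = 1 ∧ fderiv ℝ φ z = 0 := by
    intro z hz
    have h1 : (φ : E → ℝ) =ᶠ[𝓝 z] fun _ => 1 := by
      filter_upwards [(isOpen_lt continuous_norm continuous_const).mem_nhds hz] with y hy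
      exact φ.one_of_mem_closedBall (by simpa using (le_of_lt hy : ‖y‖ ≤ 1))
    exact ⟨h1.self_of_nhds, by rw [h1.fderiv_eq]; simp⟩
  refine ⟨2 ^ δ * C * (1 + 2 * c₁), by positivity, fun ε hε => ?_⟩
  have hnε : ∀ z : E, ‖ε⁻¹ • z‖ = ε⁻¹ * ‖z‖ := fun z => by
    rw [norm_smul, Real.norm_of_nonneg (by positivity)]
  -- `l` agrees with `k` outside the ball of radius `2 ε` and vanishes in the ball of radius `ε`
  set l : E → G := fun z => (1 - φ (ε⁻¹ • z)) • k z with hl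
  set l' : E → E →L[ℝ] G := fun z => (1 - φ (ε⁻¹ • z)) • k' z
    - (ε⁻¹ • fderiv ℝ φ (ε⁻¹ • z)).smulRight (k z) with hl'
  have small : ∀ z : E, z ≠ 0 → ‖z‖ ≤ 2 * ε → ∀ a : ℝ,
      ‖z‖ ^ (-a) ≤ 2 ^ δ * ε ^ δ * ‖z‖ ^ (-(a + δ)) := by
    intro z hz hzε a
    have hz' := norm_pos_iff.2 hz
    have h1 : ‖z‖ ^ (-a) = ‖z‖ ^ δ * ‖z‖ ^ (-(a + δ)) := by
      rw [← Real.rpow_add hz']; congr 1; ring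
    rw [h1, ← Real.mul_rpow two_pos.le hε.le]
    exact mul_le_mul_of_nonneg_right (Real.rpow_le_rpow hz'.le hzε hδ) (by positivity)
  have far : ∀ z : E, 2 * ε < ‖z‖ → 2 < ‖ε⁻¹ • z‖ := fun z hz => by
    rw [hnε, inv_mul_eq_div, lt_div_iff₀ hε]; exact hz
  have e1 : ∀ z, z ≠ 0 → ‖l z - k z‖ ≤ 2 ^ δ * C * (1 + 2 * c₁) * ε ^ δ * ‖z‖ ^ (-(b - 1 + δ)) := by
    intro z hz
    have : l z - k z = - (φ (ε⁻¹ • z) • k z) := by rw [hl]; simp only [sub_smul, one_smul]; abel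
    rw [this, norm_neg, norm_smul, Real.norm_of_nonneg φ.nonneg]
    rcases le_or_gt ‖z‖ (2 * ε) with h | h
    · calc φ (ε⁻¹ • z) * ‖k z‖ ≤ 1 * (C * ‖z‖ ^ (-(b - 1))) :=
            mul_le_mul φ.le_one (hkC z hz) (norm_nonneg _) one_pos.le
        _ ≤ C * (2 ^ δ * ε ^ δ * ‖z‖ ^ (-(b - 1 + δ))) := by
            rw [one_mul]; exact mul_le_mul_of_nonneg_left (small z hz h _) hC
        _ ≤ (1 + 2 * c₁) * (C * (2 ^ δ * ε ^ δ * ‖z‖ ^ (-(b - 1 + δ)))) :=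
            le_mul_of_one_le_left (by positivity) (by linarith)
        _ = _ := by ring
    · rw [(φout _ (far z h)).1, zero_mul]; positivity
  have e2 : ∀ z, z ≠ 0 → ‖l' z - k' z‖ ≤ 2 ^ δ * C * (1 + 2 * c₁) * ε ^ δ * ‖z‖ ^ (-(b + δ)) := by
    intro z hz
    have hz' := norm_pos_iff.2 hz
    have : l' z - k' z = - (φ (ε⁻¹ • z) • k' z
        + (ε⁻¹ • fderiv ℝ φ (ε⁻¹ • z)).smulRight (k z)) := by
      rw [hl']; simp only [sub_smul, one_smul]; abel
    rw [this, norm_neg]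
    rcases le_or_gt ‖z‖ (2 * ε) with h | h
    · have h1 : ‖φ (ε⁻¹ • z) • k' z‖ ≤ C * ‖z‖ ^ (-b) := by
        rw [norm_smul, Real.norm_of_nonneg φ.nonneg]
        calc _ ≤ 1 * (C * ‖z‖ ^ (-b)) := mul_le_mul φ.le_one (hk'C z hz) (norm_nonneg _) one_pos.le
          _ = _ := one_mul _
      have h2 : ‖(ε⁻¹ • fderiv ℝ φ (ε⁻¹ • z)).smulRight (k z)‖ ≤ 2 * c₁ * (C * ‖z‖ ^ (-b)) := by
        rw [ContinuousLinearMap.norm_smulRight_apply, norm_smul, Real.norm_of_nonneg (by positivity)]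
        have h3 : ‖z‖ ^ (-(b - 1)) = ‖z‖ * ‖z‖ ^ (-b) := by
          rw [show -(b - 1) = 1 + -b by ring, Real.rpow_add hz', Real.rpow_one]
        have h4 : ε⁻¹ * ‖z‖ ≤ 2 := by rw [inv_mul_eq_div, div_le_iff₀ hε]; exact h
        calc ε⁻¹ * ‖fderiv ℝ φ (ε⁻¹ • z)‖ * ‖k z‖ ≤ ε⁻¹ * c₁ * (C * (‖z‖ * ‖z‖ ^ (-b))) := by
              gcongr
              · exact hc₁ _
              · rw [← h3]; exact hkC z hz
          _ = (ε⁻¹ * ‖z‖) * (c₁ * (C * ‖z‖ ^ (-b))) := by ring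
          _ ≤ 2 * (c₁ * (C * ‖z‖ ^ (-b))) := by gcongr
          _ = _ := by ring
      calc _ ≤ C * ‖z‖ ^ (-b) + 2 * c₁ * (C * ‖z‖ ^ (-b)) := (norm_add_le _ _).trans (add_le_add h1 h2)
        _ = (1 + 2 * c₁) * (C * ‖z‖ ^ (-b)) := by ring
        _ ≤ (1 + 2 * c₁) * (C * (2 ^ δ * ε ^ δ * ‖z‖ ^ (-(b + δ)))) := by
            gcongr; exact small z hz h _
        _ = _ := by ring
    · rw [(φout _ (far z h)).1, (φout _ (far z h)).2]
      have : (ε⁻¹ • (0 : E →L[ℝ] ℝ)).smulRight (k z) = 0 := by ext; simp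
      rw [zero_smul, this, add_zero, norm_zero]
      positivity
  have near : ∀ z : E, ‖z‖ < ε → ‖ε⁻¹ • z‖ < 1 := fun z hz => by
    rw [hnε, inv_mul_eq_div, div_lt_one hε]; exact hz
  have l'0 : ∀ z : E, ‖z‖ < ε → l' z = 0 := by
    intro z hz
    rw [hl']
    simp only [(φin _ (near z hz)).1, (φin _ (near z hz)).2, sub_self, zero_smul, smul_zero, zero_sub]
    ext; simp
  refine ⟨l, l', C * ε ^ (-b) + 2 ^ δ * C * (1 + 2 * c₁) * ε ^ δ * ε ^ (-(b + δ)), fun z => ?_,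
    fun z => ?_, ?_, e1, e2⟩
  · rcases eq_or_ne z 0 with rfl | hz
    · rw [l'0 0 (by simpa using hε)]
      refine (hasFDerivAt_const (0 : G) (0 : E)).congr_of_eventuallyEq ?_
      filter_upwards [Metric.ball_mem_nhds (0 : E) hε] with y hy
      rw [hl]
      simp only [(φin _ (near y (by simpa using hy))).1, sub_self, zero_smul]
    · have h1 : HasFDerivAt (fun z : E => φ (ε⁻¹ • z)) (ε⁻¹ • fderiv ℝ φ (ε⁻¹ • z)) z := by
        have h2 : HasFDerivAt (fun z : E => ε⁻¹ • z) (ε⁻¹ • ContinuousLinearMap.id ℝ E) z :=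
          (ε⁻¹ • ContinuousLinearMap.id ℝ E).hasFDerivAt
        refine ((φd (ε⁻¹ • z)).comp z h2).congr_fderiv ?_
        ext v; simp
      refine ((h1.const_sub 1).smul (hk z hz)).congr_fderiv ?_
      ext v
      simp [hl', sub_eq_add_neg]
  · rcases lt_or_ge ‖z‖ ε with h | h
    · rw [l'0 z h, norm_zero]; positivity
    · have hz : z ≠ 0 := norm_pos_iff.1 (hε.trans_le h)
      calc ‖l' z‖ = ‖k' z + (l' z - k' z)‖ := by rw [add_sub_cancel]
        _ ≤ _ := norm_add_le _ _
        _ ≤ _ := add_le_add (hk'C z hz) (e2 z hz)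
        _ ≤ _ := add_le_add
          (mul_le_mul_of_nonneg_left (Real.rpow_le_rpow_of_nonpos hε h (by linarith)) hC)
          (mul_le_mul_of_nonneg_left (Real.rpow_le_rpow_of_nonpos hε h (by linarith))
            (by positivity))
  · have m1 : Continuous fun z : E => 1 - φ (ε⁻¹ • z) := by
      have := φc.continuous; fun_prop
    have m2 : Continuous fun z : E => ε⁻¹ • fderiv ℝ φ (ε⁻¹ • z) := by fun_prop
    refine (m1.aestronglyMeasurable.smul hk'm).sub ?_
    exact isBoundedBilinearMap_smulRight.continuous.comp_aestronglyMeasurable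
      (m2.aestronglyMeasurable.prodMk hkm)

/-- Convolution with a kernel whose derivative has an integrable singularity is differentiable,
and the derivative falls on the kernel. -/
lemma hasFDerivAt_singular_convolution {b B C : ℝ} (hb : 1 ≤ b) (hbd : b < d) (hC : 0 ≤ C)
    {k : E → G} {k' : E → E →L[ℝ] G} (hk : ∀ z, z ≠ 0 → HasFDerivAt k (k' z) z)
    (hkm : AEStronglyMeasurable k) (hk'm : AEStronglyMeasurable k')
    (hkC : ∀ z, z ≠ 0 → ‖k z‖ ≤ C * ‖z‖ ^ (-(b - 1)))
    (hk'C : ∀ z, z ≠ 0 → ‖k' z‖ ≤ C * ‖z‖ ^ (-b))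
    {f : E → ℝ} (hf : Integrable f) (hfB : ∀ᵐ y, |f y| ≤ B) (x : E) :
    HasFDerivAt (fun x => ∫ y, f y • k (x - y)) (∫ y, f y • k' (x - y)) x := by
  -- a margin in the exponent turns the size of the cut-off into a rate of convergence
  set δ := (d - b) / 2 with hδ
  have hδ0 : 0 < δ := by rw [hδ]; linarith
  have hbδ : b + δ < d := by rw [hδ]; linarith
  obtain ⟨c, hc, H⟩ := exists_cutoff_kernel hb hδ0.le hC hk hkm hk'm hkC hk'C
  set ε : ℕ → ℝ := fun n => 1 / ((n : ℝ) + 1) with hεdef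
  have hε : ∀ n, 0 < ε n := fun n => by positivity
  have hε0 : Tendsto ε atTop (𝓝 0) := tendsto_one_div_add_atTop_nhds_zero_nat
  choose l l' D hl hl'D hl'm hlk hl'k using fun n => H (ε n) (hε n)
  have lc : ∀ n, Continuous (l n) := fun n =>
    continuous_iff_continuousAt.2 fun z => (hl n z).continuousAt
  have s0 := fun x => singular_convolution (r := 1) (by linarith : 0 ≤ b - 1) le_rfl
    (by linarith) one_pos le_rfl hf hfB hC hkm hkC x
  have s1 := fun x => singular_convolution (r := 1) (by linarith : 0 ≤ b) le_rfl
    (by linarith) one_pos le_rfl hf hfB hC hk'm hk'C x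
  have d0 := fun n x => singular_convolution (k := fun z => l n z - k z) (r := 1)
    (by linarith : 0 ≤ b - 1 + δ) le_rfl (by linarith) one_pos le_rfl hf hfB
    (mul_nonneg hc (Real.rpow_nonneg (hε n).le δ)) ((lc n).aestronglyMeasurable.sub hkm) (hlk n) x
  have d1 := fun n x => singular_convolution (k := fun z => l' n z - k' z) (r := 1)
    (by linarith : 0 ≤ b + δ) le_rfl (by linarith) one_pos le_rfl hf hfB
    (mul_nonneg hc (Real.rpow_nonneg (hε n).le δ)) ((hl'm n).sub hk'm) (hl'k n) x
  simp only [Real.one_rpow, mul_one, one_mul, add_zero] at d0 d1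
  have i0 : ∀ n x, Integrable fun y => f y • l n (x - y) := fun n x => by
    refine ((d0 n x).1.add (s0 x).1).congr (.of_forall fun y => ?_)
    simp [← smul_add]
  have i1 : ∀ n x, Integrable fun y => f y • l' n (x - y) := fun n x => by
    refine ((d1 n x).1.add (s1 x).1).congr (.of_forall fun y => ?_)
    simp [← smul_add]
  have diff : ∀ n x, HasFDerivAt (fun x => ∫ y, f y • l n (x - y)) (∫ y, f y • l' n (x - y)) x := by
    intro n x
    refine hasFDerivAt_integral_of_dominated_of_fderiv_le (F := fun x y => f y • l n (x - y))
      (F' := fun x y => f y • l' n (x - y)) (bound := fun y => |f y| * D n) univ_mem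
      (.of_forall fun x => (i0 n x).aestronglyMeasurable) (i0 n x) (i1 n x).aestronglyMeasurable
      (.of_forall fun y x _ => ?_) (hf.abs.mul_const _) (.of_forall fun y x _ => ?_)
    · rw [norm_smul, Real.norm_eq_abs]
      exact mul_le_mul_of_nonneg_left (hl'D n _) (abs_nonneg _)
    · exact ((hl n (x - y)).comp x ((hasFDerivAt_id x).sub_const y)).const_smul (f y)
  have tc : ∀ a : ℝ, Tendsto (fun n => c * ε n ^ δ * a) atTop (𝓝 0) := fun a => by
    have := ((hε0.rpow_const (Or.inr hδ0.le : (0 : ℝ) ≠ 0 ∨ 0 ≤ δ)).const_mul c).mul_const a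
    simpa [Real.zero_rpow hδ0.ne'] using this
  refine hasFDerivAt_of_tendstoUniformly (f := fun n x => ∫ y, f y • l n (x - y))
    (f' := fun n x => ∫ y, f y • l' n (x - y)) (g := fun x => ∫ y, f y • k (x - y))
    (g' := fun x => ∫ y, f y • k' (x - y)) (l := atTop) ?_ diff (fun x => ?_) x
  · rw [Metric.tendstoUniformly_iff]
    intro η hη
    filter_upwards [(tc _).eventually_lt_const hη] with n hn x
    refine lt_of_le_of_lt ?_ hn
    rw [dist_comm, dist_eq_norm, ← integral_sub (i1 n x) (s1 x).1]
    simp_rw [← smul_sub]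
    exact (d1 n x).2
  · rw [tendsto_iff_norm_sub_tendsto_zero]
    refine squeeze_zero (fun n => norm_nonneg _) (fun n => ?_)
      (tc (B * ballMoment d (b - 1 + δ) + ∫ y, |f y|))
    rw [← integral_sub (i0 n x) (s0 x).1]
    simp_rw [← smul_sub]
    exact (d0 n x).2

end Convolution

/-! ### The velocity field -/

lemma aestronglyMeasurable_of_continuousOn_compl {G : Type*} [NormedAddCommGroup G] (hd : 0 < d)
    {k : E → G} (hk : ContinuousOn k {0}ᶜ) : AEStronglyMeasurable k := by
  have h := hk.aestronglyMeasurable (μ := volume) (measurableSet_singleton (0 : E)).compl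
  rwa [Measure.restrict_eq_self_of_ae_mem] at h
  filter_upwards [ae_ne_sub hd 0] with y hy
  simpa using hy

/-- The linear map turning the differential of `g` into `M ∇ g`. -/
def dualMap (M : Matrix (Fin d) (Fin d) ℝ) : (E →L[ℝ] ℝ) →L[ℝ] E :=
  LinearMap.toContinuousLinearMap
    { toFun := fun l => Matrix.toEuclideanLin M ((InnerProductSpace.toDual ℝ E).symm l)
      map_add' := fun l l' => by rw [map_add, map_add]
      map_smul' := fun c l => by rw [map_smulₛₗ, map_smulₛₗ]; simp }

lemma dualMap_apply (M : Matrix (Fin d) (Fin d) ℝ) (l : E →L[ℝ] ℝ) :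
    dualMap M l = Matrix.toEuclideanLin M ((InnerProductSpace.toDual ℝ E).symm l) := rfl

/-- The trace of an operator, in the standard basis. -/
def trace (A : E →L[ℝ] E) : ℝ := ∑ i, A (EuclideanSpace.single i 1) i

lemma trace_dualMap (M : Matrix (Fin d) (Fin d) ℝ) (g : E → ℝ) (z : E) :
    trace (dualMap M ∘L fderiv ℝ (fderiv ℝ g) z) = frobeniusHessian M g z := by
  unfold trace frobeniusHessian
  refine Finset.sum_congr rfl fun i _ => ?_
  simp only [ContinuousLinearMap.comp_apply, iteratedFDeriv_two_apply, dualMap_apply,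
    Matrix.toEuclideanLin_apply, Matrix.mulVec, dotProduct]
  refine Finset.sum_congr rfl fun j _ => ?_
  congr 1
  have := InnerProductSpace.toDual_symm_apply (𝕜 := ℝ) (x := EuclideanSpace.single j (1 : ℝ))
    (y := fderiv ℝ (fderiv ℝ g) z (EuclideanSpace.single i 1))
  rw [real_inner_comm, EuclideanSpace.inner_single_left] at this
  simpa using this

section Kernel

variable {s : ℝ} {g : EuclideanSpace ℝ (Fin d) → ℝ} {M : Matrix (Fin d) (Fin d) ℝ}

lemma IsRieszType.hasFDerivAt_fderiv (hg : IsRieszType s g) {z : E} (hz : z ≠ 0) :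
    HasFDerivAt (fderiv ℝ g) (fderiv ℝ (fderiv ℝ g) z) z := by
  have h1 : ContDiffAt ℝ ∞ g z := hg.contDiffOn.contDiffAt (isOpen_compl_singleton.mem_nhds hz)
  have h2 : ContDiffAt ℝ 1 (fderiv ℝ g) z := h1.fderiv_right (by norm_cast)
  exact (h2.differentiableAt one_ne_zero).hasFDerivAt

lemma IsRieszType.continuousOn_fderiv_fderiv (hg : IsRieszType s g) :
    ContinuousOn (fderiv ℝ (fderiv ℝ g)) {0}ᶜ := fun z hz => by
  have h1 : ContDiffAt ℝ ∞ g z := hg.contDiffOn.contDiffAt (isOpen_compl_singleton.mem_nhds hz)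
  have h2 : ContDiffAt ℝ 1 (fderiv ℝ g) z := h1.fderiv_right (by norm_cast)
  exact (h2.fderiv_right (m := 0) (by norm_num)).continuousAt.continuousWithinAt

/-- The kernel `M ∇ g` and its derivative have the singularities `|z|^{-(s+1)}` and
`|z|^{-(s+2)}`. The logarithm in the growth condition only concerns `g` itself. -/
lemma IsRieszType.exists_bound (hg : IsRieszType s g) :
    ∃ C, 0 ≤ C ∧ ∀ z : E, z ≠ 0 → ‖dualMap M (fderiv ℝ g z)‖ ≤ C * ‖z‖ ^ (-(s + 2 - 1)) ∧
      ‖dualMap M ∘L fderiv ℝ (fderiv ℝ g) z‖ ≤ C * ‖z‖ ^ (-(s + 2)) := by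
  obtain ⟨C₁, h₁⟩ := hg.bound 1
  obtain ⟨C₂, h₂⟩ := hg.bound 2
  refine ⟨‖(dualMap M : (E →L[ℝ] ℝ) →L[ℝ] E)‖ * max |C₁| |C₂|, by positivity, fun z hz => ?_⟩
  have hz' := norm_pos_iff.2 hz
  have e : ∀ (C a : ℝ), |C| ≤ max |C₁| |C₂| →
      C * (1 / ‖z‖ ^ a + 0) ≤ max |C₁| |C₂| * ‖z‖ ^ (-a) := by
    intro C a hC
    rw [add_zero, one_div, Real.rpow_neg hz'.le]
    exact mul_le_mul_of_nonneg_right ((le_abs_self C).trans hC) (by positivity)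
  constructor
  · have := h₁ z hz
    rw [norm_iteratedFDeriv_one] at this
    simp only [one_ne_zero, and_false, if_false] at this
    refine ((dualMap M).le_opNorm _).trans ?_
    rw [mul_assoc]
    refine mul_le_mul_of_nonneg_left (this.trans ?_) (norm_nonneg _)
    rw [show s + 2 - 1 = s + ((1 : ℕ) : ℝ) by push_cast; ring]
    exact e _ _ (le_max_left _ _)
  · have := h₂ z hz
    rw [← norm_iteratedFDeriv_fderiv, norm_iteratedFDeriv_one] at this
    simp only [OfNat.ofNat_ne_zero, and_false, if_false] at this
    refine (ContinuousLinearMap.opNorm_comp_le _ _).trans ?_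
    rw [mul_assoc]
    refine mul_le_mul_of_nonneg_left (this.trans ?_) (norm_nonneg _)
    exact e _ _ (le_max_right _ _)

/-- The regularity of the velocity field of a bounded integrable function. In the first bound the
radius `r` balances the sup norm against the mass, so that the velocity is small when the mass is
small and the sup norm is bounded. -/
lemma IsRieszType.velocity_regular (hg : IsRieszType s g) (hs : 0 ≤ s) (hsd : s < d - 2) :
    ∃ C δ : ℝ, 0 ≤ C ∧ 0 < δ ∧ (∀ (f : E → ℝ) (A B r : ℝ), Integrable f → (∀ᵐ y, |f y| ≤ B) →
        (∫ y, |f y|) ≤ A → 0 < r → r ≤ 1 → ∀ x,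
        Integrable (fun y => f y • Matrix.toEuclideanLin M (gradient g (x - y))) ∧
        ‖velocity M g f x‖ ≤ C * (B * r ^ δ + r ^ (-(s + 1)) * A)) ∧
      (∀ (f : E → ℝ) (A B : ℝ), Integrable f → (∀ᵐ y, |f y| ≤ B) → (∫ y, |f y|) ≤ A → ∀ x,
        ∃ D : E →L[ℝ] E, HasFDerivAt (velocity M g f) D x ∧ ‖D‖ ≤ C * (B + A) ∧
          trace D = ∫ y, f y * frobeniusHessian M g (x - y)) := by
  have hd : 0 < d := by
    have : (0 : ℝ) < d := by linarith
    exact_mod_cast this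
  obtain ⟨C, hC, hb⟩ := hg.exists_bound (M := M)
  have hk : ∀ z : E, z ≠ 0 → HasFDerivAt (fun z => dualMap M (fderiv ℝ g z))
      (dualMap M ∘L fderiv ℝ (fderiv ℝ g) z) z := fun z hz =>
    (dualMap M).hasFDerivAt.comp z (hg.hasFDerivAt_fderiv hz)
  have hkm : AEStronglyMeasurable (fun z : E => dualMap M (fderiv ℝ g z)) :=
    aestronglyMeasurable_of_continuousOn_compl hd fun z hz => (hk z hz).continuousAt.continuousWithinAt
  have hk'm : AEStronglyMeasurable (fun z : E => dualMap M ∘L fderiv ℝ (fderiv ℝ g) z) :=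
    aestronglyMeasurable_of_continuousOn_compl hd
      (continuousOn_const.clm_comp hg.continuousOn_fderiv_fderiv)
  set δ := (d - (s + 2)) / 2 with hδ
  have hδ0 : 0 < δ := by rw [hδ]; linarith
  have hbδ : s + 2 + δ < d := by rw [hδ]; linarith
  set b₁ := ballMoment d (s + 2 - 1 + δ) with hb₁
  set b₂ := ballMoment d (s + 2) with hb₂
  have b₁0 : 0 ≤ b₁ := ballMoment_nonneg _ _
  have b₂0 : 0 ≤ b₂ := ballMoment_nonneg _ _
  refine ⟨C * (b₁ + b₂ + 1), δ, by positivity, hδ0, ?_, ?_⟩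
  · intro f A B r hf hfB hA hr hr1 x
    have h := singular_convolution (a := s + 2 - 1) (by linarith) hδ0.le (by linarith) hr hr1
      hf hfB hC hkm (fun z hz => (hb z hz).1) x
    have hB0 : 0 ≤ B := by
      obtain ⟨y, hy⟩ := hfB.exists
      exact (abs_nonneg _).trans hy
    have hA0 : 0 ≤ A := le_trans (integral_nonneg fun y => abs_nonneg _) hA
    refine ⟨h.1, h.2.trans ?_⟩
    rw [show -(s + 2 - 1) = -(s + 1) by ring, mul_assoc C]
    refine mul_le_mul_of_nonneg_left ?_ hC
    rw [← hb₁]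
    have p1 : 0 ≤ r ^ (-(s + 1)) := by positivity
    have p2 : 0 ≤ r ^ δ := by positivity
    have p3 := mul_le_mul_of_nonneg_left hA p1
    have p4 : 0 ≤ B * r ^ δ := by positivity
    have p5 : 0 ≤ r ^ (-(s + 1)) * A := by positivity
    nlinarith [mul_nonneg p4 b₂0, mul_nonneg p5 b₁0, mul_nonneg p5 b₂0]
  · intro f A B hf hfB hA x
    have hB0 : 0 ≤ B := by
      obtain ⟨y, hy⟩ := hfB.exists
      exact (abs_nonneg _).trans hy
    have hA0 : 0 ≤ A := le_trans (integral_nonneg fun y => abs_nonneg _) hA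
    have h := singular_convolution (a := s + 2) (r := 1) (by linarith) le_rfl (by linarith)
      one_pos le_rfl hf hfB hC hk'm (fun z hz => (hb z hz).2) x
    refine ⟨_, hasFDerivAt_singular_convolution (b := s + 2) (by linarith) (by linarith) hC hk hkm
      hk'm (fun z hz => (hb z hz).1) (fun z hz => (hb z hz).2) hf hfB x, h.2.trans ?_, ?_⟩
    · simp only [Real.one_rpow, mul_one, one_mul, add_zero]
      rw [mul_assoc C]
      refine mul_le_mul_of_nonneg_left ?_ hC
      rw [← hb₂]
      nlinarith [mul_nonneg hB0 b₁0, mul_nonneg hA0 b₁0, mul_nonneg hA0 b₂0]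
    · let trL : (E →L[ℝ] E) →L[ℝ] ℝ := ∑ i, (EuclideanSpace.proj i : E →L[ℝ] ℝ) ∘L
        ContinuousLinearMap.apply ℝ E (EuclideanSpace.single i (1 : ℝ))
      have htr : ∀ A : E →L[ℝ] E, trL A = trace A := fun A => by
        simp [trL, trace]
      rw [← htr, ← trL.integral_comp_comm h.1]
      refine integral_congr_ae (.of_forall fun y => ?_)
      simp only [map_smul, smul_eq_mul]
      rw [htr, trace_dualMap]

end Kernel

lemma eLpNorm_one_eq_ofReal_integral_norm {G : Type*} [NormedAddCommGroup G] {f : E → G} (hf : Integrable f) :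
    eLpNorm f 1 volume = ENNReal.ofReal (∫ x, ‖f x‖) := by
  rw [eLpNorm_one_eq_lintegral_enorm, ofReal_integral_norm_eq_lintegral_enorm hf]

section Solution

variable {s σ : ℝ} {g : EuclideanSpace ℝ (Fin d) → ℝ} {M : Matrix (Fin d) (Fin d) ℝ}
  {μ : ℝ → EuclideanSpace ℝ (Fin d) → ℝ}

lemma IsMildSolution.integrable (hμ : IsMildSolution M g σ μ) {t : ℝ} (ht : 0 ≤ t) :
    Integrable (μ t) := memLp_one_iff_integrable.1 (hμ.memLp_one t ht)

lemma IsMildSolution.tendsto_integral_abs_sub (hμ : IsMildSolution M g σ μ) {t : ℝ} (ht : 0 ≤ t) :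
    Tendsto (fun r => ∫ x, |μ r x - μ t x|) (𝓝[Ici 0] t) (𝓝 0) := by
  have h := (ENNReal.tendsto_toReal ENNReal.zero_ne_top).comp (hμ.continuous_one t ht)
  refine h.congr' ?_
  filter_upwards [self_mem_nhdsWithin] with r hr
  have hi : Integrable (μ r - μ t) := (hμ.integrable hr).sub (hμ.integrable ht)
  simp only [Function.comp_apply]
  rw [eLpNorm_one_eq_ofReal_integral_norm hi, ENNReal.toReal_ofReal (integral_nonneg fun x => norm_nonneg _)]
  rfl

lemma IsMildSolution.exists_bounds (hμ : IsMildSolution M g σ μ) (T : ℝ) :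
    ∃ A B, 0 ≤ A ∧ 0 ≤ B ∧ ∀ t ∈ Icc 0 T, (∫ x, |μ t x|) ≤ A ∧ ∀ᵐ x, |μ t x| ≤ B := by
  have hc : ContinuousOn (fun t => ∫ x, |μ t x|) (Icc 0 T) := by
    intro t ht
    refine ContinuousWithinAt.mono (t := Ici 0) ?_ fun r hr => hr.1
    rw [ContinuousWithinAt, tendsto_iff_dist_tendsto_zero]
    refine squeeze_zero' (.of_forall fun _ => dist_nonneg) ?_ (hμ.tendsto_integral_abs_sub ht.1)
    filter_upwards [self_mem_nhdsWithin] with r hr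
    rw [Real.dist_eq, ← integral_sub (hμ.integrable hr).abs (hμ.integrable ht.1).abs]
    refine abs_integral_le_integral_abs.trans ?_
    exact integral_mono_of_nonneg (.of_forall fun _ => abs_nonneg _)
      ((hμ.integrable hr).sub (hμ.integrable ht.1)).abs
      (.of_forall fun x => abs_abs_sub_abs_le _ _)
  obtain ⟨A, hA⟩ := isCompact_Icc.bddAbove_image hc
  obtain ⟨B, hB⟩ := hμ.bounded_top T
  refine ⟨max A 0, B, le_max_right _ _, B.2, fun t ht => ⟨le_max_of_le_left
    (hA (mem_image_of_mem _ ht)), ?_⟩⟩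
  have h := hB t ht
  rw [eLpNorm_exponent_top] at h
  filter_upwards [ae_le_eLpNormEssSup (f := μ t) (μ := volume)] with x hx
  have := hx.trans h
  rw [← Real.norm_eq_abs]
  rw [← coe_nnnorm]
  exact_mod_cast (by simpa [enorm_le_coe] using this : ‖μ t x‖₊ ≤ B)

end Solution

/-! ### Advection–diffusion by a field of nonnegative divergence -/

/-- A density `μ`, on the time interval `[0, T]`, carried by the velocity field `u` and diffusing
with diffusivity `σ`. The field `u` is bounded, Lipschitz and differentiable in space, with
nonnegative divergence; the flux `μ u` is continuous in time with values in `L¹`. The constants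
`A`, `U`, `L` bound the mass, the velocity and its gradient uniformly in time, and the equation is
the Duhamel formula, so that the nonlinear origin of `u` plays no further role. -/
structure IsAdvectionDiffusion (σ T A U L : ℝ) (μ : ℝ → E → ℝ) (u : ℝ → E → E) : Prop where
  integrable : ∀ t ∈ Icc 0 T, Integrable (μ t)
  integral_abs_le : ∀ t ∈ Icc 0 T, ∫ x, |μ t x| ≤ A
  norm_le : ∀ t ∈ Icc 0 T, ∀ x, ‖u t x‖ ≤ U
  hasFDerivAt : ∀ t ∈ Icc 0 T, ∀ x, ∃ D : E →L[ℝ] E, HasFDerivAt (u t) D x ∧ ‖D‖ ≤ L ∧ 0 ≤ trace D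
  tendsto_flux : ∀ t ∈ Icc 0 T,
    Tendsto (fun r => ∫ x, ‖μ r x • u r x - μ t x • u t x‖) (𝓝[Icc 0 T] t) (𝓝 0)
  duhamel : ∀ t ∈ Ioc 0 T, ∀ᵐ x, μ t x = heatFlow (t * σ) (μ 0) x
    - ∫ κ in (0 : ℝ)..t, heatFlowDiv ((t - κ) * σ) (fun y => μ κ y • u κ y) x

section Solution

variable {s σ : ℝ} {g : EuclideanSpace ℝ (Fin d) → ℝ} {M : Matrix (Fin d) (Fin d) ℝ}
  {μ : ℝ → EuclideanSpace ℝ (Fin d) → ℝ}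

lemma velocity_sub (hg : IsRieszType s g) (hs : 0 ≤ s) (hsd : s < d - 2) {f₁ f₂ : E → ℝ}
    {B₁ B₂ : ℝ} (h₁ : Integrable f₁) (h₂ : Integrable f₂) (b₁ : ∀ᵐ y, |f₁ y| ≤ B₁)
    (b₂ : ∀ᵐ y, |f₂ y| ≤ B₂) (x : E) :
    velocity M g f₁ x - velocity M g f₂ x = velocity M g (fun y => f₁ y - f₂ y) x := by
  obtain ⟨C, δ, -, -, H, -⟩ := hg.velocity_regular (M := M) hs hsd
  unfold velocity
  rw [← integral_sub (H f₁ _ B₁ 1 h₁ b₁ le_rfl one_pos le_rfl x).1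
    (H f₂ _ B₂ 1 h₂ b₂ le_rfl one_pos le_rfl x).1]
  simp_rw [sub_smul]

/-- The velocity field of a mild solution. Its divergence at `x` is
`∫ μ(y) (M : ∇²g)(x - y) dy`, and it is nonnegative either because both factors are, or because the
second one vanishes: the assumption `s + 2 < d` excludes a singular contribution of the origin. -/
theorem IsMildSolution.isAdvectionDiffusion (hg : IsRieszType s g) (hs : 0 ≤ s) (hsd : s < d - 2)
    (hMg : ∀ x, x ≠ 0 → 0 ≤ frobeniusHessian M g x) (hμ : IsMildSolution M g σ μ)
    (hpos : (∃ x, x ≠ 0 ∧ frobeniusHessian M g x ≠ 0) → ∀ t, 0 ≤ t → 0 ≤ᵐ[volume] μ t) (T : ℝ) :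
    ∃ A U L, 0 ≤ U ∧ 0 ≤ L ∧
      IsAdvectionDiffusion σ T A U L μ (fun t => velocity M g (μ t)) := by
  have hd : 0 < d := by
    have : (0 : ℝ) < d := by linarith
    exact_mod_cast this
  obtain ⟨C, δ, hC, hδ, H₁, H₂⟩ := hg.velocity_regular (M := M) hs hsd
  obtain ⟨A, B, hA, hB, hAB⟩ := hμ.exists_bounds T
  have hint : ∀ t ∈ Icc 0 T, Integrable (μ t) := fun t ht => hμ.integrable ht.1
  have hU : ∀ t ∈ Icc 0 T, ∀ x, ‖velocity M g (μ t) x‖ ≤ C * (B + A) := fun t ht x => by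
    have := (H₁ (μ t) A B 1 (hint t ht) (hAB t ht).2 (hAB t ht).1 one_pos le_rfl x).2
    simpa using this
  have hdiff : ∀ t ∈ Icc 0 T, ∀ x, ∃ D : E →L[ℝ] E, HasFDerivAt (velocity M g (μ t)) D x ∧
      ‖D‖ ≤ C * (B + A) ∧ 0 ≤ trace D := by
    intro t ht x
    obtain ⟨D, h1, h2, h3⟩ := H₂ (μ t) A B (hint t ht) (hAB t ht).2 (hAB t ht).1 x
    refine ⟨D, h1, h2, ?_⟩
    rw [h3]
    refine integral_nonneg_of_ae ?_
    by_cases hne : ∃ x, x ≠ 0 ∧ frobeniusHessian M g x ≠ 0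
    · filter_upwards [hpos hne t ht.1, ae_ne_sub hd x] with y hy hxy
      exact mul_nonneg hy (hMg _ hxy)
    · push Not at hne
      filter_upwards [ae_ne_sub hd x] with y hxy
      simp [hne _ hxy]
  have hcont : ∀ t ∈ Icc 0 T, Continuous (velocity M g (μ t)) := fun t ht =>
    continuous_iff_continuousAt.2 fun x => (hdiff t ht x).choose_spec.1.continuousAt
  -- continuity in `L¹` and boundedness in `L^∞` make the velocity continuous in time, uniformly
  -- in space
  have hunif : ∀ t ∈ Icc 0 T, ∀ ε, 0 < ε → ∀ᶠ r in 𝓝[Icc 0 T] t, ∀ x,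
      ‖velocity M g (μ r) x - velocity M g (μ t) x‖ ≤ ε := by
    intro t ht ε hε
    have l1 : Tendsto (fun r : ℝ => C * (2 * B * r ^ δ)) (𝓝[>] 0) (𝓝 0) := by
      have h0 : Tendsto (fun r : ℝ => r ^ δ) (𝓝[>] 0) (𝓝 0) := by
        have := (Real.continuousAt_rpow_const 0 δ (Or.inr hδ.le)).tendsto
        rw [Real.zero_rpow hδ.ne'] at this
        exact this.mono_left nhdsWithin_le_nhds
      simpa using (h0.const_mul (2 * B)).const_mul C
    obtain ⟨r₀, hr₀, hr0, hr1⟩ := ((l1.eventually_lt_const (half_pos hε)).and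
      (Ioc_mem_nhdsGT (zero_lt_one (α := ℝ)))).exists
    have l2 : Tendsto (fun r => C * (r₀ ^ (-(s + 1)) * ∫ x, |μ r x - μ t x|)) (𝓝[Icc 0 T] t)
        (𝓝 0) := by
      have := ((hμ.tendsto_integral_abs_sub ht.1).mono_left
        (nhdsWithin_mono t fun r (hr : r ∈ Icc 0 T) => hr.1)).const_mul (r₀ ^ (-(s + 1)))
      simpa using this.const_mul C
    filter_upwards [l2.eventually_lt_const (half_pos hε), self_mem_nhdsWithin] with r hr hrT x
    rw [velocity_sub hg hs hsd (hint r hrT) (hint t ht) (hAB r hrT).2 (hAB t ht).2]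
    have h := (H₁ (fun y => μ r y - μ t y) _ (2 * B) r₀ ((hint r hrT).sub (hint t ht)) (by
      filter_upwards [(hAB r hrT).2, (hAB t ht).2] with y h1 h2
      exact (abs_sub _ _).trans (by linarith)) le_rfl hr0 hr1 x).2
    linarith
  refine ⟨A, C * (B + A), C * (B + A), by positivity, by positivity, hint,
    fun t ht => (hAB t ht).1, hU, hdiff, fun t ht => ?_, fun t ht => hμ.duhamel t ht.1⟩
  set V := C * (B + A) with hV
  have hm : ∀ r ∈ Icc 0 T, ∀ t ∈ Icc 0 T, Integrable (fun x => μ r x • velocity M g (μ t) x) := by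
    intro r hr t ht
    exact (hint r hr).smul_bdd V (hcont t ht).aestronglyMeasurable (.of_forall (hU t ht))
  rw [Metric.tendsto_nhds]
  intro ε hε
  have l2 : Tendsto (fun r => V * ∫ x, |μ r x - μ t x|) (𝓝[Icc 0 T] t) (𝓝 0) := by
    have := ((hμ.tendsto_integral_abs_sub ht.1).mono_left
        (nhdsWithin_mono t fun r (hr : r ∈ Icc 0 T) => hr.1)).const_mul V
    simpa using this
  have hε' : 0 < ε / (2 * (A + 1)) := by positivity
  filter_upwards [l2.eventually_lt_const (half_pos hε), hunif t ht _ hε', self_mem_nhdsWithin]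
    with r hr hru hrT
  rw [Real.dist_eq, sub_zero, abs_of_nonneg (integral_nonneg fun x => norm_nonneg _)]
  have i1 : Integrable fun x => V * |μ r x - μ t x| := ((hint r hrT).sub (hint t ht)).abs.const_mul V
  have i2 : Integrable fun x => |μ t x| * (ε / (2 * (A + 1))) := (hint t ht).abs.mul_const _
  calc ∫ x, ‖μ r x • velocity M g (μ r) x - μ t x • velocity M g (μ t) x‖
      ≤ ∫ x, (V * |μ r x - μ t x| + |μ t x| * (ε / (2 * (A + 1)))) := by
        refine integral_mono_of_nonneg (.of_forall fun x => norm_nonneg _) (i1.add i2)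
          (.of_forall fun x => ?_)
        have e : μ r x • velocity M g (μ r) x - μ t x • velocity M g (μ t) x
            = (μ r x - μ t x) • velocity M g (μ r) x
              + μ t x • (velocity M g (μ r) x - velocity M g (μ t) x) := by
          rw [sub_smul, smul_sub]; abel
        simp only
        rw [e]
        refine (norm_add_le _ _).trans ?_
        rw [norm_smul, norm_smul, Real.norm_eq_abs, Real.norm_eq_abs, mul_comm]
        exact add_le_add (mul_le_mul_of_nonneg_right (hU r hrT x) (abs_nonneg _))
          (mul_le_mul_of_nonneg_left (hru x) (abs_nonneg _))
    _ = V * (∫ x, |μ r x - μ t x|) + (∫ x, |μ t x|) * (ε / (2 * (A + 1))) := by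
        rw [integral_add i1 i2, integral_const_mul, integral_mul_const]
    _ < ε / 2 + ε / 2 := by
        refine add_lt_add_of_lt_of_le hr ?_
        calc (∫ x, |μ t x|) * (ε / (2 * (A + 1))) ≤ (A + 1) * (ε / (2 * (A + 1))) :=
              mul_le_mul_of_nonneg_right ((hAB t ht).1.trans (by linarith)) hε'.le
          _ = ε / 2 := by field_simp
    _ = ε := by ring

end Solution

/-! ### The weak Duhamel formula -/

section Fubini

variable {τ B : ℝ}

lemma integrable_inner_gradient_heatKernel (hτ : 0 < τ) {F : E → E} (hF : Integrable F) :
    Integrable (fun p : E × E => inner ℝ (gradient (heatKernel τ) (p.1 - p.2)) (F p.2)) := by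
  have h := hF.convolution_integrand (innerSL ℝ) (integrable_gradient_heatKernel (d := d) hτ)
    (μ := volume)
  refine h.congr (.of_forall fun p => ?_)
  exact real_inner_comm (gradient (heatKernel τ) (p.1 - p.2)) (F p.2)

lemma integrable_heatFlowDiv (hτ : 0 < τ) {F : E → E} (hF : Integrable F) :
    Integrable (heatFlowDiv τ F) :=
  (integrable_inner_gradient_heatKernel hτ hF).integral_prod_left

lemma integral_abs_heatFlowDiv_le (hτ : 0 < τ) {F : E → E} (hF : Integrable F) :
    ∫ x, |heatFlowDiv τ F x| ≤ 2 ^ ((d : ℝ) / 2) / √τ * ∫ y, ‖F y‖ := by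
  have h := integrable_inner_gradient_heatKernel hτ hF
  calc ∫ x, |heatFlowDiv τ F x|
      ≤ ∫ x, ∫ y, ‖inner ℝ (gradient (heatKernel τ) (x - y)) (F y)‖ := by
        refine integral_mono_of_nonneg (.of_forall fun _ => abs_nonneg _) h.norm.integral_prod_left
          (.of_forall fun x => ?_)
        exact norm_integral_le_integral_norm
          (fun y => inner ℝ (gradient (heatKernel τ) (x - y)) (F y))
    _ = ∫ y, ∫ x, ‖inner ℝ (gradient (heatKernel τ) (x - y)) (F y)‖ :=
        integral_integral_swap h.norm
    _ ≤ ∫ y, 2 ^ ((d : ℝ) / 2) / √τ * ‖F y‖ := by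
        refine integral_mono_of_nonneg (.of_forall fun y => integral_nonneg fun x => norm_nonneg _)
          (hF.norm.const_mul _) (.of_forall fun y => ?_)
        calc ∫ x, ‖inner ℝ (gradient (heatKernel τ) (x - y)) (F y)‖
            ≤ ∫ x, ‖gradient (heatKernel τ) (x - y)‖ * ‖F y‖ :=
              integral_mono_of_nonneg (.of_forall fun _ => norm_nonneg _)
                (((integrable_gradient_heatKernel hτ).comp_sub_right y).norm.mul_const _)
                (.of_forall fun x => norm_inner_le_norm (𝕜 := ℝ) _ _)
          _ = (∫ x : E, ‖gradient (heatKernel τ) x‖) * ‖F y‖ := by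
              rw [integral_mul_const,
                integral_sub_right_eq_self (fun x : E => ‖gradient (heatKernel τ) x‖)]
          _ ≤ _ := mul_le_mul_of_nonneg_right (integral_norm_gradient_heatKernel_le hτ)
              (norm_nonneg _)
    _ = _ := integral_const_mul _ _

/-- The heat flow of a divergence is dual to minus the gradient of the heat flow. -/
lemma integral_mul_heatFlowDiv (hτ : 0 < τ) {φ : E → ℝ} (hφ : Continuous φ) (hB : ∀ x, |φ x| ≤ B)
    {F : E → E} (hF : Integrable F) :
    ∫ x, φ x * heatFlowDiv τ F x = - ∫ y, inner ℝ (heatFlowGrad τ φ y) (F y) := by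
  have h : Integrable (fun p : E × E =>
      φ p.1 * inner ℝ (gradient (heatKernel τ) (p.1 - p.2)) (F p.2)) :=
    (integrable_inner_gradient_heatKernel hτ hF).bdd_mul (c := B)
      (hφ.comp continuous_fst).aestronglyMeasurable (.of_forall fun p => hB p.1)
  unfold heatFlowDiv heatFlowGrad
  simp_rw [← integral_const_mul]
  rw [integral_integral_swap h, ← integral_neg]
  refine integral_congr_ae (.of_forall fun y => ?_)
  have hi : Integrable fun x => φ x • gradient (heatKernel τ) (y - x) :=
    ((integrable_gradient_heatKernel hτ).comp_sub_left y).bdd_smul B hφ.aestronglyMeasurable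
      (.of_forall hB)
  simp only
  rw [real_inner_comm, ← integral_inner hi, ← integral_neg]
  refine integral_congr_ae (.of_forall fun x => ?_)
  simp only
  rw [← neg_sub x y, gradient_heatKernel_neg hτ, smul_neg, inner_neg_right, neg_neg,
    inner_smul_right, real_inner_comm]

lemma integrable_heatKernel_mul_prod (hτ : 0 < τ) {f : E → ℝ} (hf : Integrable f) :
    Integrable (fun p : E × E => heatKernel τ (p.1 - p.2) * f p.2) := by
  refine (hf.convolution_integrand (ContinuousLinearMap.mul ℝ ℝ) (integrable_heatKernel (d := d) hτ)
    (μ := volume)).congr (.of_forall fun p => ?_)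
  simp [mul_comm]

lemma integral_mul_heatFlow (hτ : 0 < τ) {φ : E → ℝ} (hφ : Continuous φ) (hB : ∀ x, |φ x| ≤ B)
    {f : E → ℝ} (hf : Integrable f) :
    ∫ x, φ x * heatFlow τ f x = ∫ y, heatFlow τ φ y * f y := by
  have h : Integrable (fun p : E × E => φ p.1 * (heatKernel τ (p.1 - p.2) * f p.2)) :=
    (integrable_heatKernel_mul_prod hτ hf).bdd_mul (c := B)
      (hφ.comp continuous_fst).aestronglyMeasurable (.of_forall fun p => hB p.1)
  unfold heatFlow
  simp_rw [← integral_const_mul, ← integral_mul_const]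
  rw [integral_integral_swap h]
  refine integral_congr_ae (.of_forall fun y => integral_congr_ae (.of_forall fun x => ?_))
  simp only
  rw [← heatKernel_neg τ (x - y), neg_sub]
  ring

lemma integrable_heatFlow (hτ : 0 < τ) {f : E → ℝ} (hf : Integrable f) :
    Integrable (heatFlow τ f) :=
  (integrable_heatKernel_mul_prod hτ hf).integral_prod_left

end Fubini

lemma continuousAt_gradient_heatKernel {τ : ℝ} (hτ : 0 < τ) (z : E) :
    ContinuousAt (fun p : ℝ × E => gradient (heatKernel p.1) p.2) (τ, z) := by
  have h1 : ContinuousAt (fun p : ℝ × E => -(heatKernel p.1 p.2 / (2 * p.1)) • p.2) (τ, z) := by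
    unfold heatKernel
    have e1 : ContinuousAt (fun p : ℝ × E => (4 * Real.pi * p.1) ^ (-(d : ℝ) / 2)) (τ, z) :=
      (by fun_prop : ContinuousAt (fun p : ℝ × E => 4 * Real.pi * p.1) (τ, z)).rpow_const
        (Or.inl (by positivity))
    have e2 : ContinuousAt (fun p : ℝ × E => -‖p.2‖ ^ 2 / (4 * p.1)) (τ, z) :=
      ContinuousAt.div (by fun_prop) (by fun_prop) (by positivity)
    exact (((e1.mul e2.rexp).div (by fun_prop) (by positivity)).neg).smul continuousAt_snd
  refine h1.congr ?_
  filter_upwards [(isOpen_lt continuous_const continuous_fst).mem_nhds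
    (show (0 : ℝ) < ((τ, z) : ℝ × E).1 from hτ)] with p hp
  exact (gradient_heatKernel hp _).symm

lemma norm_gradient_heatKernel_le_of_le {τ₀ τ : ℝ} (h₀ : 0 < τ₀) (h : τ₀ ≤ τ) (z : E) :
    ‖gradient (heatKernel τ) z‖
      ≤ 2 ^ ((d : ℝ) / 2) / √τ₀ * (4 * Real.pi * (2 * τ₀)) ^ (-(d : ℝ) / 2) := by
  have hτ : 0 < τ := h₀.trans_le h
  refine (norm_gradient_heatKernel_le hτ z).trans ?_
  have h1 : heatKernel (2 * τ) z ≤ (4 * Real.pi * (2 * τ₀)) ^ (-(d : ℝ) / 2) := by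
    unfold heatKernel
    calc _ ≤ (4 * Real.pi * (2 * τ₀)) ^ (-(d : ℝ) / 2) * 1 := by
          refine mul_le_mul (Real.rpow_le_rpow_of_nonpos (by positivity) (by gcongr) ?_)
            (Real.exp_le_one_iff.2 ?_) (Real.exp_pos _).le (by positivity)
          · have : (0 : ℝ) ≤ d := by positivity
            linarith
          · rw [neg_div, neg_nonpos]; positivity
      _ = _ := mul_one _
  have h2 : 0 < √τ₀ := Real.sqrt_pos.2 h₀
  have h3 := heatKernel_nonneg (d := d) (τ := 2 * τ) (by positivity) z
  gcongr

/-- The source term of the Duhamel formula depends continuously on time and space, as long as the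
flux depends continuously on time in `L¹`. -/
lemma continuousAt_heatFlowDiv {T σ t : ℝ} (hσ : 0 < σ) (htT : t ≤ T) {F : ℝ → E → E}
    (hF : ∀ r ∈ Icc 0 T, Integrable (F r))
    (hFc : ∀ t ∈ Icc 0 T, Tendsto (fun r => ∫ x, ‖F r x - F t x‖) (𝓝[Icc 0 T] t) (𝓝 0))
    {κ : ℝ} (hκ : κ ∈ Ioo 0 t) (x : E) :
    ContinuousAt (fun p : ℝ × E => heatFlowDiv ((t - p.1) * σ) (F p.1) p.2) (κ, x) := by
  have hκT : κ ∈ Icc 0 T := ⟨hκ.1.le, hκ.2.le.trans htT⟩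
  set τ₀ := (t - κ) * σ / 2 with hτ₀
  have h₀ : 0 < τ₀ := by have := sub_pos.2 hκ.2; positivity
  set b := 2 ^ ((d : ℝ) / 2) / √τ₀ * (4 * Real.pi * (2 * τ₀)) ^ (-(d : ℝ) / 2) with hb
  have hev : ∀ᶠ p : ℝ × E in 𝓝 (κ, x), p.1 ∈ Ioo 0 t ∧ τ₀ ≤ (t - p.1) * σ := by
    have c : Continuous fun p : ℝ × E => (t - p.1) * σ := by fun_prop
    refine (continuous_fst.continuousAt.eventually (Ioo_mem_nhds hκ.1 hκ.2)).and ?_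
    refine (c.continuousAt.eventually (lt_mem_nhds (a := τ₀) ?_)).mono fun p hp => hp.le
    simp only
    linarith
  have cτ : ContinuousAt (fun p : ℝ × E => ∫ y,
      inner ℝ (gradient (heatKernel ((t - p.1) * σ)) (p.2 - y)) (F κ y)) (κ, x) := by
    refine continuousAt_of_dominated (bound := fun y => b * ‖F κ y‖) ?_ ?_
      ((hF κ hκT).norm.const_mul b) (.of_forall fun y => ?_)
    · filter_upwards [hev] with p hp
      have : Continuous fun y => gradient (heatKernel ((t - p.1) * σ)) (p.2 - y) :=
        (continuous_gradient_heatKernel (h₀.trans_le hp.2)).comp (by fun_prop)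
      exact this.aestronglyMeasurable.inner (hF κ hκT).aestronglyMeasurable
    · filter_upwards [hev] with p hp
      refine .of_forall fun y => (norm_inner_le_norm _ _).trans ?_
      exact mul_le_mul_of_nonneg_right (norm_gradient_heatKernel_le_of_le h₀ hp.2 _) (norm_nonneg _)
    · have h1 := continuousAt_gradient_heatKernel (d := d) (τ := (t - κ) * σ) (by linarith) (x - y)
      have h2 : Tendsto (fun p : ℝ × E => ((t - p.1) * σ, p.2 - y)) (𝓝 (κ, x))
          (𝓝 ((t - κ) * σ, x - y)) :=
        (by fun_prop : Continuous fun p : ℝ × E => ((t - p.1) * σ, p.2 - y)).tendsto' _ _ rfl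
      have h3 := h1.tendsto.comp h2
      have h4 : Continuous fun v : E => (inner ℝ v (F κ y) : ℝ) := by fun_prop
      exact (h4.tendsto _).comp h3
  have rem : Tendsto (fun p : ℝ × E => ∫ y,
      inner ℝ (gradient (heatKernel ((t - p.1) * σ)) (p.2 - y)) (F p.1 y - F κ y))
      (𝓝 (κ, x)) (𝓝 0) := by
    have hlim : Tendsto (fun p : ℝ × E => b * ∫ y, ‖F p.1 y - F κ y‖) (𝓝 (κ, x)) (𝓝 0) := by
      have h1 : Tendsto (fun p : ℝ × E => p.1) (𝓝 (κ, x)) (𝓝[Icc 0 T] κ) :=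
        tendsto_nhdsWithin_iff.2 ⟨continuous_fst.continuousAt, hev.mono fun p hp =>
          ⟨hp.1.1.le, hp.1.2.le.trans htT⟩⟩
      simpa using ((hFc κ hκT).comp h1).const_mul b
    refine squeeze_zero_norm' ?_ hlim
    filter_upwards [hev] with p hp
    have hpT : p.1 ∈ Icc 0 T := ⟨hp.1.1.le, hp.1.2.le.trans htT⟩
    rw [← integral_const_mul]
    refine norm_integral_le_of_norm_le (((hF _ hpT).sub (hF _ hκT)).norm.const_mul b)
      (.of_forall fun y => (norm_inner_le_norm _ _).trans ?_)
    exact mul_le_mul_of_nonneg_right (norm_gradient_heatKernel_le_of_le h₀ hp.2 _) (norm_nonneg _)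
  have hsum := cτ.tendsto.add rem
  rw [add_zero] at hsum
  refine Tendsto.congr' ?_ hsum
  filter_upwards [hev] with p hp
  have hpT : p.1 ∈ Icc 0 T := ⟨hp.1.1.le, hp.1.2.le.trans htT⟩
  have hii : ∀ r ∈ Icc 0 T, Integrable fun y =>
      inner ℝ (gradient (heatKernel ((t - p.1) * σ)) (p.2 - y)) (F r y) := by
    intro r hr
    have hc : Continuous fun y => gradient (heatKernel ((t - p.1) * σ)) (p.2 - y) :=
      (continuous_gradient_heatKernel (h₀.trans_le hp.2)).comp (by fun_prop)
    refine ((hF r hr).norm.const_mul b).mono'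
      (hc.aestronglyMeasurable.inner (hF r hr).aestronglyMeasurable) (.of_forall fun y =>
        (norm_inner_le_norm _ _).trans ?_)
    exact mul_le_mul_of_nonneg_right (norm_gradient_heatKernel_le_of_le h₀ hp.2 _) (norm_nonneg _)
  have e : ∀ y : E, (inner ℝ (gradient (heatKernel ((t - p.1) * σ)) (p.2 - y)) (F p.1 y - F κ y) : ℝ)
      = inner ℝ (gradient (heatKernel ((t - p.1) * σ)) (p.2 - y)) (F p.1 y)
        - inner ℝ (gradient (heatKernel ((t - p.1) * σ)) (p.2 - y)) (F κ y) :=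
    fun y => inner_sub_right _ _ _
  simp_rw [e]
  rw [integral_sub (hii _ hpT) (hii _ hκT)]
  unfold heatFlowDiv
  ring

lemma integrableOn_inv_sqrt (t : ℝ) {σ : ℝ} (hσ : 0 < σ) :
    IntegrableOn (fun κ : ℝ => 1 / √((t - κ) * σ)) (Ioo 0 t) := by
  rcases le_or_gt t 0 with ht | ht
  · simp [Ioo_eq_empty_of_le ht]
  have h1 := ((intervalIntegral.intervalIntegrable_rpow' (a := 0) (b := t) (r := -(1 / 2))
    (by norm_num)).comp_sub_left t).symm
  rw [sub_self, sub_zero, intervalIntegrable_iff_integrableOn_Ioo_of_le ht.le] at h1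
  refine IntegrableOn.congr_fun (h1.mul_const (σ ^ (-(1 / 2) : ℝ))) (fun κ hκ => ?_) measurableSet_Ioo
  have : 0 < t - κ := sub_pos.2 hκ.2
  change (t - κ) ^ (-(1 / 2) : ℝ) * σ ^ (-(1 / 2) : ℝ) = _
  rw [← Real.mul_rpow this.le hσ.le, Real.rpow_neg (by positivity), Real.sqrt_eq_rpow, one_div,
    one_div]

section Duhamel

variable {σ T A U L B t : ℝ} {μ : ℝ → EuclideanSpace ℝ (Fin d) → ℝ}
  {u : ℝ → EuclideanSpace ℝ (Fin d) → EuclideanSpace ℝ (Fin d)}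

lemma IsAdvectionDiffusion.continuous_velocity (h : IsAdvectionDiffusion σ T A U L μ u)
    (ht : t ∈ Icc 0 T) : Continuous (u t) :=
  continuous_iff_continuousAt.2 fun x => (h.hasFDerivAt t ht x).choose_spec.1.continuousAt

lemma IsAdvectionDiffusion.integrable_flux (h : IsAdvectionDiffusion σ T A U L μ u)
    (ht : t ∈ Icc 0 T) : Integrable (fun x => μ t x • u t x) :=
  (h.integrable t ht).smul_bdd U (h.continuous_velocity ht).aestronglyMeasurable
    (.of_forall (h.norm_le t ht))

lemma IsAdvectionDiffusion.integral_norm_flux_le (h : IsAdvectionDiffusion σ T A U L μ u)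
    (hU : 0 ≤ U) (ht : t ∈ Icc 0 T) : ∫ x, ‖μ t x • u t x‖ ≤ A * U := by
  calc ∫ x, ‖μ t x • u t x‖ ≤ ∫ x, |μ t x| * U := by
        refine integral_mono (h.integrable_flux ht).norm ((h.integrable t ht).abs.mul_const U)
          fun x => ?_
        simp only [norm_smul, Real.norm_eq_abs]
        exact mul_le_mul_of_nonneg_left (h.norm_le t ht x) (abs_nonneg _)
    _ = (∫ x, |μ t x|) * U := integral_mul_const _ _
    _ ≤ A * U := mul_le_mul_of_nonneg_right (h.integral_abs_le t ht) hU

/-- The Duhamel formula tested against a bounded continuous function. -/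
theorem IsAdvectionDiffusion.weak_duhamel (h : IsAdvectionDiffusion σ T A U L μ u) (hσ : 0 < σ)
    (hU : 0 ≤ U) (ht : t ∈ Ioc 0 T) {φ : E → ℝ} (hφ : Continuous φ) (hB : ∀ x, |φ x| ≤ B) :
    IntegrableOn (fun κ => ∫ x, inner ℝ (heatFlowGrad ((t - κ) * σ) φ x) (μ κ x • u κ x))
      (Ioo 0 t) ∧
    ∫ x, φ x * μ t x = (∫ x, heatFlow (t * σ) φ x * μ 0 x)
      + ∫ κ in Ioo 0 t, ∫ x, inner ℝ (heatFlowGrad ((t - κ) * σ) φ x) (μ κ x • u κ x) := by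
  set F : ℝ → E → E := fun κ x => μ κ x • u κ x with hF
  have hT : ∀ κ ∈ Ioo 0 t, κ ∈ Icc 0 T := fun κ hκ => ⟨hκ.1.le, hκ.2.le.trans ht.2⟩
  have hFi : ∀ r ∈ Icc 0 T, Integrable (F r) := fun r hr => h.integrable_flux hr
  have hpos : ∀ κ ∈ Ioo 0 t, 0 < (t - κ) * σ := fun κ hκ => by have := sub_pos.2 hκ.2; positivity
  have hB0 : 0 ≤ B := (abs_nonneg _).trans (hB 0)
  set ν : Measure (ℝ × E) := (volume.restrict (Ioo 0 t)).prod volume with hν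
  have hνe : ν = (volume : Measure (ℝ × E)).restrict (Ioo 0 t ×ˢ univ) := by
    rw [hν, ← Measure.restrict_univ (μ := (volume : Measure E)), Measure.prod_restrict]
    rfl
  set H : ℝ × E → ℝ := fun p => φ p.2 * heatFlowDiv ((t - p.1) * σ) (F p.1) p.2 with hH
  have Hm : AEStronglyMeasurable H ν := by
    rw [hνe]
    refine ContinuousOn.aestronglyMeasurable ?_ (measurableSet_Ioo.prod MeasurableSet.univ)
    intro p hp
    exact ((hφ.comp continuous_snd).continuousAt.mul (continuousAt_heatFlowDiv hσ ht.2 hFi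
      h.tendsto_flux hp.1 p.2)).continuousWithinAt
  have Hb : ∀ κ ∈ Ioo 0 t, Integrable (fun x => H (κ, x)) ∧
      ∫ x, ‖H (κ, x)‖ ≤ B * 2 ^ ((d : ℝ) / 2) * (A * U) * (1 / √((t - κ) * σ)) := by
    intro κ hκ
    have hi := integrable_heatFlowDiv (hpos κ hκ) (hFi κ (hT κ hκ))
    refine ⟨hi.bdd_mul (c := B) hφ.aestronglyMeasurable (.of_forall hB), ?_⟩
    calc ∫ x, ‖H (κ, x)‖ ≤ ∫ x, B * |heatFlowDiv ((t - κ) * σ) (F κ) x| := by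
          refine integral_mono_of_nonneg (.of_forall fun _ => norm_nonneg _) (hi.abs.const_mul B)
            (.of_forall fun x => ?_)
          simp only [hH, norm_mul, Real.norm_eq_abs]
          exact mul_le_mul_of_nonneg_right (hB x) (abs_nonneg _)
      _ = B * ∫ x, |heatFlowDiv ((t - κ) * σ) (F κ) x| := integral_const_mul _ _
      _ ≤ B * (2 ^ ((d : ℝ) / 2) / √((t - κ) * σ) * (A * U)) := by
          refine mul_le_mul_of_nonneg_left ((integral_abs_heatFlowDiv_le (hpos κ hκ)
            (hFi κ (hT κ hκ))).trans ?_) hB0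
          exact mul_le_mul_of_nonneg_left (h.integral_norm_flux_le hU (hT κ hκ)) (by positivity)
      _ = _ := by ring
  have Hi : Integrable H ν := by
    rw [hν, integrable_prod_iff Hm]
    refine ⟨ae_restrict_of_forall_mem measurableSet_Ioo fun κ hκ => (Hb κ hκ).1, ?_⟩
    refine ((integrableOn_inv_sqrt t hσ).const_mul
      (B * 2 ^ ((d : ℝ) / 2) * (A * U))).mono' Hm.norm.integral_prod_right' ?_
    refine ae_restrict_of_forall_mem measurableSet_Ioo fun κ hκ => ?_
    rw [Real.norm_of_nonneg (integral_nonneg fun x => norm_nonneg _)]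
    exact (Hb κ hκ).2
  have e1 : ∀ κ ∈ Ioo 0 t, ∫ x, H (κ, x)
      = - ∫ x, inner ℝ (heatFlowGrad ((t - κ) * σ) φ x) (F κ x) := fun κ hκ =>
    integral_mul_heatFlowDiv (hpos κ hκ) hφ hB (hFi κ (hT κ hκ))
  have int1 : IntegrableOn (fun κ => ∫ x, inner ℝ (heatFlowGrad ((t - κ) * σ) φ x) (F κ x))
      (Ioo 0 t) := by
    refine (Hi.integral_prod_left.neg).congr (ae_restrict_of_forall_mem measurableSet_Ioo
      fun κ hκ => ?_)
    simp only [Pi.neg_apply]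
    rw [e1 κ hκ, neg_neg]
  refine ⟨int1, ?_⟩
  have hτ : 0 < t * σ := mul_pos ht.1 hσ
  have h0 : Integrable (μ 0) := h.integrable 0 ⟨le_rfl, ht.1.le.trans ht.2⟩
  have e2 : ∀ᵐ x, φ x * μ t x = φ x * heatFlow (t * σ) (μ 0) x - ∫ κ in Ioo 0 t, H (κ, x) := by
    filter_upwards [h.duhamel t ht] with x hx
    rw [hx, mul_sub, intervalIntegral.integral_of_le ht.1.le, integral_Ioc_eq_integral_Ioo,
      ← integral_const_mul]
  have i1 : Integrable fun x => φ x * heatFlow (t * σ) (μ 0) x :=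
    (integrable_heatFlow hτ h0).bdd_mul (c := B) hφ.aestronglyMeasurable (.of_forall hB)
  rw [integral_congr_ae e2, integral_sub i1 Hi.integral_prod_right, integral_mul_heatFlow hτ hφ hB h0,
    ← integral_integral_swap (f := fun κ x => H (κ, x)) Hi, setIntegral_congr_fun measurableSet_Ioo e1,
    integral_neg, sub_neg_eq_add]

end Duhamel

/-! ### Continuity of the flux in time and under translations -/

lemma tendsto_integral_norm_translate_sub {f : E → E} (hf : Integrable f) :
    Tendsto (fun z : E => ∫ x, ‖f (x + z) - f x‖) (𝓝 0) (𝓝 0) := by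
  have hm : MemLp f 1 (volume : Measure E) := memLp_one_iff_integrable.2 hf
  have : Fact ((1 : ℝ≥0∞) ≠ ⊤) := ⟨ENNReal.one_ne_top⟩
  have h1 : Continuous fun z : E => DomAddAct.mk z +ᵥ hm.toLp f :=
    continuous_vadd.comp (DomAddAct.continuous_mk.prodMk continuous_const)
  have h2 := h1.tendsto 0
  rw [tendsto_iff_dist_tendsto_zero] at h2
  refine h2.congr fun z => ?_
  rw [DomAddAct.mk_zero, zero_vadd, DomAddAct.mk_vadd_toLp, dist_eq_norm, ← MemLp.toLp_sub,
    L1.norm_eq_integral_norm]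
  refine integral_congr_ae ?_
  filter_upwards [MemLp.coeFn_toLp (f := (fun x => f (z +ᵥ x)) - f)
    ((hm.comp_measurePreserving (measurePreserving_vadd z volume)).sub hm)] with x hx
  rw [hx]
  simp [add_comm]

lemma integral_norm_translate_sub_le {f : E → E} (hf : Integrable f) (z : E) :
    ∫ x, ‖f (x + z) - f x‖ ≤ 2 * ∫ x, ‖f x‖ := by
  have i1 : Integrable fun x => ‖f (x + z)‖ := (hf.comp_add_right z).norm
  calc ∫ x, ‖f (x + z) - f x‖ ≤ ∫ x, (‖f (x + z)‖ + ‖f x‖) :=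
        integral_mono ((hf.comp_add_right z).sub hf).norm (i1.add hf.norm) fun x => norm_sub_le _ _
    _ = _ := by
      rw [integral_add i1 hf.norm, integral_add_right_eq_self (fun x => ‖f x‖), two_mul]

/-- Continuity of translations in `L¹`, as an affine bound valid for all translations. -/
lemma exists_translation_modulus {f : E → E} (hf : Integrable f) {ε : ℝ} (hε : 0 < ε) :
    ∃ D, 0 ≤ D ∧ ∀ z, ∫ x, ‖f (x + z) - f x‖ ≤ ε + D * ‖z‖ := by
  obtain ⟨δ, hδ, H⟩ := Metric.eventually_nhds_iff.1
    ((tendsto_integral_norm_translate_sub hf).eventually_le_const hε)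
  have h0 : 0 ≤ ∫ x, ‖f x‖ := integral_nonneg fun x => norm_nonneg _
  refine ⟨(2 * ∫ x, ‖f x‖) / δ, div_nonneg (mul_nonneg two_pos.le h0) hδ.le, fun z => ?_⟩
  rcases lt_or_ge ‖z‖ δ with h | h
  · exact (H (by simpa using h)).trans (le_add_of_nonneg_right
      (mul_nonneg (div_nonneg (mul_nonneg two_pos.le h0) hδ.le) (norm_nonneg z)))
  · refine (integral_norm_translate_sub_le hf z).trans ?_
    rw [div_mul_eq_mul_div]
    have : 2 * (∫ x, ‖f x‖) ≤ 2 * (∫ x, ‖f x‖) * ‖z‖ / δ := by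
      rw [le_div_iff₀ hδ]
      exact mul_le_mul_of_nonneg_left h (mul_nonneg two_pos.le h0)
    linarith

section Family

variable {T : ℝ} {F : ℝ → EuclideanSpace ℝ (Fin d) → EuclideanSpace ℝ (Fin d)}

/-- The flux is equicontinuous under translations in `L¹`, uniformly in time. -/
lemma exists_uniform_translation_modulus (hF : ∀ r ∈ Icc 0 T, Integrable (F r))
    (hFc : ∀ t ∈ Icc 0 T, Tendsto (fun r => ∫ x, ‖F r x - F t x‖) (𝓝[Icc 0 T] t) (𝓝 0))
    {ε : ℝ} (hε : 0 < ε) :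
    ∃ D, 0 ≤ D ∧ ∀ t ∈ Icc 0 T, ∀ z, ∫ x, ‖F t (x + z) - F t x‖ ≤ ε + D * ‖z‖ := by
  let P : Set ℝ → Prop := fun S => ∃ D, 0 ≤ D ∧ ∀ t ∈ S, t ∈ Icc 0 T →
      ∀ z, ∫ x, ‖F t (x + z) - F t x‖ ≤ ε + D * ‖z‖
  have key : P (Icc 0 T) := by
    refine isCompact_Icc.induction_on ⟨0, le_rfl, fun t ht => ht.elim⟩ ?_ ?_ ?_
    · rintro S S' hS ⟨D, hD, H⟩
      exact ⟨D, hD, fun t ht => H t (hS ht)⟩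
    · rintro S S' ⟨D, hD, H⟩ ⟨D', hD', H'⟩
      refine ⟨max D D', le_max_of_le_left hD, fun t ht htT z => ?_⟩
      rcases ht with ht | ht
      · exact (H t ht htT z).trans (by gcongr; exact le_max_left _ _)
      · exact (H' t ht htT z).trans (by gcongr; exact le_max_right _ _)
    · intro t ht
      obtain ⟨D, hD, H⟩ := exists_translation_modulus (hF t ht) (half_pos hε)
      refine ⟨_, (hFc t ht).eventually_le_const (by positivity : 0 < ε / 4), D, hD,
        fun r hr hrT z => ?_⟩
      have hr' : ∫ x, ‖F r x - F t x‖ ≤ ε / 4 := hr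
      have i1 : Integrable fun x => ‖F r (x + z) - F t (x + z)‖ :=
        (((hF r hrT).comp_add_right z).sub ((hF t ht).comp_add_right z)).norm
      have i2 : Integrable fun x => ‖F t (x + z) - F t x‖ :=
        (((hF t ht).comp_add_right z).sub (hF t ht)).norm
      have i3 : Integrable fun x => ‖F r x - F t x‖ := ((hF r hrT).sub (hF t ht)).norm
      have i12 : Integrable fun x => ‖F r (x + z) - F t (x + z)‖ + ‖F t (x + z) - F t x‖ := i1.add i2
      calc ∫ x, ‖F r (x + z) - F r x‖
          ≤ ∫ x, (‖F r (x + z) - F t (x + z)‖ + ‖F t (x + z) - F t x‖ + ‖F r x - F t x‖) := by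
            refine integral_mono (((hF r hrT).comp_add_right z).sub (hF r hrT)).norm
              (i12.add i3) fun x => ?_
            have : F r (x + z) - F r x = (F r (x + z) - F t (x + z)) + (F t (x + z) - F t x)
                - (F r x - F t x) := by abel
            simp only
            rw [this]
            exact (norm_sub_le _ _).trans (add_le_add_left (norm_add_le _ _) _)
        _ = (∫ x, ‖F r x - F t x‖) + (∫ x, ‖F t (x + z) - F t x‖) + ∫ x, ‖F r x - F t x‖ := by
            rw [integral_add i12 i3, integral_add i1 i2,
              integral_add_right_eq_self (fun x => ‖F r x - F t x‖)]
        _ ≤ ε + D * ‖z‖ := by linarith [H z]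
  obtain ⟨D, hD, H⟩ := key
  exact ⟨D, hD, fun t ht => H t ht ht⟩

lemma exists_time_modulus (hF : ∀ r ∈ Icc 0 T, Integrable (F r))
    (hFc : ∀ t ∈ Icc 0 T, Tendsto (fun r => ∫ x, ‖F r x - F t x‖) (𝓝[Icc 0 T] t) (𝓝 0))
    {ε : ℝ} (hε : 0 < ε) :
    ∃ δ, 0 < δ ∧ ∀ r ∈ Icc 0 T, ∀ t ∈ Icc 0 T, |r - t| < δ → ∫ x, ‖F r x - F t x‖ ≤ ε := by
  classical
  set G : ℝ → (E →₁[volume] E) := fun t => if h : Integrable (F t) then h.toL1 (F t) else 0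
  have hG : ∀ r ∈ Icc 0 T, ∀ t ∈ Icc 0 T, dist (G r) (G t) = ∫ x, ‖F r x - F t x‖ := by
    intro r hr t ht
    simp only [G, hF r hr, hF t ht, dif_pos]
    rw [dist_eq_norm, ← Integrable.toL1_sub, L1.norm_of_fun_eq_integral_norm]
    rfl
  have hc : ContinuousOn G (Icc 0 T) := by
    intro t ht
    rw [ContinuousWithinAt, tendsto_iff_dist_tendsto_zero]
    refine (hFc t ht).congr' ?_
    filter_upwards [self_mem_nhdsWithin] with r hr
    rw [hG r hr t ht]
  obtain ⟨δ, hδ, H⟩ := Metric.uniformContinuousOn_iff.1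
    (isCompact_Icc.uniformContinuousOn_of_continuous hc) ε hε
  exact ⟨δ, hδ, fun r hr t ht hrt => by rw [← hG r hr t ht]; exact (H r hr t ht hrt).le⟩

end Family

/-! ### The error of one time step -/

lemma heatFlowGrad_heatFlow {a b B : ℝ} (ha : 0 < a) (hb : 0 < b) {φ : E → ℝ} (hφ : Continuous φ)
    (hB : ∀ x, |φ x| ≤ B) (x : E) : heatFlowGrad a (heatFlow b φ) x = heatFlowGrad (a + b) φ x := by
  have h1 := hasGradientAt_heatFlow ha (continuous_heatFlow hb hφ hB) (abs_heatFlow_le hb hB) x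
  rw [funext (heatFlow_heatFlow ha hb hφ hB)] at h1
  exact h1.unique (hasGradientAt_heatFlow (add_pos ha hb) hφ hB x)

/-- Smoothing a bounded field by the heat kernel changes its pairing with an integrable field by
at most the mean size of the translations of the latter. -/
lemma abs_integral_inner_sub_smooth_le {b K ε D : ℝ} (hb : 0 < b) (hε : 0 ≤ ε) (hD : 0 ≤ D)
    {V F : E → E} (hV : Continuous V) (hVK : ∀ x, ‖V x‖ ≤ K) (hF : Integrable F)
    (hFt : ∀ z, ∫ x, ‖F (x + z) - F x‖ ≤ ε + D * ‖z‖) :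
    |(∫ x, inner ℝ (V x) (F x)) - ∫ x, inner ℝ (∫ z, heatKernel b z • V (x - z)) (F x)|
      ≤ K * (ε + D * (2 * 2 ^ ((d : ℝ) / 2) * √b)) := by
  have hK : 0 ≤ K := (norm_nonneg _).trans (hVK 0)
  have hG := integrable_heatKernel (d := d) hb
  have iV : ∀ W : E → E, Integrable W → Integrable fun x => (inner ℝ (V x) (W x) : ℝ) := by
    intro W hW
    refine (hW.norm.const_mul K).mono' (hV.aestronglyMeasurable.inner hW.aestronglyMeasurable)
      (.of_forall fun x => (norm_inner_le_norm _ _).trans ?_)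
    exact mul_le_mul_of_nonneg_right (hVK x) (norm_nonneg _)
  have iP : Integrable (fun p : E × E => heatKernel b p.2 * (inner ℝ (V (p.1 - p.2)) (F p.1) : ℝ)) := by
    refine ((hF.norm.mul_prod hG).const_mul K).mono' ?_ (.of_forall fun p => ?_)
    · have c1 : Continuous fun p : E × E => V (p.1 - p.2) := by fun_prop
      have c2 : Continuous fun p : E × E => heatKernel b p.2 :=
        (continuous_heatKernel b).comp continuous_snd
      exact c2.aestronglyMeasurable.mul (c1.aestronglyMeasurable.inner
        hF.aestronglyMeasurable.comp_fst)
    · rw [norm_mul, Real.norm_of_nonneg (heatKernel_nonneg hb _)]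
      calc heatKernel b p.2 * ‖(inner ℝ (V (p.1 - p.2)) (F p.1) : ℝ)‖
          ≤ heatKernel b p.2 * (K * ‖F p.1‖) := by
            refine mul_le_mul_of_nonneg_left ((norm_inner_le_norm _ _).trans ?_)
              (heatKernel_nonneg hb _)
            exact mul_le_mul_of_nonneg_right (hVK _) (norm_nonneg _)
        _ = _ := by ring
  have e1 : ∫ x, inner ℝ (∫ z, heatKernel b z • V (x - z)) (F x)
      = ∫ z, heatKernel b z * ∫ x, inner ℝ (V x) (F (x + z)) := by
    have h1 : ∀ x, (inner ℝ (∫ z, heatKernel b z • V (x - z)) (F x) : ℝ)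
        = ∫ z, heatKernel b z * (inner ℝ (V (x - z)) (F x) : ℝ) := by
      intro x
      have i : Integrable fun z => heatKernel b z • V (x - z) :=
        hG.smul_bdd K (hV.comp (by fun_prop : Continuous fun z => x - z)).aestronglyMeasurable
          (.of_forall fun z => hVK _)
      rw [real_inner_comm, ← integral_inner i]
      refine integral_congr_ae (.of_forall fun z => ?_)
      simp only
      rw [inner_smul_right, real_inner_comm]
    simp_rw [h1]
    rw [integral_integral_swap iP]
    refine integral_congr_ae (.of_forall fun z => ?_)
    simp only
    rw [integral_const_mul, ← integral_add_right_eq_self (fun x => (inner ℝ (V (x - z)) (F x) : ℝ)) z]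
    simp
  have e2 : ∫ x, inner ℝ (V x) (F x) = ∫ z : E, heatKernel b z * ∫ x, inner ℝ (V x) (F x) := by
    rw [integral_mul_const, integral_heatKernel hb, one_mul]
  have hle : ∀ z, |(∫ x, inner ℝ (V x) (F x)) - ∫ x, inner ℝ (V x) (F (x + z))|
      ≤ K * (ε + D * ‖z‖) := by
    intro z
    have iz := hF.comp_add_right z
    rw [abs_sub_comm, ← integral_sub (iV _ iz) (iV _ hF), ← Real.norm_eq_abs]
    calc _ ≤ ∫ x, K * ‖F (x + z) - F x‖ := by
          refine norm_integral_le_of_norm_le ((iz.sub hF).norm.const_mul K) (.of_forall fun x => ?_)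
          rw [← inner_sub_right]
          exact (norm_inner_le_norm _ _).trans (mul_le_mul_of_nonneg_right (hVK x) (norm_nonneg _))
      _ = K * ∫ x, ‖F (x + z) - F x‖ := integral_const_mul _ _
      _ ≤ _ := mul_le_mul_of_nonneg_left (hFt z) hK
  have iR : Integrable fun z : E => heatKernel b z * ∫ x, inner ℝ (V x) (F x) := hG.mul_const _
  have iS : Integrable fun z : E => heatKernel b z * ∫ x, inner ℝ (V x) (F (x + z)) := by
    refine iP.integral_prod_right.congr (.of_forall fun z => ?_)
    simp only
    rw [integral_const_mul, ← integral_add_right_eq_self (fun x => (inner ℝ (V (x - z)) (F x) : ℝ)) z]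
    simp
  have iQ : Integrable fun z : E => heatKernel b z * (K * (ε + D * ‖z‖)) := by
    refine ((hG.const_mul (K * ε)).add ((integrable_norm_mul_heatKernel hb).const_mul (K * D))).congr
      (.of_forall fun z => ?_)
    simp only [Pi.add_apply]
    ring
  rw [e1, e2, ← integral_sub iR iS, ← Real.norm_eq_abs]
  calc _ ≤ ∫ z : E, heatKernel b z * (K * (ε + D * ‖z‖)) := by
        refine norm_integral_le_of_norm_le iQ (.of_forall fun z => ?_)
        rw [← mul_sub, norm_mul, Real.norm_of_nonneg (heatKernel_nonneg hb z)]
        exact mul_le_mul_of_nonneg_left (hle z) (heatKernel_nonneg hb z)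
    _ = K * ∫ z : E, heatKernel b z * (ε + D * ‖z‖) := by
        rw [← integral_const_mul]
        refine integral_congr_ae (.of_forall fun z => ?_)
        simp only
        ring
    _ ≤ _ := mul_le_mul_of_nonneg_left (integral_heatKernel_mul_le hb hD
        (fun z => by positivity) fun z => le_rfl) hK

section Step

variable {σ T A U L B t₀ t₁ : ℝ} {μ : ℝ → EuclideanSpace ℝ (Fin d) → ℝ}
  {u : ℝ → EuclideanSpace ℝ (Fin d) → EuclideanSpace ℝ (Fin d)}

/-- The weak Duhamel formula between two times. -/
lemma IsAdvectionDiffusion.weak_duhamel_step (h : IsAdvectionDiffusion σ T A U L μ u) (hσ : 0 < σ)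
    (hU : 0 ≤ U) (h₀ : 0 ≤ t₀) (h₀₁ : t₀ < t₁) (h₁ : t₁ ≤ T) {φ : E → ℝ} (hφ : Continuous φ)
    (hB : ∀ x, |φ x| ≤ B) :
    IntegrableOn (fun κ => ∫ x, inner ℝ (heatFlowGrad ((t₁ - κ) * σ) φ x) (μ κ x • u κ x))
      (Ioo t₀ t₁) ∧
    ∫ x, φ x * μ t₁ x = (∫ x, heatFlow ((t₁ - t₀) * σ) φ x * μ t₀ x)
      + ∫ κ in Ioo t₀ t₁, ∫ x, inner ℝ (heatFlowGrad ((t₁ - κ) * σ) φ x) (μ κ x • u κ x) := by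
  obtain ⟨i1, e1⟩ := h.weak_duhamel hσ hU ⟨h₀.trans_lt h₀₁, h₁⟩ hφ hB
  rcases h₀.eq_or_lt with rfl | h0
  · rw [sub_zero]; exact ⟨i1, e1⟩
  have hτ : 0 < (t₁ - t₀) * σ := mul_pos (sub_pos.2 h₀₁) hσ
  obtain ⟨i0, e0⟩ := h.weak_duhamel hσ hU ⟨h0, h₀₁.le.trans h₁⟩ (continuous_heatFlow hτ hφ hB)
    (abs_heatFlow_le hτ hB)
  have hg : ∀ κ ∈ Ioo 0 t₀, ∫ x, inner ℝ (heatFlowGrad ((t₀ - κ) * σ)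
      (heatFlow ((t₁ - t₀) * σ) φ) x) (μ κ x • u κ x)
      = ∫ x, inner ℝ (heatFlowGrad ((t₁ - κ) * σ) φ x) (μ κ x • u κ x) := by
    intro κ hκ
    refine integral_congr_ae (.of_forall fun x => ?_)
    simp only
    rw [heatFlowGrad_heatFlow (mul_pos (sub_pos.2 hκ.2) hσ) hτ hφ hB,
      show (t₀ - κ) * σ + (t₁ - t₀) * σ = (t₁ - κ) * σ by ring]
  have hf : (∫ x, heatFlow (t₀ * σ) (heatFlow ((t₁ - t₀) * σ) φ) x * μ 0 x)
      = ∫ x, heatFlow (t₁ * σ) φ x * μ 0 x := by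
    refine integral_congr_ae (.of_forall fun x => ?_)
    simp only
    rw [heatFlow_heatFlow (mul_pos h0 hσ) hτ hφ hB,
      show t₀ * σ + (t₁ - t₀) * σ = t₁ * σ by ring]
  rw [setIntegral_congr_fun measurableSet_Ioo hg, hf] at e0
  refine ⟨i1.mono_set (Ioo_subset_Ioo_left h₀), ?_⟩
  have i2 := (integrableOn_Ioc_iff_integrableOn_Ioo).2 i1
  rw [e1, e0, ← integral_Ioc_eq_integral_Ioo, ← integral_Ioc_eq_integral_Ioo (x := 0) (y := t₀),
    ← integral_Ioc_eq_integral_Ioo (x := t₀), ← Ioc_union_Ioc_eq_Ioc h₀ h₀₁.le,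
    setIntegral_union (Ioc_disjoint_Ioc_of_le le_rfl) measurableSet_Ioc
      (i2.mono_set (Ioc_subset_Ioc_right h₀₁.le)) (i2.mono_set (Ioc_subset_Ioc_left h₀))]
  ring

end Step

section Step

variable {σ T A U L : ℝ} {μ : ℝ → EuclideanSpace ℝ (Fin d) → ℝ}
  {u : ℝ → EuclideanSpace ℝ (Fin d) → EuclideanSpace ℝ (Fin d)}

lemma integrable_bounded_mul {f m : E → ℝ} {B : ℝ} (hf : Continuous f) (hB : ∀ x, |f x| ≤ B)
    (hm : Integrable m) : Integrable fun x => f x * m x :=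
  hm.bdd_mul (c := B) hf.aestronglyMeasurable (.of_forall hB)

lemma integrable_inner_of_bound {V F : E → E} {K : ℝ} (hV : Continuous V) (hVK : ∀ x, ‖V x‖ ≤ K)
    (hF : Integrable F) : Integrable fun x => (inner ℝ (V x) (F x) : ℝ) := by
  refine (hF.norm.const_mul K).mono' (hV.aestronglyMeasurable.inner hF.aestronglyMeasurable)
    (.of_forall fun x => (norm_inner_le_norm _ _).trans ?_)
  exact mul_le_mul_of_nonneg_right (hVK x) (norm_nonneg _)

/-- Transport along the frozen velocity, to second order. -/
lemma IsAdvectionDiffusion.abs_transport_sub_le (h : IsAdvectionDiffusion σ T A U L μ u)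
    {t : ℝ} (ht : t ∈ Icc 0 T) {ψ : E → ℝ} {ψ' : E → E} {B C K s : ℝ} (hC : 0 ≤ C)
    (hψ : ∀ x, HasGradientAt ψ (ψ' x) x) (hB : ∀ x, |ψ x| ≤ B) (hψ' : Continuous ψ')
    (hK : ∀ x, ‖ψ' x‖ ≤ K) (hψC : ∀ x y, ‖ψ' x - ψ' y‖ ≤ C * ‖x - y‖) :
    |(∫ x, ψ (x + s • u t x) * μ t x) - (∫ x, ψ x * μ t x)
      - s * ∫ x, inner ℝ (ψ' x) (μ t x • u t x)| ≤ C * (s * U) ^ 2 * A := by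
  have hm := h.integrable t ht
  have hu := h.continuous_velocity ht
  have cψ : Continuous ψ := continuous_iff_continuousAt.2 fun x => (hψ x).hasFDerivAt.continuousAt
  have i1 : Integrable fun x => ψ (x + s • u t x) * μ t x :=
    integrable_bounded_mul (by fun_prop) (fun x => hB _) hm
  have i2 : Integrable fun x => ψ x * μ t x := integrable_bounded_mul cψ hB hm
  have i3 : Integrable fun x => s * (inner ℝ (ψ' x) (μ t x • u t x) : ℝ) :=
    (integrable_inner_of_bound hψ' hK (h.integrable_flux ht)).const_mul s
  have i12 : Integrable fun x => ψ (x + s • u t x) * μ t x - ψ x * μ t x := i1.sub i2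
  rw [← integral_const_mul, ← integral_sub i1 i2, ← integral_sub i12 i3, ← Real.norm_eq_abs]
  calc _ ≤ ∫ x, C * (s * U) ^ 2 * |μ t x| := by
        refine norm_integral_le_of_norm_le (hm.abs.const_mul _) (.of_forall fun x => ?_)
        have h1 := abs_taylor_le_of_hasGradientAt hψ hψC x (s • u t x)
        rw [inner_smul_right] at h1 ⊢
        have h2 : ψ (x + s • u t x) * μ t x - ψ x * μ t x
            - s * (μ t x * (inner ℝ (ψ' x) (u t x) : ℝ))
            = (ψ (x + s • u t x) - ψ x - s * inner ℝ (ψ' x) (u t x)) * μ t x := by ring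
        rw [h2, norm_mul, Real.norm_eq_abs, Real.norm_eq_abs]
        refine mul_le_mul_of_nonneg_right (h1.trans (mul_le_mul_of_nonneg_left ?_ hC)) (abs_nonneg _)
        rw [norm_smul, mul_pow, mul_pow, Real.norm_eq_abs, sq_abs]
        exact mul_le_mul_of_nonneg_left (pow_le_pow_left₀ (norm_nonneg _) (h.norm_le t ht x) 2)
          (sq_nonneg s)
    _ = C * (s * U) ^ 2 * ∫ x, |μ t x| := integral_const_mul _ _
    _ ≤ _ := mul_le_mul_of_nonneg_left (h.integral_abs_le t ht) (by positivity)

/-- Over a short time step the evolution is dual to the heat flow followed by transport along the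
initial velocity, up to an error that is small compared with the length of the step. -/
theorem IsAdvectionDiffusion.exists_step_error_le (h : IsAdvectionDiffusion σ T A U L μ u)
    (hσ : 0 < σ) (hU : 0 ≤ U) {ε : ℝ} (hε : 0 < ε) :
    ∃ h₀, 0 < h₀ ∧ ∀ t s, 0 ≤ t → 0 < s → s ≤ h₀ → t + s ≤ T → ∀ (χ : E → ℝ) (K B : ℝ),
      Continuous χ → (∀ x, |χ x| ≤ B) → 0 ≤ K → (∀ x y, |χ x - χ y| ≤ K * ‖x - y‖) →
      |(∫ x, χ x * μ (t + s) x) - ∫ x, heatFlow (s * σ) χ (x + s • u t x) * μ t x|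
        ≤ K * s * ε := by
  have hFi : ∀ r ∈ Icc 0 T, Integrable fun x => μ r x • u r x := fun r hr => h.integrable_flux hr
  have hε4 : 0 < ε / 4 := by positivity
  obtain ⟨D, hD, Htr⟩ := exists_uniform_translation_modulus hFi h.tendsto_flux hε4
  obtain ⟨δ, hδ, Hti⟩ := exists_time_modulus hFi h.tendsto_flux hε4
  set c : ℝ := 2 ^ ((d : ℝ) / 2) with hc
  have hc0 : 0 < c := by positivity
  have hev : ∀ᶠ s : ℝ in 𝓝 0, D * (2 * c * √(s * σ)) < ε / 4 ∧ c * (√s / √σ) * U ^ 2 * A < ε / 4 := by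
    have c1 : Continuous fun s : ℝ => D * (2 * c * √(s * σ)) := by fun_prop
    have c2 : Continuous fun s : ℝ => c * (√s / √σ) * U ^ 2 * A := by fun_prop
    exact (c1.tendsto' 0 0 (by simp) |>.eventually_lt_const hε4).and
      (c2.tendsto' 0 0 (by simp) |>.eventually_lt_const hε4)
  obtain ⟨δ', hδ', H'⟩ := Metric.eventually_nhds_iff.1 hev
  refine ⟨min (δ / 2) (δ' / 2), by positivity, fun t s ht hs hsh htsT χ K B hχ hχB hK hχK => ?_⟩
  obtain ⟨b1, b2⟩ := H' (y := s) (by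
    rw [Real.dist_eq, sub_zero, abs_of_pos hs]
    exact lt_of_le_of_lt (hsh.trans (min_le_right _ _)) (by linarith))
  have hsδ : s < δ := lt_of_le_of_lt (hsh.trans (min_le_left _ _)) (by linarith)
  have hτ : 0 < s * σ := mul_pos hs hσ
  have htT : t ∈ Icc 0 T := ⟨ht, by linarith⟩
  obtain ⟨iq, eq⟩ := h.weak_duhamel_step hσ hU ht (by linarith : t < t + s) htsT hχ hχB
  rw [add_sub_cancel_left] at eq
  set F : ℝ → E → E := fun r x => μ r x • u r x with hF
  set q : ℝ → ℝ := fun κ => ∫ x, inner ℝ (heatFlowGrad ((t + s - κ) * σ) χ x) (F κ x) with hq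
  set q₀ : ℝ := ∫ x, inner ℝ (heatFlowGrad (s * σ) χ x) (F t x) with hq₀
  -- replace the flux at time `κ` by the one at time `t`, then the gradient at time `t + s - κ` by the
  -- one at time `s`; the latter is a heat flow that can be moved onto the flux
  have hκ : ∀ κ ∈ Ioo t (t + s), ‖q κ - q₀‖ ≤ K * (3 * (ε / 4)) := by
    intro κ hκ
    have hκT : κ ∈ Icc 0 T := ⟨ht.trans hκ.1.le, hκ.2.le.trans htsT⟩
    have ha : 0 < (t + s - κ) * σ := mul_pos (sub_pos.2 hκ.2) hσ
    have hb : 0 < (κ - t) * σ := mul_pos (sub_pos.2 hκ.1) hσ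
    have cV := continuous_heatFlowGrad ha hχ hχB
    have bV := norm_heatFlowGrad_le_of_lipschitz ha hχ hχB hK hχK
    have h1 : |q κ - ∫ x, inner ℝ (heatFlowGrad ((t + s - κ) * σ) χ x) (F t x)| ≤ K * (ε / 4) := by
      rw [hq]
      simp only
      rw [← integral_sub (integrable_inner_of_bound cV bV (hFi κ hκT))
        (integrable_inner_of_bound cV bV (hFi t htT)), ← Real.norm_eq_abs]
      calc _ ≤ ∫ x, K * ‖F κ x - F t x‖ := by
            refine norm_integral_le_of_norm_le (((hFi κ hκT).sub (hFi t htT)).norm.const_mul K)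
              (.of_forall fun x => ?_)
            rw [← inner_sub_right]
            exact (norm_inner_le_norm _ _).trans (mul_le_mul_of_nonneg_right (bV x) (norm_nonneg _))
        _ = K * ∫ x, ‖F κ x - F t x‖ := integral_const_mul _ _
        _ ≤ _ := by
            refine mul_le_mul_of_nonneg_left (Hti κ hκT t htT ?_) hK
            rw [abs_of_pos (sub_pos.2 hκ.1)]
            linarith [hκ.2]
    have h2 : |(∫ x, inner ℝ (heatFlowGrad ((t + s - κ) * σ) χ x) (F t x)) - q₀|
        ≤ K * (2 * (ε / 4)) := by
      have h3 := abs_integral_inner_sub_smooth_le hb hε4.le hD cV bV (hFi t htT) (Htr t htT)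
      have h4 : ∀ x, ∫ z, heatKernel ((κ - t) * σ) z • heatFlowGrad ((t + s - κ) * σ) χ (x - z)
          = heatFlowGrad (s * σ) χ x := fun x => by
        rw [← heatFlowGrad_add ha hb hχ hχB]
        congr 1; ring
      simp_rw [h4] at h3
      refine h3.trans (mul_le_mul_of_nonneg_left ?_ hK)
      have h5 : √((κ - t) * σ) ≤ √(s * σ) :=
        Real.sqrt_le_sqrt (mul_le_mul_of_nonneg_right (by linarith [hκ.2]) hσ.le)
      have h6 : D * (2 * c * √((κ - t) * σ)) ≤ D * (2 * c * √(s * σ)) := by gcongr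
      linarith
    have : q κ - q₀ = (q κ - ∫ x, inner ℝ (heatFlowGrad ((t + s - κ) * σ) χ x) (F t x))
        + ((∫ x, inner ℝ (heatFlowGrad ((t + s - κ) * σ) χ x) (F t x)) - q₀) := by ring
    rw [this, Real.norm_eq_abs]
    refine (abs_add_le _ _).trans ((add_le_add h1 h2).trans (le_of_eq (by ring)))
  have hint : |(∫ κ in Ioo t (t + s), q κ) - s * q₀| ≤ K * s * (3 * (ε / 4)) := by
    have e1 : s * q₀ = ∫ κ in Ioo t (t + s), q₀ := by
      rw [setIntegral_const, Real.volume_real_Ioo_of_le (by linarith), smul_eq_mul]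
      ring
    rw [e1, ← integral_sub iq (integrableOn_const (by simp)), ← Real.norm_eq_abs]
    refine (norm_setIntegral_le_of_norm_le_const (C := K * (3 * (ε / 4))) (by simp) hκ).trans ?_
    rw [Real.volume_real_Ioo_of_le (by linarith)]
    exact le_of_eq (by ring)
  have htr := h.abs_transport_sub_le htT (s := s)
    (C := K * (c / √(s * σ))) (by positivity) (hasGradientAt_heatFlow hτ hχ hχB)
    (abs_heatFlow_le hτ hχB) (continuous_heatFlowGrad hτ hχ hχB)
    (norm_heatFlowGrad_le_of_lipschitz hτ hχ hχB hK hχK) (norm_heatFlowGrad_sub_le hτ hχ hχB hK hχK)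
  have e3 : K * (c / √(s * σ)) * (s * U) ^ 2 * A = K * s * (c * (√s / √σ) * U ^ 2 * A) := by
    have hs' := Real.sqrt_pos.2 hs
    have hσ' := Real.sqrt_pos.2 hσ
    rw [Real.sqrt_mul hs.le]
    have e4 : s = √s * √s := (Real.mul_self_sqrt hs.le).symm
    field_simp
    rw [Real.sq_sqrt hs.le]
  rw [e3] at htr
  have h5 : K * s * (c * (√s / √σ) * U ^ 2 * A) ≤ K * s * (ε / 4) :=
    mul_le_mul_of_nonneg_left b2.le (by positivity)
  rw [eq]
  calc _ = |((∫ κ in Ioo t (t + s), q κ) - s * q₀)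
        - ((∫ x, heatFlow (s * σ) χ (x + s • u t x) * μ t x) - (∫ x, heatFlow (s * σ) χ x * μ t x)
          - s * q₀)| := by congr 1; ring
    _ ≤ K * s * (3 * (ε / 4)) + K * s * (ε / 4) :=
        (abs_sub _ _).trans (add_le_add hint (htr.trans h5))
    _ = K * s * ε := by ring

end Step

/-! ### The Jacobian of one transport step -/

lemma trace_toMatrix (A : E →L[ℝ] E) :
    (LinearMap.toMatrix (EuclideanSpace.basisFun (Fin d) ℝ).toBasis
      (EuclideanSpace.basisFun (Fin d) ℝ).toBasis (A : E →ₗ[ℝ] E)).trace = trace A := by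
  unfold trace Matrix.trace
  refine Finset.sum_congr rfl fun i _ => ?_
  simp [LinearMap.toMatrix_apply]

lemma det_eq_det_toMatrix (A : E →L[ℝ] E) :
    A.det = (LinearMap.toMatrix (EuclideanSpace.basisFun (Fin d) ℝ).toBasis
      (EuclideanSpace.basisFun (Fin d) ℝ).toBasis (A : E →ₗ[ℝ] E)).det := by
  rw [LinearMap.det_toMatrix]

lemma differentiable_det : Differentiable ℝ fun A : E →L[ℝ] E => A.det := by
  have h : (fun A : E →L[ℝ] E => A.det) = fun A : E →L[ℝ] E => ∑ π : Equiv.Perm (Fin d),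
      Equiv.Perm.sign π • ∏ i, A (EuclideanSpace.single i 1) (π i) := by
    ext A
    rw [det_eq_det_toMatrix, Matrix.det_apply]
    simp [LinearMap.toMatrix_apply]
  rw [h]
  have h1 : ∀ i j, ContDiff ℝ 1 fun A : E →L[ℝ] E => A (EuclideanSpace.single i 1) j :=
    fun i j => ((EuclideanSpace.proj j : E →L[ℝ] ℝ) ∘L
      ContinuousLinearMap.apply ℝ E (EuclideanSpace.single i (1 : ℝ))).contDiff
  refine Differentiable.fun_sum fun π _ => ?_
  simp only [Units.smul_def, zsmul_eq_mul]
  refine Differentiable.const_mul ?_ _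
  exact (contDiff_prod (n := 1) fun i _ => h1 i (π i)).differentiable one_ne_zero

lemma hasDerivAt_det_id_add_smul (A : E →L[ℝ] E) :
    HasDerivAt (fun h : ℝ => (ContinuousLinearMap.id ℝ E + h • A).det) (trace A) 0 := by
  set M := LinearMap.toMatrix (EuclideanSpace.basisFun (Fin d) ℝ).toBasis
      (EuclideanSpace.basisFun (Fin d) ℝ).toBasis (A : E →ₗ[ℝ] E) with hM
  have h1 : ∀ h : ℝ, (ContinuousLinearMap.id ℝ E + h • A).det = 1 + trace A * h
      + (Matrix.det (1 + (Polynomial.X : Polynomial ℝ) • M.map Polynomial.C)).divX.divX.eval h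
        * h ^ 2 := by
    intro h
    rw [det_eq_det_toMatrix, ← trace_toMatrix, ← hM, ← Matrix.det_one_add_smul]
    congr 1
    simp only [ContinuousLinearMap.toLinearMap_add, ContinuousLinearMap.toLinearMap_smul, map_add, map_smul,
      ContinuousLinearMap.coe_id, LinearMap.toMatrix_id]
    rfl
  simp_rw [h1]
  have h2 := (((hasDerivAt_id (0 : ℝ)).const_mul (trace A)).const_add 1).add
    (((Matrix.det (1 + (Polynomial.X : Polynomial ℝ) • M.map Polynomial.C)).divX.divX.hasDerivAt
      (0 : ℝ)).mul ((hasDerivAt_id (0 : ℝ)).pow 2))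
  refine (h2.congr_deriv (by simp)).congr_of_eventuallyEq (.of_forall fun h => ?_)
  simp

/-- The Jacobian of a perturbation of the identity is, to first order, controlled by the
divergence, uniformly on bounded sets of gradients. -/
lemma exists_det_ge (L ε : ℝ) (hε : 0 < ε) :
    ∃ h₀, 0 < h₀ ∧ ∀ (A : E →L[ℝ] E) (h : ℝ), ‖A‖ ≤ L → 0 ≤ trace A → 0 < h → h ≤ h₀ →
      1 - ε * h ≤ (ContinuousLinearMap.id ℝ E + h • A).det := by
  set I : E →L[ℝ] E := ContinuousLinearMap.id ℝ E with hI
  obtain ⟨f', hf'⟩ := differentiable_det I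
  have htr : ∀ A : E →L[ℝ] E, f' A = trace A := by
    intro A
    have h1 : HasDerivAt (fun h : ℝ => I + h • A) A 0 := by
      simpa using ((hasDerivAt_id (0 : ℝ)).smul_const A).const_add I
    have h2 : HasFDerivAt (fun A : E →L[ℝ] E => A.det) f' (I + (0 : ℝ) • A) := by
      have e : I + (0 : ℝ) • A = I := by ext; simp
      rw [e]; exact hf'
    have h4 := h2.comp_hasDerivAt 0 h1
    exact h4.unique (hasDerivAt_det_id_add_smul A)
  set L' := max L 0 + 1 with hL'
  have hL'0 : 0 < L' := by positivity
  have h3 := (hasFDerivAt_iff_isLittleO_nhds_zero.1 hf').bound (div_pos hε hL'0)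
  obtain ⟨δ, hδ, H⟩ := Metric.eventually_nhds_iff.1 h3
  refine ⟨δ / (2 * L'), by positivity, fun A h hA hAt hh hhδ => ?_⟩
  have hAL : ‖A‖ ≤ L' := hA.trans ((le_max_left _ _).trans (by linarith))
  have hn : ‖h • A‖ ≤ h * L' := by
    rw [norm_smul, Real.norm_of_nonneg hh.le]; gcongr
  have hsm : h * L' < δ := by
    calc h * L' ≤ δ / (2 * L') * L' := by gcongr
      _ = δ / 2 := by field_simp
      _ < δ := by linarith
  have h4 := H (y := h • A) (by rw [dist_zero_right]; exact hn.trans_lt hsm)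
  rw [map_smul, htr, smul_eq_mul, Real.norm_eq_abs] at h4
  have h5 : ε / L' * ‖h • A‖ ≤ ε * h := by
    calc ε / L' * ‖h • A‖ ≤ ε / L' * (h * L') := by gcongr
      _ = ε * h := by field_simp
  have h6 : I.det = 1 := by
    rw [hI, ContinuousLinearMap.det, ContinuousLinearMap.coe_id, LinearMap.det_id]
  have h7 := (abs_le.1 (h4.trans h5)).1
  rw [h6] at h7
  have h8 : 0 ≤ h * trace A := mul_nonneg hh.le hAt
  linarith

lemma injective_id_add_smul {v : E → E} {L h : ℝ} (hv : ∀ x y, ‖v x - v y‖ ≤ L * ‖x - y‖)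
    (hh : 0 ≤ h) (hhL : h * L < 1) : Function.Injective fun x => x + h • v x := by
  intro x y hxy
  by_contra hne
  have h1 : x - y = h • (v y - v x) := by
    simp only at hxy
    rw [smul_sub, sub_eq_sub_iff_add_eq_add, hxy, add_comm]
  have h2 : ‖x - y‖ ≤ h * (L * ‖x - y‖) := by
    calc ‖x - y‖ = h * ‖v y - v x‖ := by rw [h1, norm_smul, Real.norm_of_nonneg hh]
      _ ≤ _ := by
        rw [norm_sub_rev]
        exact mul_le_mul_of_nonneg_left (hv x y) hh
  have h3 : 0 < ‖x - y‖ := norm_pos_iff.2 (sub_ne_zero.2 hne)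
  nlinarith

/-- Change of variables in one transport step. -/
lemma lintegral_comp_id_add_smul_le {v : E → E} {v' : E → E →L[ℝ] E} {L h c : ℝ}
    (hv : ∀ x y, ‖v x - v y‖ ≤ L * ‖x - y‖) (hv' : ∀ x, HasFDerivAt v (v' x) x)
    (hh : 0 ≤ h) (hhL : h * L < 1) (hc : 0 < c)
    (hdet : ∀ x, c ≤ (ContinuousLinearMap.id ℝ E + h • v' x).det) (ψ : E → ℝ≥0∞) :
    ∫⁻ x, ψ (x + h • v x) ≤ (ENNReal.ofReal c)⁻¹ * ∫⁻ x, ψ x := by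
  have hd : ∀ x ∈ (univ : Set E), HasFDerivWithinAt (fun x => x + h • v x)
      (ContinuousLinearMap.id ℝ E + h • v' x) univ x := fun x _ =>
    ((hasFDerivAt_id x).add ((hv' x).const_smul h)).hasFDerivWithinAt
  have key := lintegral_image_eq_lintegral_abs_det_fderiv_mul volume MeasurableSet.univ hd
    (injective_id_add_smul hv hh hhL).injOn ψ
  have hc' : ENNReal.ofReal c ≠ 0 := by simpa using hc
  rw [← ENNReal.div_eq_inv_mul, ENNReal.le_div_iff_mul_le (Or.inl hc') (Or.inl ENNReal.ofReal_ne_top),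
    mul_comm, ← lintegral_const_mul' _ _ ENNReal.ofReal_ne_top]
  calc ∫⁻ x, ENNReal.ofReal c * ψ (x + h • v x)
      ≤ ∫⁻ x in univ, ENNReal.ofReal |(ContinuousLinearMap.id ℝ E + h • v' x).det|
        * ψ (x + h • v x) := by
        rw [Measure.restrict_univ]
        refine lintegral_mono fun x => ?_
        gcongr
        exact (hdet x).trans (le_abs_self _)
    _ = ∫⁻ x in (fun x => x + h • v x) '' univ, ψ x := key.symm
    _ ≤ ∫⁻ x, ψ x := setLIntegral_le_lintegral _ _

/-! ### The dual evolution of test functions -/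

/-- The constant of the smoothing estimate when the reciprocal exponent decreases from `x` to `y`
in a time proportional to `x - y`, with ratio `ρ`. -/
def rateConst (d : ℕ) (ρ x y : ℝ) : ℝ :=
  (conjRatio y / conjRatio x) ^ ((d : ℝ) / 2) * (4 * Real.pi * ρ) ^ (-((d : ℝ) / 2) * (x - y))

lemma smoothingConst_eq_rateConst {x y τ : ℝ} :
    smoothingConst d x y τ = rateConst d (τ / (x - y)) x y := by
  rw [smoothingConst, rateConst, mul_div_assoc]

lemma rateConst_self {ρ x : ℝ} (h0 : 0 < x) (h1 : x < 1) : rateConst d ρ x x = 1 := by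
  rw [rateConst, div_self (conjRatio_pos h0 h1).ne', sub_self, mul_zero, Real.rpow_zero,
    Real.one_rpow, one_mul]

lemma rateConst_nonneg {ρ x y : ℝ} (hρ : 0 ≤ ρ) (hx0 : 0 < x) (hx1 : x < 1) (hy0 : 0 < y)
    (hy1 : y < 1) : 0 ≤ rateConst d ρ x y := by
  have := conjRatio_pos hx0 hx1
  have := conjRatio_pos hy0 hy1
  unfold rateConst
  positivity

/-- At a constant ratio of time to reciprocal exponent, the sharp constants compose without loss. -/
lemma rateConst_mul {ρ x y z : ℝ} (hρ : 0 < ρ) (hx0 : 0 < x) (hx1 : x < 1) (hy0 : 0 < y)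
    (hy1 : y < 1) (hz0 : 0 < z) (hz1 : z < 1) :
    rateConst d ρ y z * rateConst d ρ x y = rateConst d ρ x z := by
  have kx := conjRatio_pos hx0 hx1
  have ky := conjRatio_pos hy0 hy1
  have kz := conjRatio_pos hz0 hz1
  unfold rateConst
  rw [mul_mul_mul_comm, ← Real.mul_rpow (by positivity) (by positivity),
    ← Real.rpow_add (by positivity)]
  congr 2
  · field_simp
  · ring

/-- One transport step increases the `L^{1/y}` norm by at most the `y`-th power of the inverse
Jacobian, here bounded by the inverse Jacobian itself. -/
lemma eLpNorm_comp_id_add_smul_le {v : E → E} {v' : E → E →L[ℝ] E} {L h c y : ℝ}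
    (hv : ∀ x y, ‖v x - v y‖ ≤ L * ‖x - y‖) (hv' : ∀ x, HasFDerivAt v (v' x) x)
    (hh : 0 ≤ h) (hhL : h * L < 1) (hc : 0 < c) (hc1 : c ≤ 1)
    (hdet : ∀ x, c ≤ (ContinuousLinearMap.id ℝ E + h • v' x).det) (hy : 0 < y) (hy1 : y ≤ 1)
    (ψ : E → ℝ) :
    eLpNorm (fun x => ψ (x + h • v x)) (ENNReal.ofReal y⁻¹) volume
      ≤ ENNReal.ofReal c⁻¹ * eLpNorm ψ (ENNReal.ofReal y⁻¹) volume := by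
  rw [eLpNorm_ofReal_inv hy, eLpNorm_ofReal_inv hy]
  calc _ ≤ ((ENNReal.ofReal c)⁻¹ * ∫⁻ x, ENNReal.ofReal (|ψ x| ^ y⁻¹)) ^ y := by
        gcongr
        exact lintegral_comp_id_add_smul_le hv hv' hh hhL hc hdet
          fun x => ENNReal.ofReal (|ψ x| ^ y⁻¹)
    _ = (ENNReal.ofReal c)⁻¹ ^ y * (∫⁻ x, ENNReal.ofReal (|ψ x| ^ y⁻¹)) ^ y :=
        ENNReal.mul_rpow_of_nonneg _ _ hy.le
    _ ≤ _ := by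
        gcongr
        rw [ENNReal.ofReal_inv_of_pos hc]
        calc (ENNReal.ofReal c)⁻¹ ^ y ≤ (ENNReal.ofReal c)⁻¹ ^ (1 : ℝ) :=
              ENNReal.rpow_le_rpow_of_exponent_le
                (ENNReal.one_le_inv.2 (ENNReal.ofReal_le_one.2 hc1)) hy1
          _ = _ := ENNReal.rpow_one _

section Dual

variable {σ T A U L : ℝ} {μ : ℝ → EuclideanSpace ℝ (Fin d) → ℝ}
  {u : ℝ → EuclideanSpace ℝ (Fin d) → EuclideanSpace ℝ (Fin d)}

lemma IsAdvectionDiffusion.lipschitz (h : IsAdvectionDiffusion σ T A U L μ u) {t : ℝ}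
    (ht : t ∈ Icc 0 T) (x y : E) : ‖u t x - u t y‖ ≤ L * ‖x - y‖ :=
  convex_univ.norm_image_sub_le_of_norm_hasFDerivWithin_le (𝕜 := ℝ)
    (fun x _ => (h.hasFDerivAt t ht x).choose_spec.1.hasFDerivWithinAt)
    (fun x _ => (h.hasFDerivAt t ht x).choose_spec.2.1) (mem_univ y) (mem_univ x)

/-- The dual evolution of a test function over `j` steps of length `s`: it stays bounded and
Lipschitz, its `L^r` norms obey the smoothing estimate of the heat flow up to the Jacobians of the
transport steps, and its pairing with the solution is almost conserved. -/
lemma IsAdvectionDiffusion.exists_dual (h : IsAdvectionDiffusion σ T A U L μ u)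
    (hσ : 0 < σ) (hL : 0 ≤ L) {ε s : ℝ} (hε : 0 < ε) (hs : 0 < s) (hsL : s * L < 1)
    (hεs : ε * s < 1)
    (herr : ∀ t, 0 ≤ t → t + s ≤ T → ∀ (χ : E → ℝ) (K B : ℝ),
      Continuous χ → (∀ x, |χ x| ≤ B) → 0 ≤ K → (∀ x y, |χ x - χ y| ≤ K * ‖x - y‖) →
      |(∫ x, χ x * μ (t + s) x) - ∫ x, heatFlow (s * σ) χ (x + s • u t x) * μ t x|
        ≤ K * s * ε)
    (hdet : ∀ D : E →L[ℝ] E, ‖D‖ ≤ L → 0 ≤ trace D →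
      1 - ε * s ≤ (ContinuousLinearMap.id ℝ E + s • D).det)
    {φ : E → ℝ} {K B : ℝ} (hφ : Continuous φ) (hB : ∀ x, |φ x| ≤ B) (hK : 0 ≤ K)
    (hφK : ∀ x y, |φ x - φ y| ≤ K * ‖x - y‖) {x₀ η : ℝ} (hx₀ : x₀ < 1) (hη : 0 < η) (j : ℕ)
    (hjT : j * s ≤ T) (hj : 0 < x₀ - j * η) :
    ∃ χ : E → ℝ, Continuous χ ∧ (∀ x, |χ x| ≤ B) ∧
      (∀ x y, |χ x - χ y| ≤ K * (1 + s * L) ^ j * ‖x - y‖) ∧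
      eLpNorm χ (ENNReal.ofReal (x₀ - j * η)⁻¹) volume
        ≤ ENNReal.ofReal (((1 - ε * s)⁻¹) ^ j * rateConst d (s * σ / η) x₀ (x₀ - j * η))
          * eLpNorm φ (ENNReal.ofReal x₀⁻¹) volume ∧
      |(∫ x, φ x * μ T x) - ∫ x, χ x * μ (T - j * s) x| ≤ j * (K * (1 + s * L) ^ j * s * ε) := by
  have hc : 0 < 1 - ε * s := by linarith
  have hc1 : 1 - ε * s ≤ 1 := by have := mul_pos hε hs; linarith
  have hτ : 0 < s * σ := mul_pos hs hσ
  have hρ : 0 < s * σ / η := by positivity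
  induction j with
  | zero =>
    have hx0 : 0 < x₀ := by simpa using hj
    refine ⟨φ, hφ, hB, by simpa using hφK, ?_, by simp⟩
    simp [rateConst_self hx0 hx₀]
  | succ j ih =>
    push_cast at hjT hj ⊢
    have hxj : 0 < x₀ - j * η := by nlinarith
    have hxj1 : x₀ - j * η < 1 := by have : 0 ≤ j * η := by positivity
                                     linarith
    obtain ⟨χ, cχ, bχ, lχ, nχ, eχ⟩ := ih (by nlinarith) hxj
    set t := T - (j + 1) * s with ht
    have ht0 : 0 ≤ t := by rw [ht]; linarith
    have hts : t + s = T - j * s := by rw [ht]; ring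
    have htT : t ∈ Icc 0 T := ⟨ht0, by rw [ht]; have : 0 ≤ (j + 1) * s := by positivity
                                       linarith⟩
    have hu := h.continuous_velocity htT
    have hul := h.lipschitz htT
    set Kj := K * (1 + s * L) ^ j with hKj
    have hKj0 : 0 ≤ Kj := by positivity
    refine ⟨fun x => heatFlow (s * σ) χ (x + s • u t x), ?_, fun x => abs_heatFlow_le hτ bχ _,
      fun x y => ?_, ?_, ?_⟩
    · exact (continuous_heatFlow hτ cχ bχ).comp (by fun_prop)
    · refine (heatFlow_sub_le_of_lipschitz hτ cχ bχ lχ _ _).trans ?_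
      have h1 : x + s • u t x - (y + s • u t y) = (x - y) + s • (u t x - u t y) := by
        rw [smul_sub]; abel
      have h2 : ‖x + s • u t x - (y + s • u t y)‖ ≤ (1 + s * L) * ‖x - y‖ := by
        rw [h1]
        refine (norm_add_le _ _).trans ?_
        rw [norm_smul, Real.norm_of_nonneg hs.le]
        have := mul_le_mul_of_nonneg_left (hul x y) hs.le
        linarith
      calc Kj * ‖x + s • u t x - (y + s • u t y)‖ ≤ Kj * ((1 + s * L) * ‖x - y‖) :=
            mul_le_mul_of_nonneg_left h2 hKj0
        _ = _ := by rw [hKj, pow_succ]; ring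
    · have e : x₀ - (j + 1) * η = x₀ - j * η - η := by ring
      have h1 := eLpNorm_comp_id_add_smul_le (h := s) (c := 1 - ε * s) (y := x₀ - (j + 1) * η) hul
        (fun x => (h.hasFDerivAt t htT x).choose_spec.1) hs.le hsL hc hc1
        (fun x => hdet _ (h.hasFDerivAt t htT x).choose_spec.2.1
          (h.hasFDerivAt t htT x).choose_spec.2.2) hj (by linarith) (heatFlow (s * σ) χ)
      have h2 := eLpNorm_heatFlow_le (d := d) (x := x₀ - j * η) (y := x₀ - (j + 1) * η) hj
        (by linarith) hxj1 hτ cχ bχ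
      rw [smoothingConst_eq_rateConst, show x₀ - j * η - (x₀ - (j + 1) * η) = η by ring] at h2
      have r1 := rateConst_nonneg (d := d) hρ.le hxj hxj1 hj (by linarith)
      have r2 := rateConst_nonneg (d := d) hρ.le (by nlinarith : 0 < x₀) hx₀ hxj hxj1
      calc _ ≤ _ := h1
        _ ≤ ENNReal.ofReal (1 - ε * s)⁻¹
            * (ENNReal.ofReal (rateConst d (s * σ / η) (x₀ - j * η) (x₀ - (j + 1) * η))
              * (ENNReal.ofReal (((1 - ε * s)⁻¹) ^ j * rateConst d (s * σ / η) x₀ (x₀ - j * η))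
                * eLpNorm φ (ENNReal.ofReal x₀⁻¹) volume)) := by
            gcongr
            exact h2.trans (by gcongr)
        _ = _ := by
            rw [← mul_assoc, ← mul_assoc, ← ENNReal.ofReal_mul (by positivity),
              ← ENNReal.ofReal_mul (by positivity)]
            congr 2
            rw [← rateConst_mul hρ (by nlinarith : 0 < x₀) hx₀ hxj hxj1 hj (by linarith), pow_succ]
            ring
    · have h1 := herr t ht0 (by rw [hts]; have : 0 ≤ j * s := by positivity
                                linarith) χ Kj B cχ bχ hKj0 lχ
      rw [hts] at h1
      have h2 : Kj ≤ K * (1 + s * L) ^ (j + 1) := by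
        rw [hKj]
        refine mul_le_mul_of_nonneg_left (pow_le_pow_right₀ ?_ (Nat.le_succ j)) hK
        have : 0 ≤ s * L := by positivity
        linarith
      have h3 : Kj * s * ε ≤ K * (1 + s * L) ^ (j + 1) * s * ε := by gcongr
      have h4 := abs_sub_le (∫ x, φ x * μ T x) (∫ x, χ x * μ (T - j * s) x)
        (∫ x, heatFlow (s * σ) χ (x + s • u t x) * μ t x)
      have h5 : (j : ℝ) * (Kj * s * ε) ≤ j * (K * (1 + s * L) ^ (j + 1) * s * ε) := by gcongr
      linarith

lemma ofReal_abs_integral_mul_le {f m : E → ℝ} {y : ℝ} (hy : 0 < y) (hy1 : y < 1)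
    (hf : AEStronglyMeasurable f) (hm : AEStronglyMeasurable m) :
    ENNReal.ofReal |∫ x, f x * m x|
      ≤ eLpNorm f (ENNReal.ofReal y⁻¹) volume * eLpNorm m (ENNReal.ofReal (1 - y)⁻¹) volume := by
  have hyy : 0 < 1 - y := by linarith
  have hH : ENNReal.HolderTriple (ENNReal.ofReal y⁻¹) (ENNReal.ofReal (1 - y)⁻¹) 1 := by
    constructor
    rw [← ENNReal.ofReal_inv_of_pos (by positivity), ← ENNReal.ofReal_inv_of_pos (by positivity),
      inv_inv, inv_inv, ← ENNReal.ofReal_add hy.le hyy.le]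
    simp
  calc ENNReal.ofReal |∫ x, f x * m x| = ‖∫ x, f x * m x‖ₑ := by rw [Real.enorm_eq_ofReal_abs]
    _ ≤ ∫⁻ x, ‖f x * m x‖ₑ := enorm_integral_le_lintegral_enorm _
    _ = eLpNorm (f • m) 1 volume := by rw [eLpNorm_one_eq_lintegral_enorm]; rfl
    _ ≤ _ := eLpNorm_smul_le_mul_eLpNorm hm hf

/-- The smoothing estimate in dual form: it holds with the same constant as for the heat flow. -/
theorem IsAdvectionDiffusion.ofReal_abs_integral_le (h : IsAdvectionDiffusion σ T A U L μ u)
    (hT : 0 < T) (hσ : 0 < σ) (hU : 0 ≤ U) (hL : 0 ≤ L) {φ : E → ℝ} {K B : ℝ}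
    (hφ : Continuous φ) (hB : ∀ x, |φ x| ≤ B) (hK : 0 ≤ K)
    (hφK : ∀ x y, |φ x - φ y| ≤ K * ‖x - y‖) {x₀ x₁ : ℝ} (h₁ : 0 < x₁) (h₁₀ : x₁ < x₀)
    (h₀ : x₀ < 1) :
    ENNReal.ofReal |∫ x, φ x * μ T x| ≤ ENNReal.ofReal (smoothingConst d x₀ x₁ (T * σ))
      * (eLpNorm φ (ENNReal.ofReal x₀⁻¹) volume
        * eLpNorm (μ 0) (ENNReal.ofReal (1 - x₁)⁻¹) volume) := by
  have hCpos := smoothingConst_pos (d := d) h₁ h₁₀ h₀ (mul_pos hT hσ)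
  set C := smoothingConst d x₀ x₁ (T * σ) with hC
  set X := eLpNorm φ (ENNReal.ofReal x₀⁻¹) volume
    * eLpNorm (μ 0) (ENNReal.ofReal (1 - x₁)⁻¹) volume with hX
  have key : ∀ ε : ℝ, 0 < ε → ENNReal.ofReal |∫ x, φ x * μ T x|
      ≤ ENNReal.ofReal (Real.exp (2 * ε * T) * C) * X
        + ENNReal.ofReal (T * K * Real.exp (L * T) * ε) := by
    intro ε hε
    -- `n` equal steps of length `s`, the reciprocal exponent decreasing by `η` in each of them
    obtain ⟨a₁, ha₁, H₁⟩ := h.exists_step_error_le hσ hU hε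
    obtain ⟨a₂, ha₂, H₂⟩ := exists_det_ge (d := d) L ε hε
    set a := min (min a₁ a₂) (min (1 / (2 * (L + 1))) (1 / (2 * ε))) with ha
    have ha0 : 0 < a := by positivity
    obtain ⟨n, hn⟩ := exists_nat_ge (T / a)
    have hn0 : (0 : ℝ) < n := (div_pos hT ha0).trans_le hn
    set s := T / n with hs
    have hs0 : 0 < s := by positivity
    have hns : n * s = T := by rw [hs]; field_simp
    have hsa : s ≤ a := by
      rw [hs, div_le_iff₀ hn0]
      rwa [div_le_iff₀ ha0, mul_comm] at hn
    have hs1 : s ≤ a₁ := hsa.trans ((min_le_left _ _).trans (min_le_left _ _))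
    have hs2 : s ≤ a₂ := hsa.trans ((min_le_left _ _).trans (min_le_right _ _))
    have hs3 : s ≤ 1 / (2 * (L + 1)) := hsa.trans ((min_le_right _ _).trans (min_le_left _ _))
    have hs4 : s ≤ 1 / (2 * ε) := hsa.trans ((min_le_right _ _).trans (min_le_right _ _))
    have hsL : s * L < 1 := by
      rw [le_div_iff₀ (by positivity)] at hs3
      nlinarith
    have hεs : ε * s ≤ 1 / 2 := by
      rw [le_div_iff₀ (by positivity)] at hs4
      linarith
    set η := (x₀ - x₁) / n with hη
    have hη0 : 0 < η := div_pos (sub_pos.2 h₁₀) hn0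
    have hnη : x₀ - n * η = x₁ := by rw [hη]; field_simp; ring
    obtain ⟨χ, cχ, bχ, lχ, nχ, eχ⟩ := h.exists_dual hσ hL hε hs0 hsL (by linarith)
      (fun t ht hts χ K B => H₁ t s ht hs0 hs1 hts χ K B)
      (fun D hD hDt => H₂ D s hD hDt hs0 hs2) hφ hB hK hφK h₀ hη0 n hns.le (by rw [hnη]; exact h₁)
    rw [hnη] at nχ
    rw [hns, sub_self] at eχ
    have hρ : s * σ / η = T * σ / (x₀ - x₁) := by
      rw [hs, hη]; field_simp
    rw [hρ, ← smoothingConst_eq_rateConst, ← hC] at nχ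
    have g1 : ((1 - ε * s)⁻¹) ^ n ≤ Real.exp (2 * ε * T) := by
      have g2 : (1 - ε * s)⁻¹ ≤ Real.exp (2 * (ε * s)) := by
        rw [inv_le_comm₀ (by linarith) (Real.exp_pos _), ← Real.exp_neg]
        have hp : 0 < ε * s := mul_pos hε hs0
        have g3 := Real.add_one_le_exp (2 * (ε * s))
        rw [Real.exp_neg, inv_le_comm₀ (Real.exp_pos _) (by linarith)]
        refine le_trans ?_ g3
        rw [inv_le_comm₀ (by linarith) (by linarith), inv_eq_one_div, div_le_iff₀ (by linarith)]
        nlinarith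
      calc ((1 - ε * s)⁻¹) ^ n ≤ Real.exp (2 * (ε * s)) ^ n :=
            pow_le_pow_left₀ (inv_nonneg.2 (by linarith)) g2 n
        _ = Real.exp (2 * ε * T) := by rw [← Real.exp_nat_mul, ← hns]; congr 1; ring
    have g4 : (1 + s * L) ^ n ≤ Real.exp (L * T) := by
      calc (1 + s * L) ^ n ≤ Real.exp (s * L) ^ n := by
            refine pow_le_pow_left₀ (by positivity) ?_ n
            linarith [Real.add_one_le_exp (s * L)]
        _ = Real.exp (L * T) := by rw [← Real.exp_nat_mul, ← hns]; congr 1; ring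
    have g5 : n * (K * (1 + s * L) ^ n * s * ε) ≤ T * K * Real.exp (L * T) * ε := by
      calc n * (K * (1 + s * L) ^ n * s * ε) = T * K * (1 + s * L) ^ n * ε := by
            rw [← hns]; ring
        _ ≤ _ := by gcongr
    have g6 : |∫ x, φ x * μ T x| ≤ |∫ x, χ x * μ 0 x| + T * K * Real.exp (L * T) * ε := by
      have := abs_sub_abs_le_abs_sub (∫ x, φ x * μ T x) (∫ x, χ x * μ 0 x)
      linarith
    calc ENNReal.ofReal |∫ x, φ x * μ T x|
        ≤ ENNReal.ofReal |∫ x, χ x * μ 0 x| + ENNReal.ofReal (T * K * Real.exp (L * T) * ε) := by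
          rw [← ENNReal.ofReal_add (abs_nonneg _) (by positivity)]
          exact ENNReal.ofReal_le_ofReal g6
      _ ≤ ENNReal.ofReal (Real.exp (2 * ε * T) * C) * X
          + ENNReal.ofReal (T * K * Real.exp (L * T) * ε) := by
          gcongr
          refine (ofReal_abs_integral_mul_le h₁ (h₁₀.trans h₀) cχ.aestronglyMeasurable
            (h.integrable 0 ⟨le_rfl, hT.le⟩).aestronglyMeasurable).trans ?_
          rw [hX, ← mul_assoc]
          gcongr
          refine nχ.trans ?_
          gcongr
  have hl1 : Tendsto (fun ε : ℝ => ENNReal.ofReal (Real.exp (2 * ε * T) * C) * X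
      + ENNReal.ofReal (T * K * Real.exp (L * T) * ε)) (𝓝[>] 0) (𝓝 (ENNReal.ofReal C * X)) := by
    have c1 : Tendsto (fun ε : ℝ => ENNReal.ofReal (Real.exp (2 * ε * T) * C)) (𝓝[>] 0)
        (𝓝 (ENNReal.ofReal C)) := by
      have : Continuous fun ε : ℝ => ENNReal.ofReal (Real.exp (2 * ε * T) * C) :=
        ENNReal.continuous_ofReal.comp (by fun_prop)
      exact (this.tendsto' 0 _ (by simp)).mono_left nhdsWithin_le_nhds
    have c2 : Tendsto (fun ε : ℝ => ENNReal.ofReal (T * K * Real.exp (L * T) * ε)) (𝓝[>] 0)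
        (𝓝 0) := by
      have : Continuous fun ε : ℝ => ENNReal.ofReal (T * K * Real.exp (L * T) * ε) :=
        ENNReal.continuous_ofReal.comp (by fun_prop)
      exact (this.tendsto' 0 _ (by simp)).mono_left nhdsWithin_le_nhds
    simpa using (ENNReal.Tendsto.mul_const c1 (Or.inl (by simpa using hCpos))).add c2
  refine ge_of_tendsto hl1 ?_
  filter_upwards [self_mem_nhdsWithin] with ε hε
  exact key ε hε

end Dual

/-! ### Duality and dependence of the norms on the exponent -/

section Norms

variable {f : EuclideanSpace ℝ (Fin d) → ℝ} {B y : ℝ}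

lemma integrable_abs_rpow {s : ℝ} (hs : 1 ≤ s) (hf : Integrable f) (hB : ∀ᵐ x, |f x| ≤ B) :
    Integrable fun x => |f x| ^ s := by
  have hm : AEStronglyMeasurable (fun x => |f x| ^ s) :=
    (hf.aestronglyMeasurable.norm.aemeasurable.pow_const s).aestronglyMeasurable
  refine (hf.abs.const_mul (B ^ (s - 1))).mono' hm ?_
  filter_upwards [hB] with x hx
  rw [Real.norm_of_nonneg (by positivity)]
  rcases (abs_nonneg (f x)).eq_or_lt with h | h
  · rw [← h, Real.zero_rpow (by linarith), mul_zero]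
  · calc |f x| ^ s = |f x| ^ (s - 1) * |f x| := by
          rw [← Real.rpow_add_one h.ne']; congr 1; ring
      _ ≤ _ := by gcongr

lemma eLpNorm_inv_ofReal (hy : 0 < y) (hy1 : y ≤ 1) (hf : Integrable f)
    (hB : ∀ᵐ x, |f x| ≤ B) :
    eLpNorm f (ENNReal.ofReal y)⁻¹ volume = ENNReal.ofReal ((∫ x, |f x| ^ y⁻¹) ^ y) := by
  rw [← ENNReal.ofReal_inv_of_pos hy, eLpNorm_ofReal_inv hy,
    ← ofReal_integral_eq_lintegral_ofReal (integrable_abs_rpow (one_le_inv_iff₀.2 ⟨hy, hy1⟩) hf hB)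
      (.of_forall fun x => by positivity),
    ENNReal.ofReal_rpow_of_nonneg (integral_nonneg fun x => by positivity) hy.le]

/-- The converse of Hölder's inequality, tested on bounded Lipschitz functions only. -/
lemma eLpNorm_le_of_forall_lipschitz (hf : Integrable f) (hB : ∀ᵐ x, |f x| ≤ B) (hy : 0 < y)
    (hy1 : y < 1) {C : ℝ≥0∞}
    (h : ∀ (φ : E → ℝ) (K A : ℝ), Continuous φ → (∀ x, |φ x| ≤ A) → 0 ≤ K →
      (∀ x z, |φ x - φ z| ≤ K * ‖x - z‖) →
      ENNReal.ofReal |∫ x, φ x * f x| ≤ C * eLpNorm φ (ENNReal.ofReal y⁻¹) volume) :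
    eLpNorm f (ENNReal.ofReal (1 - y)⁻¹) volume ≤ C := by
  rcases eq_or_ne C ⊤ with rfl | hC
  · exact le_top
  have hyy : 0 < 1 - y := by linarith
  set s := (1 - y)⁻¹ with hs
  have hs1 : 1 < s := (one_lt_inv₀ hyy).2 (by linarith)
  have hsi : Integrable fun x => |f x| ^ s := integrable_abs_rpow hs1.le hf hB
  set I := ∫ x, |f x| ^ s with hI
  have hI0 : 0 ≤ I := integral_nonneg fun x => by positivity
  have hnf : eLpNorm f (ENNReal.ofReal s) volume = ENNReal.ofReal (I ^ (1 - y)) := by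
    rw [hs, ENNReal.ofReal_inv_of_pos hyy, eLpNorm_inv_ofReal hyy (by linarith) hf hB]
  -- the extremal function of Hölder's inequality
  set w : E → ℝ := fun x => |f x| ^ (s - 2) * f x with hw
  have hwm : AEStronglyMeasurable w :=
    ((hf.aestronglyMeasurable.norm.aemeasurable.pow_const (s - 2)).mul
      hf.aemeasurable).aestronglyMeasurable
  have hwa : ∀ x, |w x| ^ y⁻¹ = |f x| ^ s := fun x => by
    rcases (abs_nonneg (f x)).eq_or_lt with h0 | h0
    · rw [hw]
      simp only [abs_mul, ← h0, mul_zero]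
      rw [Real.zero_rpow (by positivity), Real.zero_rpow (by linarith)]
    · simp only [hw, abs_mul, abs_of_nonneg (Real.rpow_nonneg (abs_nonneg (f x)) _)]
      rw [← Real.rpow_add_one h0.ne', ← Real.rpow_mul h0.le]
      congr 1
      rw [hs]
      field_simp
      ring
  have hwf : ∀ x, w x * f x = |f x| ^ s := fun x => by
    rcases (abs_nonneg (f x)).eq_or_lt with h0 | h0
    · rw [← h0, abs_eq_zero.1 h0.symm, mul_zero, Real.zero_rpow (by linarith)]
    · calc |f x| ^ (s - 2) * f x * f x = |f x| ^ (s - 2) * |f x| ^ (2 : ℝ) := by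
            rw [mul_assoc, Real.rpow_two, sq_abs, sq]
        _ = _ := by rw [← Real.rpow_add h0]; congr 1; ring
  have hnw : eLpNorm w (ENNReal.ofReal y⁻¹) volume = ENNReal.ofReal (I ^ y) := by
    rw [eLpNorm_ofReal_inv hy]
    simp_rw [hwa]
    rw [← ofReal_integral_eq_lintegral_ofReal hsi (.of_forall fun x => by positivity),
      ENNReal.ofReal_rpow_of_nonneg hI0 hy.le]
  have hwL : MemLp w (ENNReal.ofReal y⁻¹) volume := ⟨hwm, by rw [hnw]; exact ENNReal.ofReal_lt_top⟩
  have hy1' : (1 : ℝ≥0∞) ≤ ENNReal.ofReal y⁻¹ := by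
    rw [ENNReal.one_le_ofReal]; exact (one_lt_inv₀ hy).2 hy1 |>.le
  have hwfi : Integrable fun x => w x * f x := by simpa only [hwf] using hsi
  have key : ∀ ε : ℝ, 0 < ε → ENNReal.ofReal I
      ≤ C * (ENNReal.ofReal (I ^ y) + ENNReal.ofReal ε)
        + ENNReal.ofReal ε * ENNReal.ofReal (I ^ (1 - y)) := by
    intro ε hε
    obtain ⟨φ, hφc, hφs, hφ⟩ := hwL.exist_eLpNorm_sub_le ENNReal.ofReal_ne_top hy1' hε
    obtain ⟨K, hK⟩ := hφs.lipschitzWith_of_hasCompactSupport hφc (by simp)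
    obtain ⟨A, hA⟩ := hφc.exists_bound_of_continuous hφs.continuous
    have hφf : Integrable fun x => φ x * f x :=
      hf.bdd_mul (c := A) hφs.continuous.aestronglyMeasurable (.of_forall hA)
    have h1 := h φ K A hφs.continuous hA K.2 fun x z => by
      simpa [Real.dist_eq, dist_eq_norm] using hK.dist_le_mul x z
    have h2 := ofReal_abs_integral_mul_le hy hy1 (hwm.sub hφs.continuous.aestronglyMeasurable)
      hf.aestronglyMeasurable
    rw [← hs, hnf] at h2
    have h3 : eLpNorm φ (ENNReal.ofReal y⁻¹) volume ≤ ENNReal.ofReal (I ^ y) + ENNReal.ofReal ε := by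
      calc eLpNorm φ (ENNReal.ofReal y⁻¹) volume = eLpNorm (w - (w - φ)) _ volume := by simp
        _ ≤ _ := eLpNorm_sub_le hwm (hwm.sub hφs.continuous.aestronglyMeasurable) hy1'
        _ ≤ _ := by rw [hnw]; gcongr
    have h4 : I = (∫ x, φ x * f x) + ∫ x, (w - φ) x * f x := by
      rw [← integral_add hφf]
      · rw [hI]
        refine integral_congr_ae (.of_forall fun x => ?_)
        simp only [Pi.sub_apply, ← hwf]
        ring
      · refine (hwfi.sub hφf).congr (.of_forall fun x => ?_)
        simp only [Pi.sub_apply]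
        ring
    calc ENNReal.ofReal I ≤ ENNReal.ofReal (|∫ x, φ x * f x| + |∫ x, (w - φ) x * f x|) := by
          refine ENNReal.ofReal_le_ofReal ?_
          nth_rewrite 1 [h4]
          exact add_le_add (le_abs_self _) (le_abs_self _)
      _ ≤ _ := by
          rw [ENNReal.ofReal_add (abs_nonneg _) (abs_nonneg _)]
          gcongr
          · exact h1.trans (by gcongr)
          · exact h2.trans (by gcongr)
  have hlim : Tendsto (fun ε : ℝ => C * (ENNReal.ofReal (I ^ y) + ENNReal.ofReal ε)
      + ENNReal.ofReal ε * ENNReal.ofReal (I ^ (1 - y))) (𝓝[>] 0)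
      (𝓝 (C * ENNReal.ofReal (I ^ y))) := by
    have c0 : Tendsto (fun ε : ℝ => ENNReal.ofReal ε) (𝓝[>] 0) (𝓝 0) :=
      (ENNReal.continuous_ofReal.tendsto' 0 _ (by simp)).mono_left nhdsWithin_le_nhds
    have c1 := (ENNReal.Tendsto.const_mul (tendsto_const_nhds (x := ENNReal.ofReal (I ^ y)) |>.add c0)
      (Or.inr hC)).add (ENNReal.Tendsto.mul_const c0
        (b := ENNReal.ofReal (I ^ (1 - y))) (Or.inr ENNReal.ofReal_ne_top))
    simpa using c1
  have hle : ENNReal.ofReal I ≤ C * ENNReal.ofReal (I ^ y) :=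
    ge_of_tendsto hlim (by filter_upwards [self_mem_nhdsWithin] with ε hε using key ε hε)
  rw [hnf]
  rcases hI0.eq_or_lt with h0 | h0
  · rw [← h0, Real.zero_rpow hyy.ne']; simp
  · have h5 : I = I ^ (1 - y) * I ^ y := by
      rw [← Real.rpow_add h0]; simp
    nth_rewrite 1 [h5] at hle
    rw [ENNReal.ofReal_mul (by positivity)] at hle
    exact (ENNReal.mul_le_mul_iff_left (by simp; positivity) ENNReal.ofReal_ne_top).1 hle

lemma tendsto_rpow_const_nhds_zero {m : ℝ} (hm : 0 < m) :
    Tendsto (fun r : ℝ => m ^ r) (𝓝[Ioo 0 1] 0) (𝓝 1) := by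
  have := (Real.continuous_const_rpow hm.ne').tendsto 0
  rw [Real.rpow_zero] at this
  exact this.mono_left nhdsWithin_le_nhds

/-- The norms of an integrable and bounded function depend continuously on the reciprocal of the
exponent, down to the essential supremum at `0`. -/
lemma tendsto_eLpNorm_inv_ofReal (hf : Integrable f) (hB : ∀ᵐ x, |f x| ≤ B) (hy : 0 ≤ y)
    (hy1 : y ≤ 1) :
    Tendsto (fun r : ℝ => eLpNorm f (ENNReal.ofReal r)⁻¹ volume) (𝓝[Ioo 0 1] y)
      (𝓝 (eLpNorm f (ENNReal.ofReal y)⁻¹ volume)) := by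
  have hev : (fun r : ℝ => ENNReal.ofReal ((∫ x, |f x| ^ r⁻¹) ^ r)) =ᶠ[𝓝[Ioo 0 1] y]
      fun r : ℝ => eLpNorm f (ENNReal.ofReal r)⁻¹ volume := by
    filter_upwards [self_mem_nhdsWithin] with r hr
    rw [eLpNorm_inv_ofReal hr.1 hr.2.le hf hB]
  refine Tendsto.congr' hev ?_
  rcases hy.eq_or_lt with rfl | hy
  · rw [ENNReal.ofReal_zero, ENNReal.inv_zero]
    by_cases h0 : f =ᵐ[volume] 0
    · have e : ∀ r ∈ Ioo (0 : ℝ) 1, ENNReal.ofReal ((∫ x, |f x| ^ r⁻¹) ^ r) = 0 := fun r hr => by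
        have : ∫ x, |f x| ^ r⁻¹ = 0 := by
          rw [← integral_zero (α := E) (G := ℝ) (μ := volume)]
          refine integral_congr_ae ?_
          filter_upwards [h0] with x hx
          rw [hx, Pi.zero_apply, abs_zero, Real.zero_rpow (inv_pos.2 hr.1).ne']
        rw [this, Real.zero_rpow hr.1.ne', ENNReal.ofReal_zero]
      rw [eLpNorm_congr_ae h0, eLpNorm_zero]
      refine tendsto_const_nhds.congr' ?_
      filter_upwards [self_mem_nhdsWithin] with r hr using (e r hr).symm
    have hfin : eLpNorm f ⊤ volume ≠ ⊤ :=
      ((memLp_top_of_bound hf.aestronglyMeasurable B hB).2).ne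
    have hne : eLpNorm f ⊤ volume ≠ 0 := fun h =>
      h0 ((eLpNorm_eq_zero_iff hf.aestronglyMeasurable (by simp)).1 h)
    obtain ⟨M, hM0, hM⟩ : ∃ M : ℝ, 0 < M ∧ eLpNorm f ⊤ volume = ENNReal.ofReal M :=
      ⟨_, ENNReal.toReal_pos hne hfin, (ENNReal.ofReal_toReal hfin).symm⟩
    have hfM : ∀ᵐ x, |f x| ≤ M := by
      filter_upwards [ae_le_eLpNormEssSup (f := f) (μ := volume)] with x hx
      rw [← eLpNorm_exponent_top, hM, Real.enorm_eq_ofReal_abs] at hx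
      exact (ENNReal.ofReal_le_ofReal_iff hM0.le).1 hx
    have hI0 : 0 < ∫ x, |f x| := by
      rw [integral_pos_iff_support_of_nonneg (fun x => abs_nonneg _) hf.abs, pos_iff_ne_zero]
      intro h
      refine h0 ?_
      rw [Filter.EventuallyEq, ae_iff]
      rw [← h]
      congr 1
      ext x
      simp
    rw [hM]
    refine ENNReal.tendsto_ofReal (tendsto_order.2 ⟨fun a ha => ?_, fun b hb => ?_⟩)
    -- from below: the Chebyshev inequality on a superlevel set, of positive and finite measure
    · obtain ⟨c, hc, hcM⟩ := exists_between (max_lt ha hM0)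
      have hc0 : 0 < c := (le_max_right _ _).trans_lt hc
      have hac : a < c := (le_max_left _ _).trans_lt hc
      have hmt : volume {x | c ≤ |f x|} ≠ ⊤ := (hf.measure_norm_ge_lt_top hc0).ne
      have hm0 : volume {x | c ≤ |f x|} ≠ 0 := fun h => by
        have h1 : eLpNorm f ⊤ volume ≤ ENNReal.ofReal c := by
          rw [eLpNorm_exponent_top]
          refine eLpNormEssSup_le_of_ae_bound ?_
          have : ∀ᵐ x, ¬ c ≤ |f x| := by rw [ae_iff]; simpa using h
          filter_upwards [this] with x hx using (not_le.1 hx).le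
        rw [hM] at h1
        exact absurd ((ENNReal.ofReal_le_ofReal_iff hc0.le).1 h1) (not_le.2 hcM)
      set m := volume.real {x | c ≤ |f x|} with hm
      have hmp : 0 < m := ENNReal.toReal_pos hm0 hmt
      have hl := (tendsto_rpow_const_nhds_zero hmp).const_mul c
      rw [mul_one] at hl
      filter_upwards [hl.eventually_const_lt hac, self_mem_nhdsWithin] with r hr hr0
      refine hr.trans_le ?_
      have h1 := mul_meas_ge_le_integral_of_nonneg (μ := (volume : Measure E))
        (.of_forall fun x => by positivity)
        (integrable_abs_rpow (one_le_inv_iff₀.2 ⟨hr0.1, hr0.2.le⟩) hf hB) (c ^ r⁻¹)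
      have h2 : {x | c ^ r⁻¹ ≤ |f x| ^ r⁻¹} = {x | c ≤ |f x|} := by
        ext x
        exact Real.rpow_le_rpow_iff hc0.le (abs_nonneg _) (inv_pos.2 hr0.1)
      rw [h2, ← hm] at h1
      calc c * m ^ r = (c ^ r⁻¹ * m) ^ r := by
            rw [Real.mul_rpow (by positivity) hmp.le, ← Real.rpow_mul hc0.le,
              inv_mul_cancel₀ hr0.1.ne', Real.rpow_one]
        _ ≤ _ := Real.rpow_le_rpow (by positivity) h1 hr0.1.le
    -- from above: `|f| ^ r⁻¹ ≤ M ^ (r⁻¹ - 1) |f|`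
    · have hl := (tendsto_rpow_const_nhds_zero (div_pos hI0 hM0)).const_mul M
      rw [mul_one] at hl
      filter_upwards [hl.eventually_lt_const hb, self_mem_nhdsWithin] with r hr hr0
      refine lt_of_le_of_lt ?_ hr
      have hr1 : 1 ≤ r⁻¹ := one_le_inv_iff₀.2 ⟨hr0.1, hr0.2.le⟩
      have h1 : ∫ x, |f x| ^ r⁻¹ ≤ M ^ r⁻¹ * ((∫ x, |f x|) / M) := by
        rw [show M ^ r⁻¹ * ((∫ x, |f x|) / M) = ∫ x, (M ^ r⁻¹ / M) * |f x| by
          rw [integral_const_mul]; ring]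
        refine integral_mono_ae (integrable_abs_rpow hr1 hf hB) (hf.abs.const_mul _) ?_
        filter_upwards [hfM] with x hx
        rcases (abs_nonneg (f x)).eq_or_lt with h | h
        · simp only [← h, mul_zero]
          rw [Real.zero_rpow (by linarith)]
        · calc |f x| ^ r⁻¹ = |f x| ^ (r⁻¹ - 1) * |f x| := by
                rw [← Real.rpow_add_one h.ne']; congr 1; ring
            _ ≤ M ^ (r⁻¹ - 1) * |f x| := by gcongr
            _ = _ := by rw [Real.rpow_sub_one hM0.ne']
      calc (∫ x, |f x| ^ r⁻¹) ^ r ≤ (M ^ r⁻¹ * ((∫ x, |f x|) / M)) ^ r :=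
            Real.rpow_le_rpow (integral_nonneg fun x => by positivity) h1 hr0.1.le
        _ = _ := by
            rw [Real.mul_rpow (by positivity) (by positivity), ← Real.rpow_mul hM0.le,
              inv_mul_cancel₀ hr0.1.ne', Real.rpow_one]
  · rw [eLpNorm_inv_ofReal hy hy1 hf hB]
    refine ENNReal.tendsto_ofReal (Tendsto.rpow ?_ (tendsto_id.mono_left nhdsWithin_le_nhds)
      (Or.inr hy))
    have hB0 : 0 ≤ max B 1 := by positivity
    refine tendsto_integral_filter_of_dominated_convergence
      (fun x => max B 1 ^ (2 * y⁻¹) * |f x|) (.of_forall fun r =>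
        (hf.aestronglyMeasurable.norm.aemeasurable.pow_const _).aestronglyMeasurable) ?_
      (hf.abs.const_mul _) (.of_forall fun x => ?_)
    · have h1 : ∀ᶠ r in 𝓝[Ioo 0 1] y, y / 2 < r :=
        nhdsWithin_le_nhds (lt_mem_nhds (by linarith))
      filter_upwards [h1, self_mem_nhdsWithin] with r hr hr0
      filter_upwards [hB] with x hx
      rw [Real.norm_of_nonneg (by positivity)]
      have hr1 : 1 ≤ r⁻¹ := one_le_inv_iff₀.2 ⟨hr0.1, hr0.2.le⟩
      have hr2 : r⁻¹ ≤ 2 * y⁻¹ := by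
        rw [inv_le_comm₀ hr0.1 (by positivity), mul_inv, inv_inv]; linarith
      rcases (abs_nonneg (f x)).eq_or_lt with h | h
      · rw [← h, Real.zero_rpow (by linarith), mul_zero]
      · calc |f x| ^ r⁻¹ = |f x| ^ (r⁻¹ - 1) * |f x| := by
              rw [← Real.rpow_add_one h.ne']; congr 1; ring
          _ ≤ max B 1 ^ (r⁻¹ - 1) * |f x| := by
              gcongr
              · exact hx.trans (le_max_left _ _)
          _ ≤ _ := by
              gcongr
              · exact le_max_right _ _
              · linarith
    · have h1 : Tendsto (fun r : ℝ => r⁻¹) (𝓝[Ioo 0 1] y) (𝓝 y⁻¹) :=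
        (tendsto_inv₀ hy.ne').mono_left nhdsWithin_le_nhds
      exact tendsto_const_nhds.rpow h1 (Or.inr (inv_pos.2 hy))

end Norms

/-! ### The smoothing estimate for all exponents -/

/-- With `∞^0 = 1`, this includes `r = 1` and `r = ∞`, where both sides are `1` because `0^0 = 1`. -/
lemma K_eq_conjRatio {r : ℝ≥0∞} (hr : 1 ≤ r) : K r = conjRatio (1 / r).toReal := by
  have hr1 : r⁻¹ ≤ 1 := ENNReal.inv_le_one.2 hr
  have hrt : r⁻¹ ≠ ⊤ := (hr1.trans_lt ENNReal.one_lt_top).ne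
  set t := r⁻¹.toReal with ht
  have ht0 : 0 ≤ t := ENNReal.toReal_nonneg
  have ht1 : 0 ≤ 1 - t := by
    have := ENNReal.toReal_mono ENNReal.one_ne_top hr1
    rw [ENNReal.toReal_one] at this
    linarith
  have e1 : r⁻¹ = ENNReal.ofReal t := (ENNReal.ofReal_toReal hrt).symm
  have e2 : r.conjExponent⁻¹ = ENNReal.ofReal (1 - t) := by
    have h1 : r⁻¹ + r.conjExponent⁻¹ = 1 :=
      (ENNReal.HolderConjugate.conjExponent hr).inv_add_inv_eq_one
    rw [e1] at h1
    rw [ENNReal.ofReal_sub _ ht0, ENNReal.ofReal_one]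
    exact ENNReal.eq_sub_of_add_eq' ENNReal.one_ne_top (by rw [add_comm]; exact h1)
  have e3 : ∀ (a : ℝ≥0∞) (x : ℝ), 0 ≤ x → a⁻¹ = ENNReal.ofReal x →
      a ^ a⁻¹.toReal = (ENNReal.ofReal (x ^ x))⁻¹ := fun a x hx h => by
    rw [h, ENNReal.toReal_ofReal hx, ← ENNReal.ofReal_rpow_of_nonneg hx hx, ← h,
      ENNReal.inv_rpow, inv_inv]
  rw [K, e3 r t ht0 e1, e3 _ _ ht1 e2, one_div, ← ht, conjRatio, div_eq_mul_inv, inv_inv,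
    ENNReal.toReal_mul, ENNReal.toReal_inv, ENNReal.toReal_ofReal (Real.rpow_nonneg ht1 _),
    ENNReal.toReal_ofReal (Real.rpow_nonneg ht0 _), div_eq_mul_inv, mul_comm]

lemma rpow_self_eq_exp {t : ℝ} (ht : 0 ≤ t) : t ^ t = Real.exp (t * Real.log t) := by
  rcases ht.eq_or_lt with rfl | ht
  · simp
  · rw [Real.rpow_def_of_pos ht, mul_comm]

/-- An exponential form of the constant, whose continuity up to `y = 0`, `x = 1` and `x = y` is
manifest. -/
lemma smoothingConst_eq_exp {x y τ : ℝ} (hy : 0 ≤ y) (hyx : y ≤ x) (hx : x ≤ 1) (hτ : 0 < τ) :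
    smoothingConst d x y τ = Real.exp ((d : ℝ) / 2 *
      (y * Real.log y - (1 - y) * Real.log (1 - y)
        - (x * Real.log x - (1 - x) * Real.log (1 - x))
        - (x - y) * Real.log (4 * Real.pi * τ) + (x - y) * Real.log (x - y))) := by
  have h1 : (4 * Real.pi * τ / (x - y)) ^ (-((d : ℝ) / 2) * (x - y))
      = Real.exp (-((d : ℝ) / 2) *
        ((x - y) * Real.log (4 * Real.pi * τ) - (x - y) * Real.log (x - y))) := by
    rcases hyx.eq_or_lt with rfl | h
    · simp
    · have hk : 0 < x - y := by linarith
      rw [Real.rpow_def_of_pos (by positivity), Real.log_div (by positivity) hk.ne']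
      congr 1
      ring
  rw [smoothingConst, h1, conjRatio, conjRatio, rpow_self_eq_exp hy,
    rpow_self_eq_exp (by linarith : 0 ≤ 1 - y), rpow_self_eq_exp (by linarith : 0 ≤ x),
    rpow_self_eq_exp (by linarith : 0 ≤ 1 - x), ← Real.exp_sub, ← Real.exp_sub, ← Real.exp_sub,
    ← Real.exp_mul, ← Real.exp_add]
  congr 1
  ring

/-- The constant is invariant under passing to the conjugate exponents. -/
lemma smoothingConst_one_sub (x y τ : ℝ) :
    smoothingConst d (1 - y) (1 - x) τ = smoothingConst d x y τ := by
  rw [smoothingConst, smoothingConst, conjRatio_one_sub, conjRatio_one_sub, inv_div_inv,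
    show 1 - y - (1 - x) = x - y by ring]

/-- The smoothing estimate for `1 < p < q < ∞`, with `x = 1 / p` and `y = 1 / q`. -/
lemma IsAdvectionDiffusion.eLpNorm_le {σ T A U L B : ℝ} {μ : ℝ → E → ℝ} {u : ℝ → E → E}
    (h : IsAdvectionDiffusion σ T A U L μ u) (hT : 0 < T) (hσ : 0 < σ) (hU : 0 ≤ U)
    (hL : 0 ≤ L) (hB : ∀ᵐ x, |μ T x| ≤ B) {x y : ℝ} (hy : 0 < y) (hyx : y < x) (hx : x < 1) :
    eLpNorm (μ T) (ENNReal.ofReal y)⁻¹ volume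
      ≤ ENNReal.ofReal (smoothingConst d x y (T * σ))
        * eLpNorm (μ 0) (ENNReal.ofReal x)⁻¹ volume := by
  have hx0 : 0 < x := hy.trans hyx
  have h1 := eLpNorm_le_of_forall_lipschitz (y := 1 - y)
    (C := ENNReal.ofReal (smoothingConst d x y (T * σ))
      * eLpNorm (μ 0) (ENNReal.ofReal x)⁻¹ volume)
    (h.integrable T ⟨hT.le, le_rfl⟩) hB (by linarith) (by linarith) fun φ K A' hφ hφA hK hφK => by
      have h2 := h.ofReal_abs_integral_le hT hσ hU hL hφ hφA hK hφK (x₀ := 1 - y) (x₁ := 1 - x)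
        (by linarith) (by linarith) (by linarith)
      rw [smoothingConst_one_sub, sub_sub_cancel, ENNReal.ofReal_inv_of_pos hx0] at h2
      exact h2.trans (le_of_eq (by ring))
  rwa [sub_sub_cancel, ENNReal.ofReal_inv_of_pos hy] at h1

/-- The smoothing estimate for all exponents, as a limit of the one for `1 < p < q < ∞`. -/
lemma IsAdvectionDiffusion.eLpNorm_le_of_le {σ T A U L B : ℝ} {μ : ℝ → E → ℝ} {u : ℝ → E → E}
    (h : IsAdvectionDiffusion σ T A U L μ u) (hT : 0 < T) (hσ : 0 < σ) (hU : 0 ≤ U)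
    (hL : 0 ≤ L) (hB : ∀ t ∈ Icc 0 T, ∀ᵐ x, |μ t x| ≤ B) {x y : ℝ} (hy : 0 ≤ y) (hyx : y ≤ x)
    (hx : x ≤ 1) :
    eLpNorm (μ T) (ENNReal.ofReal y)⁻¹ volume
      ≤ ENNReal.ofReal (smoothingConst d x y (T * σ))
        * eLpNorm (μ 0) (ENNReal.ofReal x)⁻¹ volume := by
  have hT' : T ∈ Icc 0 T := ⟨hT.le, le_rfl⟩
  have h0' : (0 : ℝ) ∈ Icc 0 T := ⟨le_rfl, hT.le⟩
  have hτ : 0 < T * σ := mul_pos hT hσ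
  -- the pair `(x, y)` is approached from the interior along a segment
  set X : ℝ → ℝ := fun ε => (1 - ε) * x + 2 * ε / 3 with hX
  set Y : ℝ → ℝ := fun ε => (1 - ε) * y + ε / 3 with hY
  have hmem : ∀ ε ∈ Ioo (0 : ℝ) 1, 0 < Y ε ∧ Y ε < X ε ∧ X ε < 1 := fun ε hε => by
    have h1 : 0 ≤ (1 - ε) * y := mul_nonneg (by linarith [hε.2]) hy
    have h2 : (1 - ε) * y ≤ (1 - ε) * x := mul_le_mul_of_nonneg_left hyx (by linarith [hε.2])
    have h3 : (1 - ε) * x ≤ (1 - ε) * 1 := mul_le_mul_of_nonneg_left hx (by linarith [hε.2])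
    have h4 := hε.1
    simp only [hX, hY]
    refine ⟨by linarith, by linarith, by linarith⟩
  have hev : ∀ᶠ ε in 𝓝[>] (0 : ℝ), ε ∈ Ioo (0 : ℝ) 1 := Ioo_mem_nhdsGT one_pos
  have hXc : Tendsto X (𝓝[>] 0) (𝓝 x) :=
    ((by fun_prop : Continuous X).tendsto' 0 _ (by simp [hX])).mono_left nhdsWithin_le_nhds
  have hYc : Tendsto Y (𝓝[>] 0) (𝓝 y) :=
    ((by fun_prop : Continuous Y).tendsto' 0 _ (by simp [hY])).mono_left nhdsWithin_le_nhds
  have hX1 : Tendsto X (𝓝[>] 0) (𝓝[Ioo 0 1] x) := tendsto_nhdsWithin_iff.2 ⟨hXc, by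
    filter_upwards [hev] with ε hε
    exact ⟨(hmem ε hε).1.trans (hmem ε hε).2.1, (hmem ε hε).2.2⟩⟩
  have hY1 : Tendsto Y (𝓝[>] 0) (𝓝[Ioo 0 1] y) := tendsto_nhdsWithin_iff.2 ⟨hYc, by
    filter_upwards [hev] with ε hε
    exact ⟨(hmem ε hε).1, (hmem ε hε).2.1.trans (hmem ε hε).2.2⟩⟩
  have n1 := (tendsto_eLpNorm_inv_ofReal (h.integrable T hT') (hB T hT') hy (hyx.trans hx)).comp hY1
  have n2 := (tendsto_eLpNorm_inv_ofReal (h.integrable 0 h0') (hB 0 h0') (hy.trans hyx) hx).comp hX1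
  have hC : Tendsto (fun ε => smoothingConst d (X ε) (Y ε) (T * σ)) (𝓝[>] 0)
      (𝓝 (smoothingConst d x y (T * σ))) := by
    rw [smoothingConst_eq_exp hy hyx hx hτ]
    have hml : ∀ {Z : ℝ → ℝ} {z : ℝ}, Tendsto Z (𝓝[>] 0) (𝓝 z) →
        Tendsto (fun ε => Z ε * Real.log (Z ε)) (𝓝[>] 0) (𝓝 (z * Real.log z)) := fun {Z z} hZ =>
      (Real.continuous_mul_log.tendsto z).comp hZ
    have hX' := hXc.const_sub 1
    have hY' := hYc.const_sub 1
    have hXY := hXc.sub hYc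
    have := (Real.continuous_exp.tendsto _).comp (((((hml hYc).sub (hml hY')).sub
      ((hml hXc).sub (hml hX'))).sub (hXY.mul_const (Real.log (4 * Real.pi * (T * σ))))
      |>.add (hml hXY)).const_mul ((d : ℝ) / 2))
    refine this.congr' ?_
    filter_upwards [hev] with ε hε
    obtain ⟨h1, h2, h3⟩ := hmem ε hε
    rw [smoothingConst_eq_exp h1.le h2.le h3.le hτ]
    rfl
  have hCp : 0 < smoothingConst d x y (T * σ) := by
    rw [smoothingConst_eq_exp hy hyx hx hτ]
    exact Real.exp_pos _
  refine le_of_tendsto_of_tendsto n1 (ENNReal.Tendsto.mul (ENNReal.tendsto_ofReal hC)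
    (Or.inl (by simpa using hCp)) n2 (Or.inr ENNReal.ofReal_ne_top)) ?_
  filter_upwards [hev] with ε hε
  obtain ⟨h1, h2, h3⟩ := hmem ε hε
  exact h.eLpNorm_le hT hσ hU hL (hB T hT') h1 h2 h3

end MeanField
end

theorem proposition3p2 (d : ℕ) (hd : 3 ≤ d) (s : ℝ) (hs : 0 ≤ s) (hsd : s < d - 2)
    (σ : ℝ) (hσ : 0 < σ)
    (M : Matrix (Fin d) (Fin d) ℝ) (g : EuclideanSpace ℝ (Fin d) → ℝ)
    (hg : MeanField.IsRieszType s g)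
    (hMg : ∀ x, x ≠ 0 → 0 ≤ MeanField.frobeniusHessian M g x)
    (μ : ℝ → EuclideanSpace ℝ (Fin d) → ℝ)
    (hμ : MeanField.IsMildSolution M g σ μ)
    (hpos : (∃ x, x ≠ 0 ∧ MeanField.frobeniusHessian M g x ≠ 0) →
      ∀ t, 0 ≤ t → 0 ≤ᵐ[volume] μ t)
    (p q : ℝ≥0∞) (hp : 1 ≤ p) (hpq : p ≤ q) (t : ℝ) (ht : 0 < t) :
    eLpNorm (μ t) q volume ≤
      ENNReal.ofReal
        ((MeanField.K q / MeanField.K p) ^ ((d : ℝ) / 2) *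
          (4 * Real.pi * σ * t / ((1 / p).toReal - (1 / q).toReal)) ^
            (-((d : ℝ) / 2) * ((1 / p).toReal - (1 / q).toReal))) *
        eLpNorm (μ 0) p volume := by
  obtain ⟨A, U, L, hU, hL, h⟩ := hμ.isAdvectionDiffusion hg hs hsd hMg hpos t
  obtain ⟨_, B, _, _, hB⟩ := hμ.exists_bounds t
  have hq : 1 ≤ q := hp.trans hpq
  have hpt : 1 / p ≤ 1 := by rw [one_div]; exact ENNReal.inv_le_one.2 hp
  have hqp : 1 / q ≤ 1 / p := by
    rw [one_div, one_div]; exact ENNReal.inv_le_inv.2 hpq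
  have hpf : 1 / p ≠ ⊤ := (hpt.trans_lt ENNReal.one_lt_top).ne
  have hqf : 1 / q ≠ ⊤ := ((hqp.trans hpt).trans_lt ENNReal.one_lt_top).ne
  have key := h.eLpNorm_le_of_le ht hσ hU hL (fun t ht => (hB t ht).2)
    (x := (1 / p).toReal) (y := (1 / q).toReal) ENNReal.toReal_nonneg
    (ENNReal.toReal_mono hpf hqp) (by simpa using ENNReal.toReal_mono ENNReal.one_ne_top hpt)
  rw [ENNReal.ofReal_toReal hpf, ENNReal.ofReal_toReal hqf, one_div, one_div, inv_inv, inv_inv,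
    ← one_div, ← one_div, MeanField.smoothingConst, ← MeanField.K_eq_conjRatio hp,
    ← MeanField.K_eq_conjRatio hq] at key
  rwa [show 4 * Real.pi * σ * t = 4 * Real.pi * (t * σ) by ring]
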